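/- **Setting.** Let $U\subseteq\mathbb R^d$ be open and let $f:U\to\mathbb R$ be differentiable, bounded below and closed (every sublevel set $\{x\in U: f(x)\le a\}$ is closed in $\mathbb R^d$; this is automatic if $U=\mathbb R^d$). Let $0\le\rho<2$, $L_0,L_\rho\ge 0$, $\sigma\ge0$. A function $h:U\to\mathbb R$ is called *$(L_0,L_\rho)$-smooth* if it is twice differentiable on $U$ and $\|\nabla^2h(x)\|\le L_0+L_\rho\|\nabla h(x)\|^\rho$ for almost every $x\in U$ (spectral and Euclidean norm). Let $\mathsf P$ be a probability distribution on a space $\Xi$ and let $f(\cdot,\xi):U\to\mathbb R$, $\xi\in\Xi$, be component functions. Assume that $f$ and every $f(\cdot,\xi)$ are $(L_0,L_\rho)$-smooth, and that for every $x\in U$ $$\mathbb E_{\xi\sim\mathsf P}[\nabla f(x,\xi)]=\nabla f(x),\qquad \|\nabla f(x,\xi)-\nabla f(x)\|\le\sigma\quad\text{for $\mathsf P$-almost every }\xi .$$ **Algorithm (VRAdam)** with inputs $\beta,\beta_2,\eta,\lambda,T,S_1$ and $x_1\in U$; vector operations are coordinate-wise. Draw a batch $\mathcal S_1$ of $S_1$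 samples, let $m_1$ be the average of $\nabla f(x_1,\xi)$ over $\xi\in\mathcal S_1$, $v_1=\beta_2m_1^2$, and $x_2=x_1-\eta m_1/(|m_1|+\lambda)$. For $t=2,\dots,T$ draw a new sample $\xi_t$ and set $$m_t=(1-\beta)m_{t-1}+\beta\nabla f(x_t,\xi_t)+(1-\beta)\big(\nabla f(x_t,\xi_t)-\nabla f(x_{t-1},\xi_t)\big),$$ $$v_t=(1-\beta_2)v_{t-1}+\beta_2(\nabla f(x_t,\xi_t))^2,\quad \hat v_t=\frac{v_t}{1-(1-\beta_2)^t},\quad x_{t+1}=x_t-\frac{\eta}{\sqrt{\hat v_t}+\lambda}\odot m_t .$$ All samples (the batch and $\xi_2,\dots,\xi_T$) are i.i.d. with law $\mathsf P$. The algorithm evaluates $S_1+2(T-1)$ stochastic gradients. **Parameters.** Let $\Delta_1=f(x_1)-\inf_Uf$. For $G>0$ let $L=3L_0+4L_\rho G^\rho$ and $r=\min\big\{\frac1{5L_\rho G^{\rho-1}},\frac1{5(L_0^{\rho-1}L_\rho)^{1/\rho}}\big\}$, where the second term is omitted if $\rho=0$ or $L_0=0$. Quotients with denominator $0$ in the conditions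 on $\beta_2$, $\eta$ and in $r$ are read as $+\infty$. Given numbers $c,C>0$, $0<\delta<1$ and $\epsilon>0$, the choice of $G,\lambda,\beta_2,\beta,\eta,T,S_1$ is called *admissible* if $G,\lambda,\eta>0$, $$G\ge\max\Big\{2\lambda,\,2\sigma,\,2\|\nabla f(x_1)\|,\,\sqrt{\tfrac{C\Delta_1L_0\sqrt d}{\sqrt{\beta_2}\,\delta}},\,\Big(\tfrac{C\Delta_1L_\rho\sqrt d}{\sqrt{\beta_2}\,\delta}\Big)^{\frac1{2-\rho}}\Big\},$$ $$0<\beta_2\le 1,\qquad \sqrt{\beta_2}\le\frac{\lambda}{2\sigma},\qquad \beta=\theta^2\eta^2\le1\ \text{ with }\ \theta=40L\sqrt G\,\lambda^{-3/2},$$ $$\eta\le c\min\Big\{r\sqrt{\tfrac{\beta_2}d},\ \tfrac GL\sqrt{\tfrac{\beta_2}d},\ \tfrac\lambda L,\ \tfrac{\lambda^4d\,\delta}{\beta_2\Delta_1L^2},\ \tfrac{\lambda^2\sqrt\delta\,\epsilon}{\sigma GL}\Big\},\qquad T=\Big\lceil\frac{C\,G\Delta_1}{\eta\delta\epsilon^2}\Big\rceil,\qquad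 S_1\ge\max\Big\{1,\frac1{2\beta^2T}\Big\}$$ (the last lower bound being just $S_1\ge1$ in the degenerate case $\beta^2T=0$). **Theorem.** There are numerical constants $c,C>0$ such that the following holds. 1. In the above setting, for every $0<\delta<1$, every $\epsilon>0$ and every admissible choice of the parameters, with probability at least $1-\delta$ we have $$x_t\in U\ \text{ and }\ \|\nabla f(x_t)\|\le G\quad\text{for all }1\le t\le T,\qquad\text{and}\qquad \frac1T\sum_{t=1}^T\|\nabla f(x_t)\|^2\le\epsilon^2 .$$ 2. (Gradient complexity $\mathcal O(d^{\frac{2+\rho}{2(2-\rho)}}\epsilon^{-3})$.) For all fixed values of $L_0,L_\rho,\rho,\sigma,\Delta_1,\|\nabla f(x_1)\|,\delta,\lambda,\beta_2$ (with $0<\beta_2\le1$, $\sqrt{\beta_2}\le\frac\lambda{2\sigma}$) there is a constant $K$, depending on these values but not on $d$ and $\epsilon$, such that for every $d\ge1$ and all sufficiently small $\epsilon>0$ (how small may depend on $d$) there is an admissible choice of $G,\beta,\eta,T,S_1$ with $$S_1+2(T-1)\le K\,d^{\frac{2+\rho}{2(2-\rho)}}\,\epsilon^{-3}.$$ -/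

import Mathlib

open MeasureTheory ProbabilityTheory
open scoped ENNReal

/-! ### Function class -/

/-- `f` is `(L₀, Lρ)`-smooth (with exponent `ρ`) on the open set `U`: it is twice differentiable at
every point of `U`, and for almost every `x ∈ U` the spectral norm of the Hessian is at most
`L₀ + Lρ ‖∇f(x)‖ ^ ρ`. -/
structure IsGenSmoothOn {d : ℕ} (U : Set (EuclideanSpace ℝ (Fin d)))
    (f : EuclideanSpace ℝ (Fin d) → ℝ) (L₀ Lρ ρ : ℝ) : Prop where
  differentiableOn : DifferentiableOn ℝ f U
  differentiableOn_gradient : DifferentiableOn ℝ (gradient f) U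
  hessian_le : ∀ᵐ x ∂(volume.restrict U),
    ‖fderiv ℝ (gradient f) x‖ ≤ L₀ + Lρ * ‖gradient f x‖ ^ ρ

/-- Standing assumptions on the objective `f` with domain `U`: the domain is open, `f` is
differentiable on it and bounded below on it, and `f` is a closed function, i.e. its sublevel sets
are closed in `ℝ^d` (this is automatic if `U = ℝ^d`). Values of `f` outside `U` play no role. -/
structure IsObjective {d : ℕ} (U : Set (EuclideanSpace ℝ (Fin d)))
    (f : EuclideanSpace ℝ (Fin d) → ℝ) : Prop where
  isOpen : IsOpen U
  differentiableOn : DifferentiableOn ℝ f U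
  bddBelow : BddBelow (f '' U)
  isClosed_sublevel : ∀ a : ℝ, IsClosed {x ∈ U | f x ≤ a}

/-- The stochastic gradient `∇F(x, ξ)`, the gradient in the first argument. -/
noncomputable def stochGrad {d : ℕ} {Ξ : Type*} (F : EuclideanSpace ℝ (Fin d) → Ξ → ℝ)
    (x : EuclideanSpace ℝ (Fin d)) (ξ : Ξ) : EuclideanSpace ℝ (Fin d) :=
  gradient (fun y => F y ξ) x

/-- Under the sampling distribution `P`, the stochastic gradient is at every point of the domain
unbiased, and its noise is almost surely bounded by `σ`. -/
structure IsBoundedNoise {d : ℕ} {Ξ : Type*} [MeasurableSpace Ξ]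
    (U : Set (EuclideanSpace ℝ (Fin d))) (f : EuclideanSpace ℝ (Fin d) → ℝ)
    (F : EuclideanSpace ℝ (Fin d) → Ξ → ℝ) (P : Measure Ξ) (σ : ℝ) : Prop where
  measurable : ∀ x ∈ U, Measurable (stochGrad F x)
  unbiased : ∀ x ∈ U, ∫ ξ, stochGrad F x ξ ∂P = gradient f x
  bounded : ∀ x ∈ U, ∀ᵐ ξ ∂P, ‖stochGrad F x ξ - gradient f x‖ ≤ σ

/-! ### The algorithm -/

/-- The numerical inputs of VRAdam. -/
structure VRAdamInput where
  /-- momentum parameter -/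
  β : ℝ
  /-- second order momentum parameter -/
  β₂ : ℝ
  /-- step size -/
  η : ℝ
  /-- the regularizer `λ` in the denominator -/
  lam : ℝ
  /-- number of iterations -/
  T : ℕ
  /-- size of the initial mega-batch -/
  S₁ : ℕ

/-- The quantities held at the end of iteration `t`: `x = x_t`, `xNext = x_{t+1}`, `m = m_t`,
`v = v_t`. -/
structure VRAdamState (d : ℕ) where
  x : EuclideanSpace ℝ (Fin d)
  xNext : EuclideanSpace ℝ (Fin d)
  m : EuclideanSpace ℝ (Fin d)
  v : EuclideanSpace ℝ (Fin d)

/-- Iteration `1`: the mega-batch `ζ` gives `m₁`, the average of the stochastic gradients at `x₁`;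
`v₁ = β₂ m₁²` and `x₂ = x₁ - η m₁ / (|m₁| + λ)`, coordinate-wise. -/
noncomputable def vrAdamInit {d : ℕ} {Ξ : Type*} (p : VRAdamInput)
    (g : EuclideanSpace ℝ (Fin d) → Ξ → EuclideanSpace ℝ (Fin d))
    (x₁ : EuclideanSpace ℝ (Fin d)) (ζ : Fin p.S₁ → Ξ) : VRAdamState d :=
  let m : EuclideanSpace ℝ (Fin d) := (1 / (p.S₁ : ℝ)) • ∑ i, g x₁ (ζ i)
  { x := x₁
    xNext := WithLp.toLp 2 fun i => x₁ i - p.η * m i / (|m i| + p.lam)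
    m := m
    v := WithLp.toLp 2 fun i => p.β₂ * m i ^ 2 }

/-- Iteration `t ≥ 2`, from the state `s` at the end of iteration `t - 1` and the new sample
`ξ = ξ_t`. -/
noncomputable def vrAdamStep {d : ℕ} {Ξ : Type*} (p : VRAdamInput)
    (g : EuclideanSpace ℝ (Fin d) → Ξ → EuclideanSpace ℝ (Fin d))
    (t : ℕ) (s : VRAdamState d) (ξ : Ξ) : VRAdamState d :=
  let x := s.xNext
  let m : EuclideanSpace ℝ (Fin d) :=
    (1 - p.β) • s.m + p.β • g x ξ + (1 - p.β) • (g x ξ - g s.x ξ)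
  let v : EuclideanSpace ℝ (Fin d) :=
    WithLp.toLp 2 fun i => (1 - p.β₂) * s.v i + p.β₂ * (g x ξ i) ^ 2
  let vHat : EuclideanSpace ℝ (Fin d) :=
    WithLp.toLp 2 fun i => v i / (1 - (1 - p.β₂) ^ t)
  { x := x
    xNext := WithLp.toLp 2 fun i => x i - p.η / (√(vHat i) + p.lam) * m i
    m := m
    v := v }

/-- The state at the end of iteration `k + 1`; iteration `t ≥ 2` uses the sample `ξ t`. -/
noncomputable def vrAdamState {d : ℕ} {Ξ : Type*} (p : VRAdamInput)
    (g : EuclideanSpace ℝ (Fin d) → Ξ → EuclideanSpace ℝ (Fin d))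
    (x₁ : EuclideanSpace ℝ (Fin d)) (ζ : Fin p.S₁ → Ξ) (ξ : ℕ → Ξ) : ℕ → VRAdamState d
  | 0 => vrAdamInit p g x₁ ζ
  | k + 1 => vrAdamStep p g (k + 2) (vrAdamState p g x₁ ζ ξ k) (ξ (k + 2))

/-- The iterate `x_t` of VRAdam, for `t ≥ 1`. -/
noncomputable def vrAdamIterate {d : ℕ} {Ξ : Type*} (p : VRAdamInput)
    (g : EuclideanSpace ℝ (Fin d) → Ξ → EuclideanSpace ℝ (Fin d))
    (x₁ : EuclideanSpace ℝ (Fin d)) (ζ : Fin p.S₁ → Ξ) (ξ : ℕ → Ξ) (t : ℕ) :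
    EuclideanSpace ℝ (Fin d) :=
  (vrAdamState p g x₁ ζ ξ (t - 1)).x

/-- The number of stochastic gradients that VRAdam evaluates: `S₁` in the mega-batch, and two (at
`x_t` and at `x_{t-1}`) in each iteration `t = 2, …, T`. -/
def VRAdamInput.gradientEvals (p : VRAdamInput) : ℕ := p.S₁ + 2 * (p.T - 1)

/-- All the samples, i.e. the mega-batch `ζ` together with `ξ_2, …, ξ_T`, are i.i.d. with law `P`. -/
structure IsIIDSampling {Ω Ξ : Type*} [MeasurableSpace Ω] [MeasurableSpace Ξ] (μ : Measure Ω)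
    (P : Measure Ξ) (S₁ T : ℕ) (ζ : Fin S₁ → Ω → Ξ) (ξ : ℕ → Ω → Ξ) : Prop where
  measurable_batch : ∀ i, Measurable (ζ i)
  measurable_sample : ∀ t ∈ Finset.Icc 2 T, Measurable (ξ t)
  law_batch : ∀ i, μ.map (ζ i) = P
  law_sample : ∀ t ∈ Finset.Icc 2 T, μ.map (ξ t) = P
  indep : iIndepFun (Sum.elim ζ fun t : Finset.Icc 2 T => ξ t) μ

/-! ### The choice of parameters -/

/-- The quotient `a / b` of non-negative reals with `a / 0 = ∞` for `a > 0`. -/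
noncomputable def extDiv (a b : ℝ) : ℝ≥0∞ := ENNReal.ofReal a / ENNReal.ofReal b

/-- `L = 3 L₀ + 4 Lρ G^ρ`. -/
noncomputable def effSmooth (L₀ Lρ ρ G : ℝ) : ℝ := 3 * L₀ + 4 * Lρ * G ^ ρ

/-- `r = min {1 / (5 Lρ G^(ρ-1)), 1 / (5 (L₀^(ρ-1) Lρ)^(1/ρ))}`, with `1 / 0 = ∞`. The second term
is absent if `ρ = 0` or `L₀ = 0`, where its formula has no meaning. -/
noncomputable def localRadius (L₀ Lρ ρ G : ℝ) : ℝ≥0∞ :=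
  min (extDiv 1 (5 * Lρ * G ^ (ρ - 1)))
    (if ρ = 0 ∨ L₀ = 0 then ⊤ else extDiv 1 (5 * (L₀ ^ (ρ - 1) * Lρ) ^ (1 / ρ)))

/-- The minimum of five terms that bounds the step size up to the factor `c`. -/
noncomputable def stepBound (d : ℕ) (L₀ Lρ ρ σ Δ₁ δ ε G lam β₂ : ℝ) : ℝ≥0∞ :=
  let L := effSmooth L₀ Lρ ρ G
  min (localRadius L₀ Lρ ρ G * ENNReal.ofReal √(β₂ / d)) <|
  min (extDiv (G * √(β₂ / d)) L) <|
  min (extDiv lam L) <|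
  min (extDiv (lam ^ 4 * d * δ) (β₂ * Δ₁ * L ^ 2))
    (extDiv (lam ^ 2 * √δ * ε) (σ * G * L))

/-- The conditions on `G` and on the inputs of VRAdam. Here `Δ₁` is the initial suboptimality gap,
`g₁` the initial gradient norm, and `c`, `C` are the numerical constants. -/
structure IsAdmissible (c C : ℝ) (d : ℕ) (L₀ Lρ ρ σ Δ₁ g₁ δ ε G : ℝ) (p : VRAdamInput) :
    Prop where
  lam_pos : 0 < p.lam
  G_pos : 0 < G
  lam_le : 2 * p.lam ≤ G
  sigma_le : 2 * σ ≤ G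
  grad_le : 2 * g₁ ≤ G
  L₀_le : √(C * Δ₁ * L₀ * √d / (√p.β₂ * δ)) ≤ G
  Lρ_le : (C * Δ₁ * Lρ * √d / (√p.β₂ * δ)) ^ (1 / (2 - ρ)) ≤ G
  β₂_pos : 0 < p.β₂
  β₂_le_one : p.β₂ ≤ 1
  /-- `√β₂ ≤ λ / (2σ)`, which is no condition if `σ = 0` -/
  sqrt_β₂_le : 2 * σ * √p.β₂ ≤ p.lam
  /-- `β = θ² η²` with `θ = 40 L √G λ^(-3/2)` -/
  β_eq : p.β = (40 * effSmooth L₀ Lρ ρ G * √G * p.lam ^ (-(3 / 2) : ℝ)) ^ 2 * p.η ^ 2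
  β_le_one : p.β ≤ 1
  η_pos : 0 < p.η
  η_le : ENNReal.ofReal p.η ≤
    ENNReal.ofReal c * stepBound d L₀ Lρ ρ σ Δ₁ δ ε G p.lam p.β₂
  T_eq : p.T = ⌈C * G * Δ₁ / (p.η * δ * ε ^ 2)⌉₊
  S₁_pos : 1 ≤ p.S₁
  S₁_ge : 1 / (2 * p.β ^ 2 * p.T) ≤ (p.S₁ : ℝ)

/-!
The effective constant `L` bounds the Hessian wherever the gradient is at most `2 G`. Hence short
steps from a point with gradient at most `G` stay in `U`, and `f` is `L`-smooth along them; moreover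
a suboptimality gap of at most `G² / (6 L)` forces the gradient to be at most `G`.

Let `e = m - ∇f(x)` be the estimation error. Along a step, `f` decreases up to a multiple of `‖e‖²`.
The momentum contracts `e` by the factor `1 - β` and adds noise of zero mean and of second moment
at most of the order of `L²` times the squared step plus `β² σ²`; the choice of `β` is such that the
descent pays for the first of these. So the sum of the gap and of `η / (λ β) ‖e‖²` is a Lyapunov
function: each step decreases it in expectation by a multiple of `‖∇f‖²`, up to a term of the order
of `η β σ² / λ`.

All this requires control of the gradient and of the error, and is therefore applied only up to the
first time that the gap exceeds `G² / (6 L)`, or that the part of `e` produced by differences of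
noises at consecutive iterates exceeds `λ √(d / β₂) / 2`. By Markov's inequality, the first is
unlikely since the gap is part of the Lyapunov function, and the second is unlikely because of a
bound on the sixth moment. If neither happens, Markov's inequality for the sum of `‖∇f‖²` concludes.

For the complexity, take `η` proportional to `ε`, so that `T` is of order `ε⁻³`, and `G`
proportional to `d ^ (1 / (2 (2 - ρ)))`.
-/

/-! ### Almost everywhere bounds on a derivative -/

theorem norm_sub_le_of_ae_norm_deriv_le {F : Type*} [NormedAddCommGroup F] [NormedSpace ℝ F]
    [CompleteSpace F] {γ γ' : ℝ → F} {M : ℝ}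
    (hγ : ∀ t ∈ Set.Icc (0 : ℝ) 1, HasDerivAt γ (γ' t) t)
    (hM : ∀ᵐ t : ℝ, t ∈ Set.Icc (0 : ℝ) 1 → ‖γ' t‖ ≤ M) : ‖γ 1 - γ 0‖ ≤ M := by
  have hbound : ∀ᵐ t : ℝ, t ∈ Set.uIoc (0 : ℝ) 1 → ‖deriv γ t‖ ≤ M := by
    filter_upwards [hM] with t ht hmem
    rw [Set.uIoc_of_le zero_le_one] at hmem
    have hIcc := Set.Ioc_subset_Icc_self hmem
    simpa only [(hγ t hIcc).deriv] using ht hIcc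
  have hint : IntervalIntegrable (deriv γ) volume 0 1 :=
    (intervalIntegrable_const (c := M)).mono_fun (aestronglyMeasurable_deriv γ _) <|
      (ae_restrict_iff' measurableSet_uIoc).2 <| hbound.mono fun t ht hmem =>
        (ht hmem).trans (le_abs_self M)
  have hFTC : ∫ t in (0 : ℝ)..1, deriv γ t = γ 1 - γ 0 :=
    intervalIntegral.integral_eq_sub_of_hasDerivAt (fun t ht => by
      rw [Set.uIcc_of_le zero_le_one] at ht
      exact (hγ t ht).differentiableAt.hasDerivAt) hint
  simpa [hFTC] using intervalIntegral.norm_integral_le_of_norm_le_const_ae hbound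

theorem hasDerivAt_comp_add_smul {E : Type*} [NormedAddCommGroup E] [NormedSpace ℝ E]
    {F : Type*} [NormedAddCommGroup F] [NormedSpace ℝ F] {g : E → F} {x v : E} {t : ℝ}
    (hg : DifferentiableAt ℝ g (x + t • v)) :
    HasDerivAt (fun t : ℝ => g (x + t • v)) (fderiv ℝ g (x + t • v) v) t := by
  have hline : HasDerivAt (fun t : ℝ => x + t • v) v t := by
    simpa using ((hasDerivAt_id t).smul_const v).const_add x
  exact hg.hasFDerivAt.comp_hasDerivAt t hline

section AlmostEverywhere

variable {E : Type*} [NormedAddCommGroup E] [NormedSpace ℝ E] [FiniteDimensional ℝ E]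
  [MeasurableSpace E] [BorelSpace E] (μ : Measure E) [μ.IsAddHaarMeasure]

theorem ae_ae_add_smul {p : E → Prop} (hp : ∀ᵐ x ∂μ, p x) (v : E) :
    ∀ᵐ y ∂μ, ∀ᵐ t : ℝ, p (y + t • v) := by
  obtain ⟨s, hs, hsm, hs0⟩ := exists_measurable_superset_of_null (ae_iff.1 hp)
  have hq : ∀ᵐ x ∂μ, x ∉ s := measure_eq_zero_iff_ae_notMem.1 hs0
  have hmeas : MeasurableSet {z : E × ℝ | z.1 + z.2 • v ∉ s} := by
    have : Measurable fun z : E × ℝ => z.1 + z.2 • v := by fun_prop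
    exact this hsm.compl
  have h := (Measure.ae_ae_comm (μ := μ) (ν := (volume : Measure ℝ))
    (p := fun y t => y + t • v ∉ s) hmeas).2 (Filter.Eventually.of_forall fun t =>
      (measurePreserving_add_right μ (t • v)).quasiMeasurePreserving.ae hq)
  filter_upwards [h] with y hy
  filter_upwards [hy] with t ht
  exact not_not.1 fun hnot => ht (hs hnot)

variable {F : Type*} [NormedAddCommGroup F] [NormedSpace ℝ F] [CompleteSpace F] {g : E → F}

/- By Fubini the bound holds almost everywhere on almost every parallel translate of the segment;
the estimate passes to the segment itself by continuity. -/
theorem norm_image_sub_le_of_ae_norm_fderiv_le {s : Set E} (hs : IsOpen s) (hconv : Convex ℝ s)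
    (hg : DifferentiableOn ℝ g s) {C : ℝ} (hC : ∀ᵐ x ∂μ, x ∈ s → ‖fderiv ℝ g x‖ ≤ C)
    {x y : E} (hx : x ∈ s) (hy : y ∈ s) : ‖g y - g x‖ ≤ C * ‖y - x‖ := by
  obtain ⟨v, rfl⟩ : ∃ v, y = x + v := ⟨y - x, by abel⟩
  have hdiff : ∀ z ∈ s, DifferentiableAt ℝ g z := fun z hz => hg.differentiableAt (hs.mem_nhds hz)
  have hsegment : ∀ z ∈ s, z + v ∈ s →
      (∀ᵐ t : ℝ, z + t • v ∈ s → ‖fderiv ℝ g (z + t • v)‖ ≤ C) → ‖g (z + v) - g z‖ ≤ C * ‖v‖ := by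
    intro z hz hzv hae
    have hmem : ∀ t ∈ Set.Icc (0 : ℝ) 1, z + t • v ∈ s := fun t ht =>
      hconv.add_smul_mem hz hzv ht
    simpa using norm_sub_le_of_ae_norm_deriv_le
      (fun t ht => hasDerivAt_comp_add_smul (hdiff _ (hmem t ht)))
      (hae.mono fun t ht h01 => (fderiv ℝ g (z + t • v)).le_of_opNorm_le (ht (hmem t h01)) v)
  have hcont : ContinuousAt (fun z => ‖g (z + v) - g z‖) x :=
    ((ContinuousAt.comp (f := fun z => z + v) (hdiff _ hy).continuousAt (by fun_prop)).sub
      (hdiff _ hx).continuousAt).norm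
  have hnear : ∀ᶠ z in nhds x, z ∈ s ∧ z + v ∈ s :=
    (hs.eventually_mem hx).and <|
      (by fun_prop : ContinuousAt (fun z => z + v) x).eventually_mem (hs.mem_nhds hy)
  have hdense := mem_closure_iff_frequently.1 (Measure.dense_of_ae (ae_ae_add_smul μ hC v) x)
  rw [add_sub_cancel_left]
  exact le_of_tendsto_of_frequently hcont
    ((hdense.and_eventually hnear).mono fun z hz => hsegment z hz.2.1 hz.2.2 hz.1)

theorem norm_fderiv_le_of_ae_le {U : Set E} (hU : IsOpen U) (hg : DifferentiableOn ℝ g U)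
    {φ : E → ℝ} (hφ : ContinuousOn φ U) (h : ∀ᵐ x ∂(μ.restrict U), ‖fderiv ℝ g x‖ ≤ φ x)
    {x : E} (hx : x ∈ U) : ‖fderiv ℝ g x‖ ≤ φ x := by
  have hae : ∀ᵐ z ∂μ, z ∈ U → ‖fderiv ℝ g z‖ ≤ φ z := (ae_restrict_iff' hU.measurableSet).1 h
  refine le_of_forall_pos_le_add fun e he => ?_
  have hnear : ∀ᶠ z in nhds x, z ∈ U ∧ φ z < φ x + e :=
    (hU.eventually_mem hx).and <|
      (hφ.continuousAt (hU.mem_nhds hx)).eventually (gt_mem_nhds (lt_add_of_pos_right _ he))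
  obtain ⟨r, hr, hball⟩ := Metric.eventually_nhds_iff_ball.1 hnear
  have hae_ball : ∀ᵐ z ∂μ, z ∈ Metric.ball x r → ‖fderiv ℝ g z‖ ≤ φ x + e :=
    hae.mono fun z hz hmem => (hz (hball z hmem).1).trans (hball z hmem).2.le
  have hnonneg : 0 ≤ φ x + e := by
    obtain ⟨z, hz, hmem⟩ := (Measure.dense_of_ae hae_ball).exists_mem_open Metric.isOpen_ball
      ⟨x, Metric.mem_ball_self hr⟩
    exact (norm_nonneg _).trans (hz hmem)
  refine norm_fderiv_le_of_lip' ℝ hnonneg ?_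
  filter_upwards [Metric.ball_mem_nhds x hr] with z hz
  exact norm_image_sub_le_of_ae_norm_fderiv_le μ Metric.isOpen_ball (convex_ball x r)
    (hg.mono fun z hz => (hball z hz).1) hae_ball (Metric.mem_ball_self hr) hz

end AlmostEverywhere

/-! ### Local smoothness of the objective and of its components -/

/-- `L` strictly dominates the Hessian bound of `(L₀, Lρ)`-smooth functions wherever the gradient is
at most `2 G`, so that it serves as a Lipschitz constant of the gradient there. -/
structure IsEffSmooth (L₀ Lρ ρ G L : ℝ) : Prop where
  Lρ_nonneg : 0 ≤ Lρ
  ρ_nonneg : 0 ≤ ρ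
  G_pos : 0 < G
  L_pos : 0 < L
  hessian_bound_lt : L₀ + Lρ * (2 * G) ^ ρ < L

theorem nonpos_of_forall_pos_le_mul {a b : ℝ} (h : ∀ L : ℝ, 0 < L → a ≤ L * b) : a ≤ 0 := by
  have hlim : Filter.Tendsto (fun L : ℝ => L * b) (nhdsWithin 0 (Set.Ioi 0)) (nhds 0) := by
    simpa using ((Filter.tendsto_id (α := ℝ)).mul_const b).mono_left
      (nhdsWithin_le_nhds (a := 0) (s := Set.Ioi 0))
  exact ge_of_tendsto hlim (eventually_mem_nhdsWithin.mono h)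

theorem exists_first_exit {E : Type*} [AddCommGroup E] [Module ℝ E] [TopologicalSpace E]
    [ContinuousAdd E] [ContinuousSMul ℝ E] {U : Set E} (hU : IsOpen U) {x v : E} (hx : x ∈ U)
    {b : ℝ} (hb : 0 ≤ b) (hexit : x + b • v ∉ U) :
    ∃ t ∈ Set.Ioc 0 b, x + t • v ∉ U ∧ ∀ u ∈ Set.Ico 0 t, x + u • v ∈ U := by
  have hcont : Continuous fun t : ℝ => x + t • v := by fun_prop
  have hcompact : IsCompact (Set.Icc 0 b ∩ (fun t : ℝ => x + t • v) ⁻¹' Uᶜ) :=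
    isCompact_Icc.inter_right (hU.isClosed_compl.preimage hcont)
  obtain ⟨t, ⟨ht, htU⟩, hmin⟩ := hcompact.exists_isLeast ⟨b, ⟨hb, le_rfl⟩, hexit⟩
  have ht0 : t ≠ 0 := by
    rintro rfl
    exact htU (by simpa using hx)
  refine ⟨t, ⟨lt_of_le_of_ne ht.1 ht0.symm, ht.2⟩, htU, fun u hu => ?_⟩
  by_contra huU
  exact (hmin ⟨⟨hu.1, hu.2.le.trans ht.2⟩, huU⟩).not_gt hu.2

section LocalSmoothness

variable {d : ℕ} {U : Set (EuclideanSpace ℝ (Fin d))} {f h : EuclideanSpace ℝ (Fin d) → ℝ}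
  {x v : EuclideanSpace ℝ (Fin d)} {L₀ Lρ ρ G L : ℝ}

theorem IsGenSmoothOn.norm_hessian_le (hh : IsGenSmoothOn U h L₀ Lρ ρ) (hU : IsOpen U) (hρ : 0 ≤ ρ)
    (hx : x ∈ U) : ‖fderiv ℝ (gradient h) x‖ ≤ L₀ + Lρ * ‖gradient h x‖ ^ ρ :=
  norm_fderiv_le_of_ae_le volume hU hh.differentiableOn_gradient
    (φ := fun x => L₀ + Lρ * ‖gradient h x‖ ^ ρ)
    (continuousOn_const.add <| continuousOn_const.mul <|
      hh.differentiableOn_gradient.continuousOn.norm.rpow_const fun _ _ => Or.inr hρ)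
    hh.hessian_le hx

theorem IsGenSmoothOn.norm_hessian_lt (hh : IsGenSmoothOn U h L₀ Lρ ρ) (hU : IsOpen U)
    (hL : IsEffSmooth L₀ Lρ ρ G L) (hxU : x ∈ U) (hx : ‖gradient h x‖ ≤ 2 * G) :
    ‖fderiv ℝ (gradient h) x‖ < L :=
  calc ‖fderiv ℝ (gradient h) x‖ ≤ L₀ + Lρ * ‖gradient h x‖ ^ ρ :=
        hh.norm_hessian_le hU hL.ρ_nonneg hxU
    _ ≤ L₀ + Lρ * (2 * G) ^ ρ := by
        have := hL.Lρ_nonneg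
        have := hL.ρ_nonneg
        gcongr
    _ < L := hL.hessian_bound_lt

/- A bootstrap: while the gradient has moved by at most `L ‖v‖ ≤ G / 2` it stays below `2 G`, and
there its speed is less than `L ‖v‖`. -/
theorem IsGenSmoothOn.norm_gradient_add_smul_sub_le (hh : IsGenSmoothOn U h L₀ Lρ ρ)
    (hU : IsOpen U) (hL : IsEffSmooth L₀ Lρ ρ G L)
    (hseg : ∀ t ∈ Set.Icc (0 : ℝ) 1, x + t • v ∈ U) (hx : ‖gradient h x‖ ≤ 3 / 2 * G)
    (hv : ‖v‖ ≤ G / (2 * L)) {t : ℝ} (ht : t ∈ Set.Icc (0 : ℝ) 1) :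
    ‖gradient h (x + t • v) - gradient h x‖ ≤ L * ‖v‖ * t := by
  have hLpos := hL.L_pos
  rcases eq_or_ne v 0 with rfl | hv0
  · simp
  have hLv : L * ‖v‖ ≤ G / 2 := by
    rw [le_div_iff₀ (by positivity)] at hv; linarith
  have hder : ∀ t ∈ Set.Icc (0 : ℝ) 1,
      HasDerivAt (fun t : ℝ => gradient h (x + t • v) - gradient h x)
        (fderiv ℝ (gradient h) (x + t • v) v) t := fun t ht =>
    (hasDerivAt_comp_add_smul <|
      hh.differentiableOn_gradient.differentiableAt (hU.mem_nhds (hseg t ht))).sub_const _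
  refine image_norm_le_of_norm_deriv_right_lt_deriv_boundary'
    (B := fun t => L * ‖v‖ * t) (B' := fun _ => L * ‖v‖)
    (fun t ht => (hder t ht).continuousAt.continuousWithinAt)
    (fun t ht => (hder t (Set.Ico_subset_Icc_self ht)).hasDerivWithinAt) (by simp)
    (by fun_prop) (fun t _ => ?_) (fun t ht hmoved => ?_) ht
  · simpa using ((hasDerivAt_id t).const_mul (L * ‖v‖)).hasDerivWithinAt
  · have hbelow : ‖gradient h (x + t • v)‖ ≤ 2 * G := by
      have hmove : L * ‖v‖ * t ≤ L * ‖v‖ := mul_le_of_le_one_right (by positivity) ht.2.le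
      linarith [norm_le_norm_add_norm_sub' (gradient h (x + t • v)) (gradient h x)]
    have hspeed := hh.norm_hessian_lt hU hL (hseg t (Set.Ico_subset_Icc_self ht)) hbelow
    exact (ContinuousLinearMap.le_opNorm _ _).trans_lt
      (mul_lt_mul_of_pos_right hspeed (norm_pos_iff.2 hv0))

theorem IsGenSmoothOn.abs_sub_sub_inner_le_of_segment (hh : IsGenSmoothOn U h L₀ Lρ ρ)
    (hU : IsOpen U) (hL : IsEffSmooth L₀ Lρ ρ G L)
    (hseg : ∀ t ∈ Set.Icc (0 : ℝ) 1, x + t • v ∈ U) (hx : ‖gradient h x‖ ≤ 3 / 2 * G)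
    (hv : ‖v‖ ≤ G / (2 * L)) :
    |h (x + v) - h x - inner ℝ (gradient h x) v| ≤ L * ‖v‖ ^ 2 := by
  have hLpos := hL.L_pos
  have hsegment : ∀ z ∈ segment ℝ x (x + v), ∃ t ∈ Set.Icc (0 : ℝ) 1, z = x + t • v := by
    intro z hz
    rw [segment_eq_image'] at hz
    obtain ⟨t, ht, rfl⟩ := hz
    exact ⟨t, ht, by simp⟩
  have hdiff : ∀ z ∈ segment ℝ x (x + v), DifferentiableAt ℝ h z := fun z hz => by
    obtain ⟨t, ht, rfl⟩ := hsegment z hz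
    exact hh.differentiableOn.differentiableAt (hU.mem_nhds (hseg t ht))
  have hfderiv : ∀ z ∈ segment ℝ x (x + v), ‖fderiv ℝ h z - fderiv ℝ h x‖ ≤ L * ‖v‖ := by
    intro z hz
    obtain ⟨t, ht, rfl⟩ := hsegment z hz
    calc ‖fderiv ℝ h (x + t • v) - fderiv ℝ h x‖
        = ‖gradient h (x + t • v) - gradient h x‖ := by
          rw [gradient, gradient, ← map_sub, LinearIsometryEquiv.norm_map]
      _ ≤ L * ‖v‖ * t := hh.norm_gradient_add_smul_sub_le hU hL hseg hx hv ht
      _ ≤ L * ‖v‖ := mul_le_of_le_one_right (by positivity) ht.2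
  have hmean := (convex_segment x (x + v)).norm_image_sub_le_of_norm_fderiv_le' hdiff hfderiv
    (left_mem_segment _ _ _) (right_mem_segment _ _ _)
  have hinner : fderiv ℝ h x v = inner ℝ (gradient h x) v := by simp [gradient]
  rw [add_sub_cancel_left, hinner, Real.norm_eq_abs] at hmean
  linarith

/- Up to the first exit from `U` the objective stays bounded along the segment, and sublevel sets
are closed, so there is no exit. -/
theorem IsObjective.add_smul_mem (hf : IsObjective U f) (hfs : IsGenSmoothOn U f L₀ Lρ ρ)
    (hL : IsEffSmooth L₀ Lρ ρ G L) (hxU : x ∈ U) (hx : ‖gradient f x‖ ≤ 3 / 2 * G)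
    (hv : ‖v‖ ≤ G / (2 * L)) {t : ℝ} (ht : t ∈ Set.Icc (0 : ℝ) 1) : x + t • v ∈ U := by
  have hLpos := hL.L_pos
  have hGpos := hL.G_pos
  by_contra hexit
  obtain ⟨t₀, ht₀, hexit₀, hbefore⟩ := exists_first_exit hf.isOpen hxU ht.1 hexit
  have hsublevel : ∀ u ∈ Set.Ico 0 t₀,
      x + u • v ∈ {z ∈ U | f z ≤ f x + 3 / 2 * G * ‖v‖ + L * ‖v‖ ^ 2} := by
    intro u hu
    refine ⟨hbefore u hu, ?_⟩
    have hnorm : ‖u • v‖ ≤ ‖v‖ := by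
      rw [norm_smul, Real.norm_of_nonneg hu.1]
      exact mul_le_of_le_one_left (norm_nonneg _) (hu.2.le.trans (ht₀.2.trans ht.2))
    have htaylor := hfs.abs_sub_sub_inner_le_of_segment hf.isOpen hL (x := x) (v := u • v)
      (fun s hs => by
        rw [smul_smul]
        exact hbefore _
          ⟨mul_nonneg hs.1 hu.1, (mul_le_of_le_one_left hu.1 hs.2).trans_lt hu.2⟩)
      hx (hnorm.trans hv)
    have hlinear : inner ℝ (gradient f x) (u • v) ≤ 3 / 2 * G * ‖v‖ :=
      (real_inner_le_norm _ _).trans (by gcongr)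
    have hquadratic : L * ‖u • v‖ ^ 2 ≤ L * ‖v‖ ^ 2 := by gcongr
    linarith [(abs_le.1 htaylor).2]
  have hclosure : t₀ ∈ closure (Set.Ico 0 t₀) := by
    rw [closure_Ico ht₀.1.ne]; exact ⟨ht₀.1.le, le_rfl⟩
  have hcont : Continuous fun t : ℝ => x + t • v := by fun_prop
  have hmem := map_mem_closure hcont hclosure hsublevel
  rw [(hf.isClosed_sublevel _).closure_eq] at hmem
  exact hexit₀ hmem.1

theorem IsObjective.add_mem (hf : IsObjective U f) (hfs : IsGenSmoothOn U f L₀ Lρ ρ)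
    (hL : IsEffSmooth L₀ Lρ ρ G L) (hxU : x ∈ U) (hx : ‖gradient f x‖ ≤ 3 / 2 * G)
    (hv : ‖v‖ ≤ G / (2 * L)) : x + v ∈ U := by
  simpa using hf.add_smul_mem hfs hL hxU hx hv (t := 1) (by simp)

theorem IsObjective.norm_gradient_sub_le (hf : IsObjective U f) (hfs : IsGenSmoothOn U f L₀ Lρ ρ)
    (hh : IsGenSmoothOn U h L₀ Lρ ρ) (hL : IsEffSmooth L₀ Lρ ρ G L) (hxU : x ∈ U)
    (hxf : ‖gradient f x‖ ≤ 3 / 2 * G) (hxh : ‖gradient h x‖ ≤ 3 / 2 * G)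
    (hv : ‖v‖ ≤ G / (2 * L)) : ‖gradient h (x + v) - gradient h x‖ ≤ L * ‖v‖ := by
  simpa using hh.norm_gradient_add_smul_sub_le hf.isOpen hL
    (fun _ => hf.add_smul_mem hfs hL hxU hxf hv) hxh hv (t := 1) (by simp)

theorem IsObjective.abs_sub_sub_inner_le (hf : IsObjective U f) (hfs : IsGenSmoothOn U f L₀ Lρ ρ)
    (hL : IsEffSmooth L₀ Lρ ρ G L) (hxU : x ∈ U) (hx : ‖gradient f x‖ ≤ 3 / 2 * G)
    (hv : ‖v‖ ≤ G / (2 * L)) : |f (x + v) - f x - inner ℝ (gradient f x) v| ≤ L * ‖v‖ ^ 2 :=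
  hfs.abs_sub_sub_inner_le_of_segment hf.isOpen hL (fun _ => hf.add_smul_mem hfs hL hxU hx hv) hx hv

theorem IsObjective.gap_nonneg (hf : IsObjective U f) (hxU : x ∈ U) : 0 ≤ f x - sInf (f '' U) :=
  sub_nonneg.2 (csInf_le hf.bddBelow ⟨x, hxU, rfl⟩)

theorem IsObjective.sq_norm_gradient_le (hf : IsObjective U f) (hfs : IsGenSmoothOn U f L₀ Lρ ρ)
    (hL : IsEffSmooth L₀ Lρ ρ G L) (hxU : x ∈ U) (hx : ‖gradient f x‖ ≤ 3 / 2 * G) :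
    ‖gradient f x‖ ^ 2 ≤ 6 * L * (f x - sInf (f '' U)) := by
  have hLpos := hL.L_pos
  set v := -(1 / (4 * L)) • gradient f x with hv
  have hnorm : ‖v‖ = ‖gradient f x‖ / (4 * L) := by
    rw [hv, neg_smul, norm_neg, norm_smul, Real.norm_of_nonneg (by positivity)]
    ring
  have hshort : ‖v‖ ≤ G / (2 * L) := by
    rw [hnorm, div_le_div_iff₀ (by positivity) (by positivity)]
    nlinarith [hL.G_pos]
  have hinner : inner ℝ (gradient f x) v = -(‖gradient f x‖ ^ 2 / (4 * L)) := by
    rw [hv, inner_smul_right, real_inner_self_eq_norm_sq]; ring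
  have htaylor := (abs_le.1 (hf.abs_sub_sub_inner_le hfs hL hxU hx hshort)).2
  have hgap := hf.gap_nonneg (hf.add_mem hfs hL hxU hx hshort)
  have hdescent : 3 / 16 * ‖gradient f x‖ ^ 2 / L ≤ f x - sInf (f '' U) := by
    have hsum : 3 / 16 * ‖gradient f x‖ ^ 2 / L
        = ‖gradient f x‖ ^ 2 / (4 * L) - L * (‖gradient f x‖ / (4 * L)) ^ 2 := by
      field_simp; ring
    rw [hinner, hnorm] at htaylor
    linarith
  rw [div_le_iff₀ hLpos] at hdescent
  nlinarith [hf.gap_nonneg hxU]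

theorem isEffSmooth_zero (hρ : 0 ≤ ρ) (hG : 0 < G) (hL : 0 < L) : IsEffSmooth 0 0 ρ G L :=
  ⟨le_rfl, hρ, hG, hL, by simpa using hL⟩

theorem IsObjective.gradient_eq_zero (hf : IsObjective U f) (hfs : IsGenSmoothOn U f 0 0 ρ)
    (hρ : 0 ≤ ρ) (hxU : x ∈ U) : gradient f x = 0 := by
  have hsq : ‖gradient f x‖ ^ 2 ≤ 0 := nonpos_of_forall_pos_le_mul
    (b := 6 * (f x - sInf (f '' U))) fun L hL => by
      have := hf.sq_norm_gradient_le hfs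
        (isEffSmooth_zero (G := ‖gradient f x‖ + 1) hρ (by positivity) hL) hxU
        (by linarith [norm_nonneg (gradient f x)])
      linarith
  simpa using hsq.antisymm (sq_nonneg _)

theorem IsObjective.gap_eq_zero (hf : IsObjective U f) (hfs : IsGenSmoothOn U f 0 0 ρ)
    (hρ : 0 ≤ ρ) (hxU : x ∈ U) : f x - sInf (f '' U) = 0 := by
  refine le_antisymm (sub_nonpos.2 (le_csInf ⟨_, x, hxU, rfl⟩ ?_)) (hf.gap_nonneg hxU)
  rintro _ ⟨y, -, rfl⟩
  refine sub_nonpos.1 (nonpos_of_forall_pos_le_mul (b := ‖y - x‖ ^ 2) fun L hL => ?_)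
  have hgrad := hf.gradient_eq_zero hfs hρ hxU
  have hG : 0 < 2 * L * (‖y - x‖ + 1) := by positivity
  have htaylor := hf.abs_sub_sub_inner_le hfs (isEffSmooth_zero hρ hG hL) (v := y - x) hxU
    (by rw [hgrad, norm_zero]; positivity)
    (by rw [mul_div_cancel_left₀ _ (by positivity)]; linarith)
  rw [hgrad, inner_zero_left, sub_zero, add_sub_cancel] at htaylor
  linarith [(abs_le.1 htaylor).1]

end LocalSmoothness

/-! ### One iteration -/

/-- The squared norm of `g` in the metric `diag h`, in which the step of an adaptive method is a
gradient step. -/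
noncomputable def weightedSqNorm {d : ℕ} (h : Fin d → ℝ) (g : EuclideanSpace ℝ (Fin d)) : ℝ :=
  ∑ i, h i * g i ^ 2

section WeightedSqNorm

variable {d : ℕ} {h : Fin d → ℝ} {a b : EuclideanSpace ℝ (Fin d)} {c : ℝ}

theorem weightedSqNorm_nonneg (hh : ∀ i, 0 ≤ h i) : 0 ≤ weightedSqNorm h a :=
  Finset.sum_nonneg fun i _ => mul_nonneg (hh i) (sq_nonneg _)

theorem weightedSqNorm_const : weightedSqNorm (fun _ => c) a = c * ‖a‖ ^ 2 := by
  simp only [weightedSqNorm, EuclideanSpace.real_norm_sq_eq, Finset.mul_sum]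

theorem weightedSqNorm_le_weightedSqNorm {h' : Fin d → ℝ} (hh : ∀ i, h i ≤ h' i) :
    weightedSqNorm h a ≤ weightedSqNorm h' a :=
  Finset.sum_le_sum fun i _ => mul_le_mul_of_nonneg_right (hh i) (sq_nonneg _)

theorem weightedSqNorm_le (hh : ∀ i, h i ≤ c) : weightedSqNorm h a ≤ c * ‖a‖ ^ 2 :=
  (weightedSqNorm_le_weightedSqNorm hh).trans_eq weightedSqNorm_const

theorem le_weightedSqNorm (hh : ∀ i, c ≤ h i) : c * ‖a‖ ^ 2 ≤ weightedSqNorm h a :=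
  weightedSqNorm_const.symm.trans_le (weightedSqNorm_le_weightedSqNorm hh)

theorem weightedSqNorm_add_le (hh : ∀ i, 0 ≤ h i) :
    weightedSqNorm h (a + b) ≤ 2 * (weightedSqNorm h a + weightedSqNorm h b) := by
  simp only [weightedSqNorm, ← Finset.sum_add_distrib, Finset.mul_sum, ← mul_add, PiLp.add_apply,
    mul_left_comm (2 : ℝ)]
  exact Finset.sum_le_sum fun i _ => mul_le_mul_of_nonneg_left add_sq_le (hh i)

end WeightedSqNorm

/-- The real inequalities between the parameters on which the analysis rests. Here `D` stands for
`√(d / β₂)`. -/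
structure IsTuned (d : ℕ) (L σ G D : ℝ) (p : VRAdamInput) : Prop where
  L_pos : 0 < L
  G_pos : 0 < G
  lam_pos : 0 < p.lam
  η_pos : 0 < p.η
  σ_nonneg : 0 ≤ σ
  β₂_pos : 0 < p.β₂
  β₂_le_one : p.β₂ ≤ 1
  one_le_D : 1 ≤ D
  sq_D : D ^ 2 = d / p.β₂
  lam_le : 2 * p.lam ≤ G
  σ_le_G : 2 * σ ≤ G
  σ_le_D : 2 * σ ≤ p.lam * D
  sqrt_le : 2 * σ * √p.β₂ ≤ p.lam
  β_eq : p.β * p.lam ^ 3 = 1600 * L ^ 2 * G * p.η ^ 2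
  β_le_one : p.β ≤ 1
  η_le_G : 10000 * p.η * L * D ≤ G
  η_le_lam : 10000 * p.η * L ≤ p.lam

theorem IsTuned.β_pos {d : ℕ} {L σ G D : ℝ} {p : VRAdamInput} (hp : IsTuned d L σ G D p) :
    0 < p.β := by
  have hL := hp.L_pos
  have hG := hp.G_pos
  have hlam := hp.lam_pos
  have hη := hp.η_pos
  have hβlam : 0 < p.β * p.lam ^ 3 := by rw [hp.β_eq]; positivity
  exact pos_of_mul_pos_left hβlam (by positivity)

theorem IsTuned.step_le {d : ℕ} {L σ G D : ℝ} {p : VRAdamInput} (hp : IsTuned d L σ G D p) {r : ℝ}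
    (hr : r ≤ 2 * p.η * D) : r ≤ G / (2 * L) ∧ L * r ≤ G / 2 := by
  have hL := hp.L_pos
  have hLr : L * r ≤ G / 2 := by nlinarith [hp.η_le_G, hp.G_pos]
  exact ⟨by rw [le_div_iff₀ (by positivity)]; linarith, hLr⟩

/-- The coordinate-wise step `v = -η h ⊙ (g + e)`, where `g` is the gradient and `e` the error of
its estimate. The bound on `h i * |g i|` is what the second moment estimate in the denominator of
the algorithm provides. -/
structure IsScaledStep {d : ℕ} (p : VRAdamInput) (G : ℝ) (g e v : EuclideanSpace ℝ (Fin d))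
    (h : Fin d → ℝ) : Prop where
  apply_eq : ∀ i, v i = -(p.η * (h i * (g i + e i)))
  le_h : ∀ i, 1 / (2 * G) ≤ h i
  h_le : ∀ i, h i ≤ 1 / p.lam
  h_mul_le : ∀ i, h i * |g i| ≤ 1 / √p.β₂

section Step

variable {d : ℕ} {L σ G D : ℝ} {p : VRAdamInput} {g e v : EuclideanSpace ℝ (Fin d)} {h : Fin d → ℝ}

theorem IsScaledStep.h_nonneg (hs : IsScaledStep p G g e v h) (hp : IsTuned d L σ G D p)
    (i : Fin d) : 0 ≤ h i := by
  have := hp.G_pos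
  exact le_trans (by positivity) (hs.le_h i)

theorem IsScaledStep.sq_norm_eq (hs : IsScaledStep p G g e v h) :
    ‖v‖ ^ 2 = p.η ^ 2 * weightedSqNorm (h ^ 2) (g + e) := by
  rw [EuclideanSpace.real_norm_sq_eq, weightedSqNorm, Finset.mul_sum]
  refine Finset.sum_congr rfl fun i _ => ?_
  rw [hs.apply_eq, Pi.pow_apply, PiLp.add_apply]
  ring

theorem IsScaledStep.sq_h_le (hs : IsScaledStep p G g e v h) (hp : IsTuned d L σ G D p)
    (i : Fin d) : h i ^ 2 ≤ 1 / p.lam * h i := by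
  rw [sq]
  exact mul_le_mul_of_nonneg_right (hs.h_le i) (hs.h_nonneg hp i)

theorem IsScaledStep.weightedSqNorm_sq_gradient_le (hs : IsScaledStep p G g e v h)
    (hp : IsTuned d L σ G D p) : weightedSqNorm (h ^ 2) g ≤ D ^ 2 := by
  have hcoord (i : Fin d) : h i ^ 2 * g i ^ 2 ≤ 1 / p.β₂ := by
    calc h i ^ 2 * g i ^ 2 = (h i * |g i|) ^ 2 := by rw [mul_pow, sq_abs]
      _ ≤ (1 / √p.β₂) ^ 2 := by
        have := hs.h_nonneg hp i
        exact pow_le_pow_left₀ (by positivity) (hs.h_mul_le i) 2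
      _ = 1 / p.β₂ := by rw [div_pow, Real.sq_sqrt hp.β₂_pos.le, one_pow]
  calc weightedSqNorm (h ^ 2) g ≤ ∑ _i : Fin d, 1 / p.β₂ := Finset.sum_le_sum fun i _ => hcoord i
    _ = D ^ 2 := by simp [hp.sq_D, div_eq_mul_inv]

theorem IsScaledStep.norm_le (hs : IsScaledStep p G g e v h) (hp : IsTuned d L σ G D p)
    (he : ‖e‖ ≤ p.lam * D) : ‖v‖ ≤ 2 * p.η * D := by
  have hlam := hp.lam_pos
  have hη := hp.η_pos
  have hD : 0 < D := one_pos.trans_le hp.one_le_D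
  have herror : weightedSqNorm (h ^ 2) e ≤ D ^ 2 := by
    calc weightedSqNorm (h ^ 2) e ≤ (1 / p.lam) ^ 2 * ‖e‖ ^ 2 :=
          weightedSqNorm_le fun i => pow_le_pow_left₀ (hs.h_nonneg hp i) (hs.h_le i) 2
      _ ≤ (1 / p.lam) ^ 2 * (p.lam * D) ^ 2 := by gcongr
      _ = D ^ 2 := by field_simp
  refine le_of_sq_le_sq ?_ (by positivity)
  calc ‖v‖ ^ 2 = p.η ^ 2 * weightedSqNorm (h ^ 2) (g + e) := hs.sq_norm_eq
    _ ≤ p.η ^ 2 * (2 * (weightedSqNorm (h ^ 2) g + weightedSqNorm (h ^ 2) e)) := by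
      gcongr
      exact weightedSqNorm_add_le fun i => sq_nonneg (h i)
    _ ≤ p.η ^ 2 * (2 * (D ^ 2 + D ^ 2)) := by
      gcongr
      exact hs.weightedSqNorm_sq_gradient_le hp
    _ = (2 * p.η * D) ^ 2 := by ring

theorem IsScaledStep.sq_norm_le (hs : IsScaledStep p G g e v h) (hp : IsTuned d L σ G D p) :
    ‖v‖ ^ 2 ≤ 2 * p.η ^ 2 / p.lam * (weightedSqNorm h g + ‖e‖ ^ 2 / p.lam) := by
  have hlam := hp.lam_pos
  calc ‖v‖ ^ 2 = p.η ^ 2 * weightedSqNorm (h ^ 2) (g + e) := hs.sq_norm_eq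
    _ ≤ p.η ^ 2 * weightedSqNorm (fun i => 1 / p.lam * h i) (g + e) := by
      gcongr
      exact weightedSqNorm_le_weightedSqNorm (hs.sq_h_le hp)
    _ = p.η ^ 2 / p.lam * weightedSqNorm h (g + e) := by
      simp only [weightedSqNorm, mul_assoc, ← Finset.mul_sum]; ring
    _ ≤ p.η ^ 2 / p.lam * (2 * (weightedSqNorm h g + 1 / p.lam * ‖e‖ ^ 2)) := by
      gcongr
      refine (weightedSqNorm_add_le (hs.h_nonneg hp)).trans ?_
      gcongr
      exact weightedSqNorm_le hs.h_le
    _ = 2 * p.η ^ 2 / p.lam * (weightedSqNorm h g + ‖e‖ ^ 2 / p.lam) := by ring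

theorem IsScaledStep.inner_eq (hs : IsScaledStep p G g e v h) :
    inner ℝ g v = p.η / 2 *
      (weightedSqNorm h e - weightedSqNorm h g - weightedSqNorm h (g + e)) := by
  simp only [weightedSqNorm, ← Finset.sum_sub_distrib, Finset.mul_sum, PiLp.inner_apply]
  refine Finset.sum_congr rfl fun i _ => ?_
  rw [hs.apply_eq, RCLike.inner_apply, conj_trivial, PiLp.add_apply]
  ring

theorem IsScaledStep.inner_le (hs : IsScaledStep p G g e v h) (hp : IsTuned d L σ G D p) :
    inner ℝ g v ≤ -(p.η / 2) * weightedSqNorm h g + p.η / (2 * p.lam) * ‖e‖ ^ 2 := by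
  have hη := hp.η_pos
  calc inner ℝ g v
      = p.η / 2 * (weightedSqNorm h e - weightedSqNorm h g - weightedSqNorm h (g + e)) :=
        hs.inner_eq
    _ ≤ p.η / 2 * (1 / p.lam * ‖e‖ ^ 2 - weightedSqNorm h g - 0) := by
        gcongr
        · exact weightedSqNorm_le hs.h_le
        · exact weightedSqNorm_nonneg (hs.h_nonneg hp)
    _ = -(p.η / 2) * weightedSqNorm h g + p.η / (2 * p.lam) * ‖e‖ ^ 2 := by ring

theorem IsScaledStep.sq_norm_gradient_le (hs : IsScaledStep p G g e v h)
    (hp : IsTuned d L σ G D p) :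
    p.η / (16 * G) * ‖g‖ ^ 2 ≤ 1 / 8 * p.η * weightedSqNorm h g := by
  have hη := hp.η_pos
  calc p.η / (16 * G) * ‖g‖ ^ 2 = 1 / 8 * p.η * (1 / (2 * G) * ‖g‖ ^ 2) := by ring
    _ ≤ 1 / 8 * p.η * weightedSqNorm h g := by
      gcongr
      exact le_weightedSqNorm hs.le_h

theorem isScaledStep_of_denominator (hp : IsTuned d L σ G D p) {y : EuclideanSpace ℝ (Fin d)}
    (hy : ‖y - g‖ ≤ σ) {q : Fin d → ℝ} (hq0 : ∀ i, 0 ≤ q i) (hqy : ∀ i, √p.β₂ * |y i| ≤ q i)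
    (hqG : ∀ i, q i ≤ 3 / 2 * G)
    (hv : ∀ i, v i = -(p.η / (q i + p.lam) * (g i + e i))) :
    IsScaledStep p G g e v fun i => 1 / (q i + p.lam) := by
  have hlam := hp.lam_pos
  have hpos (i : Fin d) : 0 < q i + p.lam := by linarith [hq0 i]
  have hsqrt : 0 < √p.β₂ := Real.sqrt_pos.2 hp.β₂_pos
  refine ⟨fun i => ?_, fun i => ?_, fun i => ?_, fun i => ?_⟩
  · rw [hv i]; ring
  · exact one_div_le_one_div_of_le (hpos i) (by linarith [hqG i, hp.lam_le])
  · exact one_div_le_one_div_of_le hlam (by linarith [hq0 i])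
  · rw [one_div_mul_eq_div, div_le_div_iff₀ (hpos i) hsqrt, one_mul]
    have hgy : |g i| ≤ |y i| + σ := by
      have hi : |y i - g i| ≤ σ := (PiLp.norm_apply_le (y - g) i).trans hy
      linarith [abs_sub_abs_le_abs_sub (g i) (y i), abs_sub_comm (g i) (y i)]
    linarith [mul_le_mul_of_nonneg_left hgy hsqrt.le, hqy i, hp.sqrt_le]

variable {L₀ Lρ ρ : ℝ} {U : Set (EuclideanSpace ℝ (Fin d))} {f : EuclideanSpace ℝ (Fin d) → ℝ}
  {x : EuclideanSpace ℝ (Fin d)}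

theorem IsScaledStep.descent (hs : IsScaledStep p G (gradient f x) e v h)
    (hp : IsTuned d L σ G D p) (hf : IsObjective U f) (hfs : IsGenSmoothOn U f L₀ Lρ ρ)
    (hL : IsEffSmooth L₀ Lρ ρ G L) (hxU : x ∈ U) (hx : ‖gradient f x‖ ≤ G)
    (he : ‖e‖ ≤ p.lam * D) :
    f (x + v) ≤ f x - 3 / 8 * p.η * weightedSqNorm h (gradient f x)
      + 5 / 8 * (p.η / p.lam) * ‖e‖ ^ 2 := by
  have hG := hp.G_pos
  have hlam := hp.lam_pos
  have hLpos := hp.L_pos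
  set Γ := weightedSqNorm h (gradient f x)
  have hΓ0 : 0 ≤ Γ := weightedSqNorm_nonneg (hs.h_nonneg hp)
  have htaylor := (abs_le.1 (hf.abs_sub_sub_inner_le hfs hL hxU (by linarith)
    (hp.step_le (hs.norm_le hp he)).1)).2
  have hfirst := hs.inner_le hp
  have hsecond : L * ‖v‖ ^ 2 ≤ 1 / 8 * p.η * (Γ + ‖e‖ ^ 2 / p.lam) := by
    calc L * ‖v‖ ^ 2 ≤ L * (2 * p.η ^ 2 / p.lam * (Γ + ‖e‖ ^ 2 / p.lam)) := by
          gcongr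
          exact hs.sq_norm_le hp
      _ = L * (2 * p.η ^ 2 / p.lam) * (Γ + ‖e‖ ^ 2 / p.lam) := by ring
      _ ≤ 1 / 8 * p.η * (Γ + ‖e‖ ^ 2 / p.lam) := by
          refine mul_le_mul_of_nonneg_right ?_ (by positivity)
          rw [mul_div_assoc', div_le_iff₀ hlam]
          nlinarith [hp.η_le_lam, hp.η_pos]
  have hsplit : 1 / 8 * p.η * (Γ + ‖e‖ ^ 2 / p.lam)
      = 1 / 8 * p.η * Γ + 1 / 8 * (p.η / p.lam) * ‖e‖ ^ 2 := by ring
  have hhalf : p.η / (2 * p.lam) * ‖e‖ ^ 2 = 1 / 2 * (p.η / p.lam) * ‖e‖ ^ 2 := by ring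
  linarith

theorem IsScaledStep.sq_norm_gradient_le_potential (hs : IsScaledStep p G (gradient f x) e v h)
    (hp : IsTuned d L σ G D p) (hf : IsObjective U f) (hfs : IsGenSmoothOn U f L₀ Lρ ρ)
    (hL : IsEffSmooth L₀ Lρ ρ G L) (hxU : x ∈ U) (hx : ‖gradient f x‖ ≤ G)
    (he : ‖e‖ ≤ p.lam * D) :
    p.η / (16 * G) * ‖gradient f x‖ ^ 2
      ≤ f x - sInf (f '' U) + p.η / (p.lam * p.β) * ‖e‖ ^ 2 := by
  have hG := hp.G_pos
  have hlam := hp.lam_pos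
  have hη := hp.η_pos
  have hβ := hp.β_pos
  have hdescent := hs.descent hp hf hfs hL hxU hx he
  have hgap := hf.gap_nonneg (hf.add_mem hfs hL hxU (by linarith)
    (hp.step_le (hs.norm_le hp he)).1)
  have hgrad := hs.sq_norm_gradient_le hp
  have hΓ0 : 0 ≤ p.η * weightedSqNorm h (gradient f x) :=
    mul_nonneg hη.le (weightedSqNorm_nonneg (hs.h_nonneg hp))
  have hweight : p.η / p.lam * ‖e‖ ^ 2 ≤ p.η / (p.lam * p.β) * ‖e‖ ^ 2 := by
    gcongr
    exact mul_le_of_le_one_right hlam.le hp.β_le_one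
  have herror : 0 ≤ p.η / p.lam * ‖e‖ ^ 2 := by positivity
  linarith

/-- The momentum parameter is tuned so that the quadratic variation `L² ‖v‖²` that a step `v` causes
in the gradient estimate is paid for by the descent of that step. -/
theorem IsTuned.error_weight_mul_sq_le (hp : IsTuned d L σ G D p) :
    p.η / (p.lam * p.β) * (8 * L ^ 2) ≤ p.lam / (400 * p.η) := by
  have hβ := hp.β_pos
  have hG := hp.G_pos
  have hlam := hp.lam_pos
  have hη := hp.η_pos
  have hweight : p.η / (p.lam * p.β) * (8 * L ^ 2) = p.lam ^ 2 / (200 * G * p.η) := by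
    rw [div_mul_eq_mul_div, div_eq_div_iff (by positivity) (by positivity)]
    linear_combination -hp.β_eq
  rw [hweight, div_le_div_iff₀ (by positivity) (by positivity)]
  nlinarith [hp.lam_le, mul_pos hlam hη, mul_pos (mul_pos hlam hη) hlam]

theorem IsTuned.error_weight_mul_sq_norm_le {E : Type*} [NormedAddCommGroup E]
    (hp : IsTuned d L σ G D p) {W u : E} (hW : ‖W‖ ≤ p.β * σ + 2 * L * ‖u‖) :
    p.η / (p.lam * p.β) * ‖W‖ ^ 2
      ≤ 2 * p.η * p.β * σ ^ 2 / p.lam + p.lam / (400 * p.η) * ‖u‖ ^ 2 := by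
  have hβ := hp.β_pos
  have hη := hp.η_pos
  have hlam := hp.lam_pos
  calc p.η / (p.lam * p.β) * ‖W‖ ^ 2
      ≤ p.η / (p.lam * p.β) * (2 * ((p.β * σ) ^ 2 + (2 * L * ‖u‖) ^ 2)) := by
        gcongr
        exact (pow_le_pow_left₀ (norm_nonneg _) hW 2).trans add_sq_le
    _ = 2 * p.η * p.β * σ ^ 2 / p.lam + p.η / (p.lam * p.β) * (8 * L ^ 2) * ‖u‖ ^ 2 := by
        field_simp; ring
    _ ≤ 2 * p.η * p.β * σ ^ 2 / p.lam + p.lam / (400 * p.η) * ‖u‖ ^ 2 := by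
        gcongr
        exact hp.error_weight_mul_sq_le

theorem IsTuned.error_weight_mul_contraction_le (hp : IsTuned d L σ G D p) (s : ℝ) :
    p.η / (p.lam * p.β) * ((1 - p.β) ^ 2 * s ^ 2)
      ≤ p.η / (p.lam * p.β) * s ^ 2 - p.η / p.lam * s ^ 2 := by
  have hβ := hp.β_pos
  have hη := hp.η_pos
  have hlam := hp.lam_pos
  calc p.η / (p.lam * p.β) * ((1 - p.β) ^ 2 * s ^ 2)
      ≤ p.η / (p.lam * p.β) * ((1 - p.β) * s ^ 2) := by
        gcongr
        nlinarith [hp.β_le_one]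
    _ = p.η / (p.lam * p.β) * s ^ 2 - p.η / p.lam * s ^ 2 := by field_simp

theorem IsScaledStep.potential_le (hs : IsScaledStep p G (gradient f x) e v h)
    (hp : IsTuned d L σ G D p) (hf : IsObjective U f) (hfs : IsGenSmoothOn U f L₀ Lρ ρ)
    (hL : IsEffSmooth L₀ Lρ ρ G L) (hxU : x ∈ U) (hx : ‖gradient f x‖ ≤ G)
    (he : ‖e‖ ≤ p.lam * D) {W : EuclideanSpace ℝ (Fin d)} (hW : ‖W‖ ≤ p.β * σ + 2 * L * ‖v‖) :
    f (x + v) + p.η / (p.lam * p.β) * ‖(1 - p.β) • e + W‖ ^ 2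
      ≤ f x + p.η / (p.lam * p.β) * ‖e‖ ^ 2
        - (p.η / (16 * G) * ‖gradient f x‖ ^ 2 + p.lam / (16 * p.η) * ‖v‖ ^ 2)
        + 2 * p.η * p.β * σ ^ 2 / p.lam
        + 2 * (p.η / (p.lam * p.β)) * (1 - p.β) * inner ℝ e W := by
  have hlam := hp.lam_pos
  have hη := hp.η_pos
  have hdescent := hs.descent hp hf hfs hL hxU hx he
  have hgrad := hs.sq_norm_gradient_le hp
  have hnoise := hp.error_weight_mul_sq_norm_le hW
  have hcontract := hp.error_weight_mul_contraction_le ‖e‖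
  set Γ := weightedSqNorm h (gradient f x)
  have hexpand : ‖(1 - p.β) • e + W‖ ^ 2
      = (1 - p.β) ^ 2 * ‖e‖ ^ 2 + 2 * (1 - p.β) * inner ℝ e W + ‖W‖ ^ 2 := by
    rw [norm_add_sq_real, norm_smul, real_inner_smul_left, mul_pow, Real.norm_eq_abs, sq_abs]
    ring
  have hstep : (p.lam / (400 * p.η) + p.lam / (16 * p.η)) * ‖v‖ ^ 2
      ≤ 13 / 100 * (p.η * Γ) + 13 / 100 * (p.η / p.lam * ‖e‖ ^ 2) := by
    calc (p.lam / (400 * p.η) + p.lam / (16 * p.η)) * ‖v‖ ^ 2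
        ≤ (p.lam / (400 * p.η) + p.lam / (16 * p.η))
          * (2 * p.η ^ 2 / p.lam * (Γ + ‖e‖ ^ 2 / p.lam)) := by
          gcongr
          exact hs.sq_norm_le hp
      _ = 13 / 100 * (p.η * Γ) + 13 / 100 * (p.η / p.lam * ‖e‖ ^ 2) := by field_simp; ring
  have hΓ0 : 0 ≤ p.η * Γ := mul_nonneg hη.le (weightedSqNorm_nonneg (hs.h_nonneg hp))
  have herror : 0 ≤ p.η / p.lam * ‖e‖ ^ 2 := by positivity
  rw [hexpand]
  linarith

end Step

/-! ### A sixth moment inequality -/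

section SixthMoment

theorem add_two_mul_add_sq_pow_three_le {x y I : ℝ} (hI : |I| ≤ x * y) :
    (x ^ 2 + 2 * I + y ^ 2) ^ 3 ≤ x ^ 6 + 6 * x ^ 4 * I + 40 * (x ^ 4 * y ^ 2 + y ^ 6) := by
  have habs : |2 * I + y ^ 2| ≤ 2 * x * y + y ^ 2 := by
    rw [abs_le] at hI ⊢
    constructor <;> nlinarith
  have hsq : x ^ 2 * (2 * I + y ^ 2) ^ 2 ≤ x ^ 2 * (2 * x * y + y ^ 2) ^ 2 := by
    rw [← sq_abs (2 * I + y ^ 2)]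
    gcongr
  have hcube : (2 * I + y ^ 2) ^ 3 ≤ (2 * x * y + y ^ 2) ^ 3 :=
    (Odd.strictMono_pow (by decide : Odd 3)).monotone ((le_abs_self _).trans habs)
  have hx3y3 : x ^ 3 * y ^ 3 ≤ 1 / 2 * (x ^ 4 * y ^ 2) + 1 / 2 * (x ^ 2 * y ^ 4) := by
    nlinarith [sq_nonneg (x ^ 2 * y - x * y ^ 2)]
  have hx2y4 : x ^ 2 * y ^ 4 ≤ 1 / 2 * (x ^ 4 * y ^ 2) + 1 / 2 * y ^ 6 := by
    nlinarith [sq_nonneg (x ^ 2 * y - y ^ 3)]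
  have hxy5 : x * y ^ 5 ≤ 1 / 2 * (x ^ 2 * y ^ 4) + 1 / 2 * y ^ 6 := by
    nlinarith [sq_nonneg (x * y ^ 2 - y ^ 3)]
  have hx4y2_nonneg : 0 ≤ x ^ 4 * y ^ 2 := by positivity
  have hy6_nonneg : 0 ≤ y ^ 6 := by positivity
  calc (x ^ 2 + 2 * I + y ^ 2) ^ 3
      = x ^ 6 + 6 * x ^ 4 * I + 3 * (x ^ 4 * y ^ 2)
        + 3 * (x ^ 2 * (2 * I + y ^ 2) ^ 2) + (2 * I + y ^ 2) ^ 3 := by ring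
    _ ≤ x ^ 6 + 6 * x ^ 4 * I + 3 * (x ^ 4 * y ^ 2)
        + 3 * (x ^ 2 * (2 * x * y + y ^ 2) ^ 2) + (2 * x * y + y ^ 2) ^ 3 := by gcongr
    _ = x ^ 6 + 6 * x ^ 4 * I + 15 * (x ^ 4 * y ^ 2) + 20 * (x ^ 3 * y ^ 3)
        + 15 * (x ^ 2 * y ^ 4) + 6 * (x * y ^ 5) + y ^ 6 := by ring
    _ ≤ x ^ 6 + 6 * x ^ 4 * I + 40 * (x ^ 4 * y ^ 2 + y ^ 6) := by linarith

theorem sq_mul_le_pow_three_add {y t : ℝ} (hy : 0 ≤ y) (ht : 0 ≤ t) :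
    y ^ 2 * t ≤ y ^ 3 + t ^ 3 := by
  rcases le_total t y with hty | hyt
  · nlinarith [mul_le_mul_of_nonneg_left hty (sq_nonneg y), pow_nonneg ht 3]
  · nlinarith [mul_le_mul_of_nonneg_right (pow_le_pow_left₀ hy hyt 2) ht, pow_nonneg hy 3]

theorem forty_mul_pow_four_mul_le (x : ℝ) {β q : ℝ} (hβ : 0 < β) (hq : 0 ≤ q) :
    40 * (x ^ 4 * q) ≤ β * x ^ 6 + 40 ^ 3 * (q / β) ^ 2 * q := by
  calc 40 * (x ^ 4 * q) = β * ((x ^ 2) ^ 2 * (40 * (q / β))) := by field_simp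
    _ ≤ β * ((x ^ 2) ^ 3 + (40 * (q / β)) ^ 3) := by
      gcongr
      exact sq_mul_le_pow_three_add (sq_nonneg x) (by positivity)
    _ = β * x ^ 6 + 40 ^ 3 * (q / β) ^ 2 * q := by field_simp

theorem one_sub_pow_six_mul_one_add_le {β : ℝ} (hβ : 0 ≤ β) (hβ1 : β ≤ 1) :
    (1 - β) ^ 6 * (1 + β) ≤ 1 := by
  have hβ' : 0 ≤ 1 - β := sub_nonneg.2 hβ1
  calc (1 - β) ^ 6 * (1 + β) = (1 - β) ^ 5 * (1 - β ^ 2) := by ring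
    _ ≤ 1 := mul_le_one₀ (pow_le_one₀ hβ' (by linarith)) (by nlinarith) (by nlinarith)

variable {E : Type*} [NormedAddCommGroup E] [InnerProductSpace ℝ E] (w z : E)

theorem norm_add_pow_six_le :
    ‖w + z‖ ^ 6 ≤ ‖w‖ ^ 6 + 6 * ‖w‖ ^ 4 * inner ℝ w z + 40 * (‖w‖ ^ 4 * ‖z‖ ^ 2 + ‖z‖ ^ 6) := by
  calc ‖w + z‖ ^ 6 = (‖w‖ ^ 2 + 2 * inner ℝ w z + ‖z‖ ^ 2) ^ 3 := by
        rw [← norm_add_sq_real, ← pow_mul]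
    _ ≤ _ := add_two_mul_add_sq_pow_three_le (abs_real_inner_le_norm w z)

theorem norm_add_pow_six_le_of_sq_norm_le {β q : ℝ} (hβ : 0 < β) (hβ1 : β ≤ 1)
    (hz : ‖z‖ ^ 2 ≤ q) :
    ‖w + z‖ ^ 6 ≤ (1 + β) * ‖w‖ ^ 6 + 6 * (‖w‖ ^ 4 * inner ℝ w z)
      + 2 * 40 ^ 3 * (q / β) ^ 2 * q := by
  have hq : 0 ≤ q := (sq_nonneg _).trans hz
  have hquad : ‖w‖ ^ 4 * ‖z‖ ^ 2 ≤ ‖w‖ ^ 4 * q := by gcongr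
  have hsix : ‖z‖ ^ 6 ≤ 40 ^ 2 * ((q / β) ^ 2 * q) := by
    calc ‖z‖ ^ 6 = (‖z‖ ^ 2) ^ 2 * ‖z‖ ^ 2 := by ring
      _ ≤ (q / β) ^ 2 * q := by gcongr; exact hz.trans (le_div_self hq hβ hβ1)
      _ ≤ 40 ^ 2 * ((q / β) ^ 2 * q) := le_mul_of_one_le_left (by positivity) (by norm_num)
  linarith [norm_add_pow_six_le w z, forty_mul_pow_four_mul_le ‖w‖ hβ hq]

/-- Contracting by `1 - β` absorbs the term `‖w‖⁴ ‖z‖²` of second order, so that only the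
martingale part and a term that is cubic in `q` remain. -/
theorem norm_smul_add_pow_six_le {β q : ℝ} (hβ : 0 < β) (hβ1 : β ≤ 1) (hz : ‖z‖ ^ 2 ≤ q) :
    ‖(1 - β) • (w + z)‖ ^ 6 ≤ ‖w‖ ^ 6 + 6 * (1 - β) ^ 6 * (‖w‖ ^ 4 * inner ℝ w z)
      + 2 * 40 ^ 3 * (q / β) ^ 2 * q := by
  have hβ' : 0 ≤ 1 - β := sub_nonneg.2 hβ1
  have hq : 0 ≤ q := (sq_nonneg _).trans hz
  have hmain : (1 - β) ^ 6 * (1 + β) * ‖w‖ ^ 6 ≤ ‖w‖ ^ 6 :=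
    mul_le_of_le_one_left (by positivity) (one_sub_pow_six_mul_one_add_le hβ.le hβ1)
  have hrest : (1 - β) ^ 6 * (2 * 40 ^ 3 * (q / β) ^ 2 * q) ≤ 2 * 40 ^ 3 * (q / β) ^ 2 * q :=
    mul_le_of_le_one_left (by positivity) (pow_le_one₀ hβ' (by linarith))
  calc ‖(1 - β) • (w + z)‖ ^ 6 = (1 - β) ^ 6 * ‖w + z‖ ^ 6 := by
        rw [norm_smul, mul_pow, Real.norm_of_nonneg hβ']
    _ ≤ (1 - β) ^ 6 * ((1 + β) * ‖w‖ ^ 6 + 6 * (‖w‖ ^ 4 * inner ℝ w z)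
        + 2 * 40 ^ 3 * (q / β) ^ 2 * q) := by
        gcongr
        exact norm_add_pow_six_le_of_sq_norm_le w z hβ hβ1 hz
    _ ≤ _ := by linarith

end SixthMoment

/-! ### Trajectories inside the domain -/

section Trajectory

variable {d : ℕ} {Ξ : Type*}

/-- The stochastic gradient, set to zero outside the domain, where the assumptions say nothing
about it. -/
noncomputable def domGrad (U : Set (EuclideanSpace ℝ (Fin d)))
    (F : EuclideanSpace ℝ (Fin d) → Ξ → ℝ) (x : EuclideanSpace ℝ (Fin d)) (s : Ξ) :
    EuclideanSpace ℝ (Fin d) :=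
  U.indicator (fun y => stochGrad F y s) x

/-- The noise of the stochastic gradient, set to zero outside the domain. -/
noncomputable def domNoise (U : Set (EuclideanSpace ℝ (Fin d))) (f : EuclideanSpace ℝ (Fin d) → ℝ)
    (F : EuclideanSpace ℝ (Fin d) → Ξ → ℝ) (x : EuclideanSpace ℝ (Fin d)) (s : Ξ) :
    EuclideanSpace ℝ (Fin d) :=
  U.indicator (fun y => stochGrad F y s - gradient f y) x

variable {U : Set (EuclideanSpace ℝ (Fin d))} {f : EuclideanSpace ℝ (Fin d) → ℝ}
  {F : EuclideanSpace ℝ (Fin d) → Ξ → ℝ} {x₁ : EuclideanSpace ℝ (Fin d)} {p : VRAdamInput}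
  {ζ : Fin p.S₁ → Ξ} {ξ : ℕ → Ξ} {L₀ Lρ ρ L σ G D : ℝ}

theorem domGrad_of_mem {x : EuclideanSpace ℝ (Fin d)} (hx : x ∈ U) (s : Ξ) :
    domGrad U F x s = stochGrad F x s :=
  Set.indicator_of_mem hx _

theorem domNoise_of_mem {x : EuclideanSpace ℝ (Fin d)} (hx : x ∈ U) (s : Ξ) :
    domNoise U f F x s = stochGrad F x s - gradient f x :=
  Set.indicator_of_mem hx _

theorem domNoise_of_notMem {x : EuclideanSpace ℝ (Fin d)} (hx : x ∉ U) :
    domNoise U f F x = 0 :=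
  funext fun _ => Set.indicator_of_notMem hx _

theorem domGrad_eq {x : EuclideanSpace ℝ (Fin d)} (hx : x ∈ U) (s : Ξ) :
    domGrad U F x s = domNoise U f F x s + gradient f x := by
  rw [domGrad_of_mem hx, domNoise_of_mem hx, sub_add_cancel]

/-- The state of VRAdam run with the gradients `domGrad`, which, unlike the actual run, is
well-behaved even when the iterates leave the domain. -/
noncomputable abbrev domState (U : Set (EuclideanSpace ℝ (Fin d)))
    (F : EuclideanSpace ℝ (Fin d) → Ξ → ℝ) (x₁ : EuclideanSpace ℝ (Fin d)) (p : VRAdamInput)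
    (ζ : Fin p.S₁ → Ξ) (ξ : ℕ → Ξ) (k : ℕ) : VRAdamState d :=
  vrAdamState p (domGrad U F) x₁ ζ ξ k

/-- The part of the estimation error `m - ∇f(x)` that comes from the differences of noises at
consecutive iterates. The rest is a convex combination of noises, and hence at most `σ`. -/
noncomputable def domCorrection (U : Set (EuclideanSpace ℝ (Fin d)))
    (f : EuclideanSpace ℝ (Fin d) → ℝ) (F : EuclideanSpace ℝ (Fin d) → Ξ → ℝ)
    (x₁ : EuclideanSpace ℝ (Fin d)) (p : VRAdamInput) (ζ : Fin p.S₁ → Ξ) (ξ : ℕ → Ξ) :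
    ℕ → EuclideanSpace ℝ (Fin d)
  | 0 => 0
  | k + 1 => (1 - p.β) • (domCorrection U f F x₁ p ζ ξ k +
      (domNoise U f F (domState U F x₁ p ζ ξ (k + 1)).x (ξ (k + 2))
        - domNoise U f F (domState U F x₁ p ζ ξ k).x (ξ (k + 2))))

theorem vrAdamState_eq_domState {n : ℕ} (h : ∀ k ≤ n, (domState U F x₁ p ζ ξ k).x ∈ U) :
    ∀ k ≤ n, vrAdamState p (stochGrad F) x₁ ζ ξ k = domState U F x₁ p ζ ξ k := by
  intro k hk
  induction k with
  | zero =>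
    have hx : x₁ ∈ U := h 0 hk
    simp only [domState, vrAdamState, vrAdamInit, domGrad_of_mem hx]
  | succ k ih =>
    have hx : (domState U F x₁ p ζ ξ k).x ∈ U := h k (Nat.le_of_succ_le hk)
    have hxNext : (domState U F x₁ p ζ ξ k).xNext ∈ U := h (k + 1) hk
    rw [vrAdamState, domState, vrAdamState, ih (Nat.le_of_succ_le hk)]
    simp only [vrAdamStep, domGrad_of_mem hx, domGrad_of_mem hxNext]

/-- The standing assumptions, with effective smoothness constant `L` and tuned parameters. -/
structure IsTunedProblem (U : Set (EuclideanSpace ℝ (Fin d))) (f : EuclideanSpace ℝ (Fin d) → ℝ)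
    (F : EuclideanSpace ℝ (Fin d) → Ξ → ℝ) (L₀ Lρ ρ L σ G D : ℝ) (p : VRAdamInput) : Prop where
  objective : IsObjective U f
  smooth : IsGenSmoothOn U f L₀ Lρ ρ
  smooth_component : ∀ s, IsGenSmoothOn U (fun x => F x s) L₀ Lρ ρ
  effSmooth : IsEffSmooth L₀ Lρ ρ G L
  tuned : IsTuned d L σ G D p

/-- The noise of every stochastic gradient that the run evaluates is at most `σ`. -/
structure IsNoiseBounded (U : Set (EuclideanSpace ℝ (Fin d))) (f : EuclideanSpace ℝ (Fin d) → ℝ)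
    (F : EuclideanSpace ℝ (Fin d) → Ξ → ℝ) (x₁ : EuclideanSpace ℝ (Fin d)) (σ : ℝ)
    (p : VRAdamInput) (ζ : Fin p.S₁ → Ξ) (ξ : ℕ → Ξ) : Prop where
  batch : ‖(domState U F x₁ p ζ ξ 0).m - gradient f x₁‖ ≤ σ
  sample : ∀ k, k + 2 ≤ p.T → ‖domNoise U f F (domState U F x₁ p ζ ξ (k + 1)).x (ξ (k + 2))‖ ≤ σ
  sample_prev : ∀ k, k + 2 ≤ p.T → ‖domNoise U f F (domState U F x₁ p ζ ξ k).x (ξ (k + 2))‖ ≤ σ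

/-- Up to iteration `k + 1` the iterates stay in the domain, and neither the suboptimality gap nor
the correction has become large. The run is analysed until this fails for the first time. -/
def IsAlive (U : Set (EuclideanSpace ℝ (Fin d))) (f : EuclideanSpace ℝ (Fin d) → ℝ)
    (F : EuclideanSpace ℝ (Fin d) → Ξ → ℝ) (x₁ : EuclideanSpace ℝ (Fin d)) (L G D : ℝ)
    (p : VRAdamInput) (ζ : Fin p.S₁ → Ξ) (ξ : ℕ → Ξ) (k : ℕ) : Prop :=
  ∀ j ≤ k, (domState U F x₁ p ζ ξ j).x ∈ U ∧
    f (domState U F x₁ p ζ ξ j).x - sInf (f '' U) ≤ G ^ 2 / (6 * L) ∧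
    ‖domCorrection U f F x₁ p ζ ξ j‖ ≤ p.lam * D / 2

theorem IsAlive.mono {k l : ℕ} (h : IsAlive U f F x₁ L G D p ζ ξ l) (hkl : k ≤ l) :
    IsAlive U f F x₁ L G D p ζ ξ k := fun j hj => h j (hj.trans hkl)

/-- The state `s` at the end of iteration `k + 1` allows one more step of the analysis: the
gradient and the estimation error are under control, and the next step is a scaled one. Here `w` is
the correction. -/
structure IsRegularState (U : Set (EuclideanSpace ℝ (Fin d))) (f : EuclideanSpace ℝ (Fin d) → ℝ)
    (σ G D : ℝ) (p : VRAdamInput) (k : ℕ) (s : VRAdamState d) (w : EuclideanSpace ℝ (Fin d)) :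
    Prop where
  mem : s.x ∈ U
  gradient_le : ‖gradient f s.x‖ ≤ G
  error_sub_le : ‖s.m - gradient f s.x - w‖ ≤ σ
  error_le : ‖s.m - gradient f s.x‖ ≤ p.lam * D
  v_nonneg : ∀ i, 0 ≤ s.v i
  v_le : ∀ i, s.v i ≤ (1 - (1 - p.β₂) ^ (k + 1)) * (3 / 2 * G) ^ 2
  exists_scaling : ∃ h, IsScaledStep p G (gradient f s.x) (s.m - gradient f s.x) (s.xNext - s.x) h

theorem norm_noise_sub_le (hP : IsTunedProblem U f F L₀ Lρ ρ L σ G D p)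
    {x v : EuclideanSpace ℝ (Fin d)} {s : Ξ} (hx : x ∈ U) (hgrad : ‖gradient f x‖ ≤ G)
    (hv : ‖v‖ ≤ 2 * p.η * D) (hnoise : ‖domNoise U f F x s‖ ≤ σ) :
    ‖domNoise U f F (x + v) s - domNoise U f F x s‖ ≤ 2 * L * ‖v‖ := by
  have hG := hP.tuned.G_pos
  have hvr := (hP.tuned.step_le hv).1
  have hxv : x + v ∈ U := hP.objective.add_mem hP.smooth hP.effSmooth hx (by linarith) hvr
  have hcomponent : ‖stochGrad F x s‖ ≤ 3 / 2 * G := by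
    rw [← domGrad_of_mem hx, domGrad_eq (f := f) hx]
    exact (norm_add_le _ _).trans (by linarith [hP.tuned.σ_le_G])
  have hlip := hP.objective.norm_gradient_sub_le hP.smooth hP.smooth hP.effSmooth hx
    (by linarith) (by linarith) hvr
  have hlip' : ‖stochGrad F (x + v) s - stochGrad F x s‖ ≤ L * ‖v‖ :=
    hP.objective.norm_gradient_sub_le hP.smooth (hP.smooth_component s) hP.effSmooth hx
      (by linarith) hcomponent hvr
  calc ‖domNoise U f F (x + v) s - domNoise U f F x s‖
      = ‖(stochGrad F (x + v) s - stochGrad F x s) - (gradient f (x + v) - gradient f x)‖ := by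
        rw [domNoise_of_mem hx, domNoise_of_mem hxv, sub_sub_sub_comm]
    _ ≤ 2 * L * ‖v‖ := (norm_sub_le _ _).trans (by linarith)

section Transition

variable {k : ℕ} {s : VRAdamState d} {w : EuclideanSpace ℝ (Fin d)}

theorem IsRegularState.norm_step_le (hs : IsRegularState U f σ G D p k s w)
    (hP : IsTunedProblem U f F L₀ Lρ ρ L σ G D p) : ‖s.xNext - s.x‖ ≤ 2 * p.η * D := by
  obtain ⟨h, hh⟩ := hs.exists_scaling
  exact hh.norm_le hP.tuned hs.error_le

theorem IsRegularState.xNext_mem (hs : IsRegularState U f σ G D p k s w)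
    (hP : IsTunedProblem U f F L₀ Lρ ρ L σ G D p) : s.xNext ∈ U := by
  have h := hP.objective.add_mem hP.smooth hP.effSmooth hs.mem
    (hs.gradient_le.trans (by linarith [hP.tuned.G_pos])) (hP.tuned.step_le (hs.norm_step_le hP)).1
  rwa [add_sub_cancel] at h

theorem IsRegularState.norm_gradient_xNext_le (hs : IsRegularState U f σ G D p k s w)
    (hP : IsTunedProblem U f F L₀ Lρ ρ L σ G D p) : ‖gradient f s.xNext‖ ≤ 3 / 2 * G := by
  have hG := hP.tuned.G_pos
  have hstep := hP.tuned.step_le (hs.norm_step_le hP)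
  have hlip := hP.objective.norm_gradient_sub_le hP.smooth hP.smooth hP.effSmooth hs.mem
    (hs.gradient_le.trans (by linarith)) (hs.gradient_le.trans (by linarith)) hstep.1
  rw [add_sub_cancel] at hlip
  linarith [hs.gradient_le, norm_le_norm_add_norm_sub' (gradient f s.xNext) (gradient f s.x)]

theorem IsRegularState.norm_noise_sub_le (hs : IsRegularState U f σ G D p k s w)
    (hP : IsTunedProblem U f F L₀ Lρ ρ L σ G D p) {y : Ξ} (hnoise : ‖domNoise U f F s.x y‖ ≤ σ) :
    ‖domNoise U f F s.xNext y - domNoise U f F s.x y‖ ≤ 2 * L * ‖s.xNext - s.x‖ := by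
  have h := _root_.norm_noise_sub_le hP hs.mem hs.gradient_le (hs.norm_step_le hP) hnoise
  rwa [add_sub_cancel] at h

theorem error_step_eq (hx : s.x ∈ U) (hxNext : s.xNext ∈ U) (y : Ξ) :
    (vrAdamStep p (domGrad U F) (k + 2) s y).m - gradient f s.xNext
      = (1 - p.β) • (s.m - gradient f s.x)
        + (domNoise U f F s.xNext y - (1 - p.β) • domNoise U f F s.x y) := by
  simp only [vrAdamStep, domGrad_eq (f := f) hx, domGrad_eq (f := f) hxNext]
  module

theorem IsRegularState.norm_innovation_le (hs : IsRegularState U f σ G D p k s w)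
    (hP : IsTunedProblem U f F L₀ Lρ ρ L σ G D p) {y : Ξ} (hnoise : ‖domNoise U f F s.x y‖ ≤ σ)
    (hnoise' : ‖domNoise U f F s.xNext y‖ ≤ σ) :
    ‖domNoise U f F s.xNext y - (1 - p.β) • domNoise U f F s.x y‖
      ≤ p.β * σ + 2 * L * ‖s.xNext - s.x‖ := by
  have hβ := hP.tuned.β_pos
  have hβ1 : 0 ≤ 1 - p.β := sub_nonneg.2 hP.tuned.β_le_one
  calc ‖domNoise U f F s.xNext y - (1 - p.β) • domNoise U f F s.x y‖
      = ‖p.β • domNoise U f F s.xNext y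
          + (1 - p.β) • (domNoise U f F s.xNext y - domNoise U f F s.x y)‖ := by
        congr 1; module
    _ ≤ p.β * ‖domNoise U f F s.xNext y‖
          + (1 - p.β) * ‖domNoise U f F s.xNext y - domNoise U f F s.x y‖ := by
        refine (norm_add_le _ _).trans_eq ?_
        rw [norm_smul, norm_smul, Real.norm_of_nonneg hβ.le, Real.norm_of_nonneg hβ1]
    _ ≤ p.β * σ + 2 * L * ‖s.xNext - s.x‖ := by
        refine add_le_add (mul_le_mul_of_nonneg_left hnoise' hβ.le) ?_
        exact (mul_le_of_le_one_left (norm_nonneg _) (sub_le_self 1 hβ.le)).trans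
          (hs.norm_noise_sub_le hP hnoise)

theorem IsRegularState.potential_step_le (hs : IsRegularState U f σ G D p k s w)
    (hP : IsTunedProblem U f F L₀ Lρ ρ L σ G D p) {y : Ξ} (hnoise : ‖domNoise U f F s.x y‖ ≤ σ)
    (hnoise' : ‖domNoise U f F s.xNext y‖ ≤ σ) :
    f s.xNext + p.η / (p.lam * p.β)
        * ‖(vrAdamStep p (domGrad U F) (k + 2) s y).m - gradient f s.xNext‖ ^ 2
      ≤ f s.x + p.η / (p.lam * p.β) * ‖s.m - gradient f s.x‖ ^ 2
        - (p.η / (16 * G) * ‖gradient f s.x‖ ^ 2 + p.lam / (16 * p.η) * ‖s.xNext - s.x‖ ^ 2)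
        + 2 * p.η * p.β * σ ^ 2 / p.lam
        + 2 * (p.η / (p.lam * p.β)) * (1 - p.β) * inner ℝ (s.m - gradient f s.x)
          (domNoise U f F s.xNext y - (1 - p.β) • domNoise U f F s.x y) := by
  obtain ⟨h, hh⟩ := hs.exists_scaling
  rw [error_step_eq hs.mem (hs.xNext_mem hP)]
  have hpotential := hh.potential_le hP.tuned hP.objective hP.smooth hP.effSmooth hs.mem
    hs.gradient_le hs.error_le (hs.norm_innovation_le hP hnoise hnoise')
  rwa [add_sub_cancel] at hpotential

theorem IsRegularState.correction_step_le (hs : IsRegularState U f σ G D p k s w)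
    (hP : IsTunedProblem U f F L₀ Lρ ρ L σ G D p) {y : Ξ} (hnoise : ‖domNoise U f F s.x y‖ ≤ σ) :
    ‖(1 - p.β) • (w + (domNoise U f F s.xNext y - domNoise U f F s.x y))‖ ^ 6
      ≤ ‖w‖ ^ 6 + 6 * (1 - p.β) ^ 6
          * (‖w‖ ^ 4 * inner ℝ w (domNoise U f F s.xNext y - domNoise U f F s.x y))
        + 2 * 40 ^ 3 * (D ^ 2 * p.lam ^ 3 / (100 * G)) ^ 2 * (4 * L ^ 2)
          * ‖s.xNext - s.x‖ ^ 2 := by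
  have hG := hP.tuned.G_pos
  have hβ := hP.tuned.β_pos
  set q := 4 * L ^ 2 * ‖s.xNext - s.x‖ ^ 2 with hq
  have hz : ‖domNoise U f F s.xNext y - domNoise U f F s.x y‖ ^ 2 ≤ q :=
    (pow_le_pow_left₀ (norm_nonneg _) (hs.norm_noise_sub_le hP hnoise) 2).trans_eq (by ring)
  have hqβ : q / p.β ≤ D ^ 2 * p.lam ^ 3 / (100 * G) := by
    rw [div_le_div_iff₀ hβ (by positivity)]
    calc q * (100 * G) ≤ 4 * L ^ 2 * (2 * p.η * D) ^ 2 * (100 * G) := by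
          rw [hq]; gcongr; exact hs.norm_step_le hP
      _ = D ^ 2 * (1600 * L ^ 2 * G * p.η ^ 2) := by ring
      _ = D ^ 2 * p.lam ^ 3 * p.β := by rw [← hP.tuned.β_eq]; ring
  have hremainder : 2 * 40 ^ 3 * (q / p.β) ^ 2 * q
      ≤ 2 * 40 ^ 3 * (D ^ 2 * p.lam ^ 3 / (100 * G)) ^ 2 * q := by gcongr
  linarith [norm_smul_add_pow_six_le w _ hβ hP.tuned.β_le_one hz]

end Transition

section Regular

theorem norm_le_lam_mul_of_norm_sub_le (hp : IsTuned d L σ G D p)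
    {e w : EuclideanSpace ℝ (Fin d)} (hew : ‖e - w‖ ≤ σ) (hw : ‖w‖ ≤ p.lam * D / 2) :
    ‖e‖ ≤ p.lam * D := by
  linarith [norm_le_norm_add_norm_sub' e w, hp.σ_le_D]

theorem abs_apply_le_of_norm_sub_le (hp : IsTuned d L σ G D p)
    {y g : EuclideanSpace ℝ (Fin d)} (hyg : ‖y - g‖ ≤ σ) (hg : ‖g‖ ≤ G) (i : Fin d) :
    |y i| ≤ 3 / 2 * G := by
  have hi : |y i| ≤ ‖y‖ := PiLp.norm_apply_le y i
  linarith [norm_le_norm_add_norm_sub' y g, hp.σ_le_G]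

theorem IsNoiseBounded.isRegularState_zero (hp : IsTuned d L σ G D p) (hx₁U : x₁ ∈ U)
    (hx₁ : ‖gradient f x₁‖ ≤ G) (hn : IsNoiseBounded U f F x₁ σ p ζ ξ) :
    IsRegularState U f σ G D p 0 (domState U F x₁ p ζ ξ 0) 0 := by
  have hβ₂ := hp.β₂_pos
  have hD : 0 ≤ p.lam * D / 2 := by
    have := hp.lam_pos; have := hp.one_le_D; positivity
  have hsqrt : √p.β₂ ≤ 1 := Real.sqrt_le_one.2 hp.β₂_le_one
  have hbatch := hn.batch
  set s := domState U F x₁ p ζ ξ 0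
  have hm := abs_apply_le_of_norm_sub_le hp hbatch hx₁
  have hv (i : Fin d) : s.v i = p.β₂ * s.m i ^ 2 := rfl
  have hxNext (i : Fin d) : s.xNext i = s.x i - p.η * s.m i / (|s.m i| + p.lam) := rfl
  have herror : ‖s.m - gradient f s.x - 0‖ ≤ σ := by rwa [sub_zero]
  refine ⟨hx₁U, hx₁, herror, norm_le_lam_mul_of_norm_sub_le hp herror (by simpa using hD),
    fun i => ?_, fun i => ?_, ?_⟩
  · rw [hv]; positivity
  · rw [hv, zero_add, pow_one, sub_sub_cancel, ← sq_abs]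
    gcongr
    exact hm i
  · refine ⟨_, isScaledStep_of_denominator hp hbatch (fun i => abs_nonneg (s.m i))
      (fun i => mul_le_of_le_one_left (abs_nonneg _) hsqrt) hm fun i => ?_⟩
    simp only [PiLp.sub_apply, hxNext, show s.x = x₁ from rfl]
    ring

variable {k : ℕ} {s : VRAdamState d} {w : EuclideanSpace ℝ (Fin d)} {y : Ξ}

theorem IsRegularState.norm_error_step_sub_le (hs : IsRegularState U f σ G D p k s w)
    (hP : IsTunedProblem U f F L₀ Lρ ρ L σ G D p) (hnoise' : ‖domNoise U f F s.xNext y‖ ≤ σ) :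
    ‖(vrAdamStep p (domGrad U F) (k + 2) s y).m - gradient f s.xNext
      - (1 - p.β) • (w + (domNoise U f F s.xNext y - domNoise U f F s.x y))‖ ≤ σ := by
  have hβ := hP.tuned.β_pos
  have hβ1 : 0 ≤ 1 - p.β := sub_nonneg.2 hP.tuned.β_le_one
  calc ‖(vrAdamStep p (domGrad U F) (k + 2) s y).m - gradient f s.xNext
        - (1 - p.β) • (w + (domNoise U f F s.xNext y - domNoise U f F s.x y))‖
      = ‖(1 - p.β) • (s.m - gradient f s.x - w) + p.β • domNoise U f F s.xNext y‖ := by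
        rw [error_step_eq hs.mem (hs.xNext_mem hP)]
        congr 1
        module
    _ ≤ (1 - p.β) * ‖s.m - gradient f s.x - w‖ + p.β * ‖domNoise U f F s.xNext y‖ := by
        refine (norm_add_le _ _).trans_eq ?_
        rw [norm_smul, norm_smul, Real.norm_of_nonneg hβ.le, Real.norm_of_nonneg hβ1]
    _ ≤ (1 - p.β) * σ + p.β * σ := by
        gcongr
        exact hs.error_sub_le
    _ = σ := by ring

theorem IsRegularState.v_step_nonneg (hs : IsRegularState U f σ G D p k s w)
    (hp : IsTuned d L σ G D p) (i : Fin d) :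
    0 ≤ (vrAdamStep p (domGrad U F) (k + 2) s y).v i :=
  add_nonneg (mul_nonneg (sub_nonneg.2 hp.β₂_le_one) (hs.v_nonneg i))
    (mul_nonneg hp.β₂_pos.le (sq_nonneg _))

theorem IsRegularState.v_step_le (hs : IsRegularState U f σ G D p k s w)
    (hp : IsTuned d L σ G D p) {i : Fin d} (hy : |domGrad U F s.xNext y i| ≤ 3 / 2 * G) :
    (vrAdamStep p (domGrad U F) (k + 2) s y).v i
      ≤ (1 - (1 - p.β₂) ^ (k + 2)) * (3 / 2 * G) ^ 2 := by
  have hβ₂ := hp.β₂_pos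
  have hβ₂1 : 0 ≤ 1 - p.β₂ := sub_nonneg.2 hp.β₂_le_one
  calc (vrAdamStep p (domGrad U F) (k + 2) s y).v i
      = (1 - p.β₂) * s.v i + p.β₂ * |domGrad U F s.xNext y i| ^ 2 := by
        rw [sq_abs]; rfl
    _ ≤ (1 - p.β₂) * ((1 - (1 - p.β₂) ^ (k + 1)) * (3 / 2 * G) ^ 2)
        + p.β₂ * (3 / 2 * G) ^ 2 := by
        gcongr
        exact hs.v_le i
    _ = (1 - (1 - p.β₂) ^ (k + 2)) * (3 / 2 * G) ^ 2 := by ring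

theorem IsTuned.bias_pow_mem_Ico (hp : IsTuned d L σ G D p) :
    (1 - p.β₂) ^ (k + 2) ∈ Set.Ico 0 1 := by
  have hβ₂1 : 0 ≤ 1 - p.β₂ := sub_nonneg.2 hp.β₂_le_one
  exact ⟨pow_nonneg hβ₂1 _, pow_lt_one₀ hβ₂1 (by linarith [hp.β₂_pos]) (by omega)⟩

theorem IsRegularState.isScaledStep_step (hs : IsRegularState U f σ G D p k s w)
    (hp : IsTuned d L σ G D p) (hgrad : ‖gradient f s.xNext‖ ≤ G)
    (hnoise' : ‖domGrad U F s.xNext y - gradient f s.xNext‖ ≤ σ) :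
    let s' := vrAdamStep p (domGrad U F) (k + 2) s y
    ∃ h, IsScaledStep p G (gradient f s'.x) (s'.m - gradient f s'.x) (s'.xNext - s'.x) h := by
  intro s'
  have hG := hp.G_pos
  have hβ₂ := hp.β₂_pos
  obtain ⟨hbias0, hbias1⟩ := hp.bias_pow_mem_Ico (k := k)
  have hbias : 0 < 1 - (1 - p.β₂) ^ (k + 2) := sub_pos.2 hbias1
  have hxNext (i : Fin d) : s'.xNext i
      = s'.x i - p.η / (√(s'.v i / (1 - (1 - p.β₂) ^ (k + 2))) + p.lam) * s'.m i := rfl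
  refine ⟨_, isScaledStep_of_denominator hp hnoise'
    (q := fun i => √(s'.v i / (1 - (1 - p.β₂) ^ (k + 2)))) (fun i => Real.sqrt_nonneg _)
    (fun i => ?_) (fun i => ?_) fun i => ?_⟩
  · have hle_v : p.β₂ * domGrad U F s.xNext y i ^ 2 ≤ s'.v i :=
      le_add_of_nonneg_left (mul_nonneg (sub_nonneg.2 hp.β₂_le_one) (hs.v_nonneg i))
    rw [← Real.sqrt_sq_eq_abs, ← Real.sqrt_mul hβ₂.le]
    exact Real.sqrt_le_sqrt (hle_v.trans
      (le_div_self (hs.v_step_nonneg hp i) hbias (by linarith)))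
  · rw [Real.sqrt_le_left (by positivity), div_le_iff₀ hbias, mul_comm]
    exact hs.v_step_le hp (abs_apply_le_of_norm_sub_le hp hnoise' hgrad i)
  · simp only [PiLp.sub_apply, hxNext, show s'.x = s.xNext from rfl]
    ring

theorem IsRegularState.norm_gradient_xNext_le_of_gap_le (hs : IsRegularState U f σ G D p k s w)
    (hP : IsTunedProblem U f F L₀ Lρ ρ L σ G D p)
    (hgap : f s.xNext - sInf (f '' U) ≤ G ^ 2 / (6 * L)) : ‖gradient f s.xNext‖ ≤ G := by
  have hL := hP.tuned.L_pos
  refine le_of_sq_le_sq ?_ hP.tuned.G_pos.le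
  calc ‖gradient f s.xNext‖ ^ 2 ≤ 6 * L * (f s.xNext - sInf (f '' U)) :=
        hP.objective.sq_norm_gradient_le hP.smooth hP.effSmooth (hs.xNext_mem hP)
          (hs.norm_gradient_xNext_le hP)
    _ ≤ 6 * L * (G ^ 2 / (6 * L)) := by gcongr
    _ = G ^ 2 := by field_simp

theorem IsRegularState.step (hs : IsRegularState U f σ G D p k s w)
    (hP : IsTunedProblem U f F L₀ Lρ ρ L σ G D p) (hnoise' : ‖domNoise U f F s.xNext y‖ ≤ σ)
    (hgap : f s.xNext - sInf (f '' U) ≤ G ^ 2 / (6 * L))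
    (hw : ‖(1 - p.β) • (w + (domNoise U f F s.xNext y - domNoise U f F s.x y))‖ ≤ p.lam * D / 2) :
    IsRegularState U f σ G D p (k + 1) (vrAdamStep p (domGrad U F) (k + 2) s y)
      ((1 - p.β) • (w + (domNoise U f F s.xNext y - domNoise U f F s.x y))) := by
  have hmem := hs.xNext_mem hP
  have hgrad := hs.norm_gradient_xNext_le_of_gap_le hP hgap
  have herror := hs.norm_error_step_sub_le hP hnoise'
  have hy : ‖domGrad U F s.xNext y - gradient f s.xNext‖ ≤ σ := by
    rwa [domGrad_eq (f := f) hmem, add_sub_cancel_right]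
  exact
    { mem := hmem
      gradient_le := hgrad
      error_sub_le := herror
      error_le := norm_le_lam_mul_of_norm_sub_le hP.tuned herror hw
      v_nonneg := hs.v_step_nonneg hP.tuned
      v_le := fun i => hs.v_step_le hP.tuned (abs_apply_le_of_norm_sub_le hP.tuned hy hgrad i)
      exists_scaling := hs.isScaledStep_step hP.tuned hgrad hy }

theorem IsAlive.isRegularState (hP : IsTunedProblem U f F L₀ Lρ ρ L σ G D p)
    (hx₁ : ‖gradient f x₁‖ ≤ G) (hn : IsNoiseBounded U f F x₁ σ p ζ ξ) (hk : k + 1 ≤ p.T)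
    (ha : IsAlive U f F x₁ L G D p ζ ξ k) :
    IsRegularState U f σ G D p k (domState U F x₁ p ζ ξ k) (domCorrection U f F x₁ p ζ ξ k) := by
  induction k with
  | zero => exact hn.isRegularState_zero hP.tuned (ha 0 le_rfl).1 hx₁
  | succ k ih =>
    obtain ⟨-, hgap, hw⟩ := ha (k + 1) le_rfl
    exact (ih (Nat.le_of_succ_le hk) (ha.mono k.le_succ)).step hP (hn.sample k hk) hgap hw

end Regular

end Trajectory

/-! ### Measurability along the trajectory -/

theorem measurable_indicator_uncurry {E E' Ξ : Type*} [TopologicalSpace E]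
    [TopologicalSpace.MetrizableSpace E] [SecondCountableTopology E] [MeasurableSpace E]
    [BorelSpace E] [TopologicalSpace E'] [TopologicalSpace.PseudoMetrizableSpace E']
    [MeasurableSpace E'] [BorelSpace E'] [Zero E'] [MeasurableSpace Ξ] {U : Set E}
    (hU : MeasurableSet U) {u : E → Ξ → E'} (hc : ∀ s, ContinuousOn (fun x => u x s) U)
    (hm : ∀ x ∈ U, Measurable (u x)) :
    Measurable fun z : E × Ξ => U.indicator (fun y => u y z.2) z.1 := by
  classical
  have hsubtype : Measurable (Function.uncurry fun (x : U) (s : Ξ) => u x s) :=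
    measurable_uncurry_of_continuous_of_measurable
      (fun s => continuousOn_iff_continuous_domRestrict.1 (hc s)) fun x => hm x x.2
  have hrestrict : Measurable fun z : {z : E × Ξ | z.1 ∈ U} =>
      Function.uncurry (fun (x : U) (s : Ξ) => u x s) (⟨z.1.1, z.2⟩, z.1.2) :=
    hsubtype.comp <| (measurable_fst.comp measurable_subtype_coe).subtype_mk.prodMk
      (measurable_snd.comp measurable_subtype_coe)
  have hdite := hrestrict.dite (g := fun _ => (0 : E')) measurable_const (measurable_fst hU)
  convert hdite using 2 with z
  by_cases hz : z.1 ∈ U <;> simp [hz]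

theorem measurable_indicator_of_continuousOn {E E' : Type*} [TopologicalSpace E]
    [MeasurableSpace E] [BorelSpace E] [TopologicalSpace E'] [MeasurableSpace E'] [BorelSpace E']
    [Zero E'] {U : Set E} {u : E → E'} (hu : ContinuousOn u U) (hU : MeasurableSet U) :
    Measurable (U.indicator u) := by
  classical
  rw [← Set.piecewise_eq_indicator]
  exact hu.measurable_piecewise continuousOn_const hU

/-- All components of the random state `s` are measurable with respect to the σ-algebra `𝓕`. -/
structure IsMeasurableState {Ω : Type*} (𝓕 : MeasurableSpace Ω) {d : ℕ}
    (s : Ω → VRAdamState d) : Prop where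
  x : Measurable[𝓕] fun ω => (s ω).x
  xNext : Measurable[𝓕] fun ω => (s ω).xNext
  m : Measurable[𝓕] fun ω => (s ω).m
  v : Measurable[𝓕] fun ω => (s ω).v

section Measurability

variable {Ω Ξ : Type*} {𝓕 : MeasurableSpace Ω} [MeasurableSpace Ξ] {d : ℕ} {p : VRAdamInput}
  {x₁ : EuclideanSpace ℝ (Fin d)} {g : EuclideanSpace ℝ (Fin d) → Ξ → EuclideanSpace ℝ (Fin d)}
  {ζ : Fin p.S₁ → Ω → Ξ} {ξ : ℕ → Ω → Ξ}

theorem isMeasurableState_vrAdamInit (hg : ∀ x, Measurable (g x)) (hζ : ∀ i, Measurable (ζ i)) :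
    IsMeasurableState 𝓕 fun ω => vrAdamInit p g x₁ fun i => ζ i ω := by
  have hm : Measurable fun ω => (vrAdamInit p g x₁ fun i => ζ i ω).m :=
    (Finset.measurable_fun_sum _ fun i _ => (hg x₁).comp (hζ i)).const_smul (1 / (p.S₁ : ℝ))
  simp only [vrAdamInit] at hm
  constructor <;> simp only [vrAdamInit] <;> fun_prop

theorem IsMeasurableState.vrAdamStep {s : Ω → VRAdamState d} (hs : IsMeasurableState 𝓕 s)
    (hg : Measurable fun z : EuclideanSpace ℝ (Fin d) × Ξ => g z.1 z.2) {y : Ω → Ξ}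
    (hy : Measurable y) (t : ℕ) : IsMeasurableState 𝓕 fun ω => vrAdamStep p g t (s ω) (y ω) := by
  obtain ⟨hx, hxNext, hm, hv⟩ := hs
  have : Measurable fun ω => g (s ω).x (y ω) := hg.comp (hx.prodMk hy)
  have : Measurable fun ω => g (s ω).xNext (y ω) := hg.comp (hxNext.prodMk hy)
  constructor <;> simp only [_root_.vrAdamStep] <;> fun_prop

theorem isMeasurableState_vrAdamState
    (hg : Measurable fun z : EuclideanSpace ℝ (Fin d) × Ξ => g z.1 z.2)
    (hζ : ∀ i, Measurable (ζ i)) {k : ℕ} (hξ : ∀ j ∈ Finset.Icc 2 (k + 1), Measurable (ξ j)) :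
    IsMeasurableState 𝓕 fun ω => vrAdamState p g x₁ (fun i => ζ i ω) (fun j => ξ j ω) k := by
  induction k with
  | zero => exact isMeasurableState_vrAdamInit (fun x => hg.comp measurable_prodMk_left) hζ
  | succ k ih =>
    exact (ih fun j hj => hξ j (Finset.Icc_subset_Icc_right (Nat.le_succ _) hj)).vrAdamStep hg
      (hξ (k + 2) (by simp)) (k + 2)

variable {U : Set (EuclideanSpace ℝ (Fin d))} {f : EuclideanSpace ℝ (Fin d) → ℝ}
  {F : EuclideanSpace ℝ (Fin d) → Ξ → ℝ} {P : Measure Ξ} {L₀ Lρ ρ σ : ℝ}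

theorem measurable_domGrad (hU : IsOpen U) (hF : ∀ s, IsGenSmoothOn U (fun x => F x s) L₀ Lρ ρ)
    (hN : IsBoundedNoise U f F P σ) :
    Measurable fun z : EuclideanSpace ℝ (Fin d) × Ξ => domGrad U F z.1 z.2 :=
  measurable_indicator_uncurry hU.measurableSet
    (fun s => (hF s).differentiableOn_gradient.continuousOn) hN.measurable

theorem measurable_domNoise (hU : IsOpen U) (hf : IsGenSmoothOn U f L₀ Lρ ρ)
    (hF : ∀ s, IsGenSmoothOn U (fun x => F x s) L₀ Lρ ρ) (hN : IsBoundedNoise U f F P σ) :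
    Measurable fun z : EuclideanSpace ℝ (Fin d) × Ξ => domNoise U f F z.1 z.2 :=
  measurable_indicator_uncurry hU.measurableSet
    (fun s => (hF s).differentiableOn_gradient.continuousOn.sub
      hf.differentiableOn_gradient.continuousOn) fun x hx => (hN.measurable x hx).sub_const _

theorem measurable_domCorrection (hU : IsOpen U) (hf : IsGenSmoothOn U f L₀ Lρ ρ)
    (hF : ∀ s, IsGenSmoothOn U (fun x => F x s) L₀ Lρ ρ) (hN : IsBoundedNoise U f F P σ)
    (hζ : ∀ i, Measurable (ζ i)) {k : ℕ} (hξ : ∀ j ∈ Finset.Icc 2 (k + 1), Measurable (ξ j)) :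
    Measurable fun ω => domCorrection U f F x₁ p (fun i => ζ i ω) (fun j => ξ j ω) k := by
  induction k with
  | zero => exact measurable_const
  | succ k ih =>
    have hξ' : ∀ j ∈ Finset.Icc 2 (k + 1), Measurable (ξ j) :=
      fun j hj => hξ j (Finset.Icc_subset_Icc_right (Nat.le_succ _) hj)
    have hξk : Measurable (ξ (k + 2)) := hξ (k + 2) (by simp)
    have hstate := isMeasurableState_vrAdamState (x₁ := x₁) (measurable_domGrad hU hF hN) hζ hξ'
    have hnoise := measurable_domNoise hU hf hF hN
    exact ((ih hξ').add ((hnoise.comp (hstate.xNext.prodMk hξk)).sub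
      (hnoise.comp (hstate.x.prodMk hξk)))).const_smul (1 - p.β)

theorem measurableSet_isAlive {L G D : ℝ} (hO : IsObjective U f) (hf : IsGenSmoothOn U f L₀ Lρ ρ)
    (hF : ∀ s, IsGenSmoothOn U (fun x => F x s) L₀ Lρ ρ) (hN : IsBoundedNoise U f F P σ)
    (hζ : ∀ i, Measurable (ζ i)) {k : ℕ} (hξ : ∀ j ∈ Finset.Icc 2 (k + 1), Measurable (ξ j)) :
    MeasurableSet {ω | IsAlive U f F x₁ L G D p (fun i => ζ i ω) (fun j => ξ j ω) k} := by
  have hinter : {ω | IsAlive U f F x₁ L G D p (fun i => ζ i ω) (fun j => ξ j ω) k}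
      = ⋂ j, ⋂ _ : j ≤ k,
        ({ω | (domState U F x₁ p (fun i => ζ i ω) (fun j => ξ j ω) j).x ∈
          {x ∈ U | f x ≤ G ^ 2 / (6 * L) + sInf (f '' U)}} ∩
        {ω | ‖domCorrection U f F x₁ p (fun i => ζ i ω) (fun j => ξ j ω) j‖ ≤ p.lam * D / 2}) := by
    ext ω
    simp only [IsAlive, Set.mem_iInter, Set.mem_inter_iff, Set.mem_ofPred_eq, sub_le_iff_le_add,
      and_assoc]
  rw [hinter]
  refine MeasurableSet.iInter fun j => MeasurableSet.iInter fun hj => ?_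
  have hξ' : ∀ i ∈ Finset.Icc 2 (j + 1), Measurable (ξ i) :=
    fun i hi => hξ i (Finset.Icc_subset_Icc_right (by omega) hi)
  exact ((isMeasurableState_vrAdamState (measurable_domGrad hO.isOpen hF hN) hζ hξ').x
    (hO.isClosed_sublevel _).measurableSet).inter
    (measurableSet_le (measurable_domCorrection hO.isOpen hf hF hN hζ hξ').norm measurable_const)

end Measurability

/-! ### Independence of the past and the next sample -/

section Independence

variable {Ω Ξ X : Type*} [MeasurableSpace Ξ]

/-- The indices of the mega-batch and of the samples used in iterations `2, …, k + 1`. -/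
def pastIndices (S₁ T k : ℕ) : Set (Fin S₁ ⊕ Finset.Icc 2 T) :=
  {i | Sum.elim (fun _ => True) (fun t : Finset.Icc 2 T => (t : ℕ) ≤ k + 1) i}

/-- The σ-algebra of the mega-batch and of the samples used in iterations `2, …, k + 1`. -/
abbrev pastSigma {S₁ : ℕ} (T : ℕ) (ζ : Fin S₁ → Ω → Ξ) (ξ : ℕ → Ω → Ξ) (k : ℕ) :
    MeasurableSpace Ω :=
  ⨆ i ∈ pastIndices S₁ T k,
    MeasurableSpace.comap (Sum.elim ζ (fun t : Finset.Icc 2 T => ξ t) i) inferInstance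

variable {S₁ T k : ℕ} {ζ : Fin S₁ → Ω → Ξ} {ξ : ℕ → Ω → Ξ}

theorem measurable_pastSigma_of_mem {i : Fin S₁ ⊕ Finset.Icc 2 T} (hi : i ∈ pastIndices S₁ T k) :
    Measurable[pastSigma T ζ ξ k] (Sum.elim ζ (fun t : Finset.Icc 2 T => ξ t) i) :=
  (comap_measurable _).mono (le_biSup (fun i => MeasurableSpace.comap
    (Sum.elim ζ (fun t : Finset.Icc 2 T => ξ t) i) inferInstance) hi) le_rfl

theorem measurable_batch_pastSigma (k : ℕ) (i : Fin S₁) :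
    Measurable[pastSigma T ζ ξ k] (ζ i) :=
  measurable_pastSigma_of_mem (i := Sum.inl i) trivial

theorem measurable_sample_pastSigma {j : ℕ} (hk : k + 1 ≤ T) (hj : j ∈ Finset.Icc 2 (k + 1)) :
    Measurable[pastSigma T ζ ξ k] (ξ j) :=
  measurable_pastSigma_of_mem (i := Sum.inr ⟨j, Finset.Icc_subset_Icc_right hk hj⟩)
    (Finset.mem_Icc.1 hj).2

variable [mΩ : MeasurableSpace Ω] [MeasurableSpace X] {μ : Measure Ω} {P : Measure Ξ}

theorem IsIIDSampling.measurable_family (h : IsIIDSampling μ P S₁ T ζ ξ)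
    (i : Fin S₁ ⊕ Finset.Icc 2 T) :
    Measurable (Sum.elim ζ (fun t : Finset.Icc 2 T => ξ t) i) := by
  rcases i with i | t
  · exact h.measurable_batch i
  · exact h.measurable_sample t t.2

theorem IsIIDSampling.pastSigma_le (h : IsIIDSampling μ P S₁ T ζ ξ) (k : ℕ) :
    pastSigma T ζ ξ k ≤ mΩ :=
  iSup₂_le fun i _ => (h.measurable_family i).comap_le

theorem IsIIDSampling.indepFun_of_measurable_past (h : IsIIDSampling μ P S₁ T ζ ξ)
    (hk : k + 2 ≤ T) {Z : Ω → X} (hZ : Measurable[pastSigma T ζ ξ k] Z) :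
    IndepFun Z (ξ (k + 2)) μ := by
  have hkT : k + 2 ∈ Finset.Icc 2 T := Finset.mem_Icc.2 ⟨by omega, hk⟩
  have hdisjoint : Disjoint (pastIndices S₁ T k) {Sum.inr ⟨k + 2, hkT⟩} :=
    Set.disjoint_singleton_right.2 (Nat.not_succ_le_self (k + 1))
  have hind := indep_iSup_of_disjoint (fun i => (h.measurable_family i).comap_le) h.indep hdisjoint
  rw [iSup_singleton] at hind
  exact (IndepFun_iff_Indep _ _ _).2 (indep_of_indep_of_le_left hind hZ.comap_le)

section ProductLaw

variable [IsFiniteMeasure μ] {Z : Ω → X} {Y : Ω → Ξ}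

theorem integral_eq_zero_of_indepFun {E : Type*} [NormedAddCommGroup E]
    [NormedSpace ℝ E] (hZY : IndepFun Z Y μ) (hZ : Measurable Z) (hY : Measurable Y)
    (hP : μ.map Y = P) {φ : X × Ξ → E} (hφ : StronglyMeasurable φ)
    (h0 : ∀ z, ∫ s, φ (z, s) ∂P = 0) : ∫ ω, φ (Z ω, Y ω) ∂μ = 0 := by
  subst hP
  rw [← integral_map (φ := fun ω => (Z ω, Y ω)) (f := φ) (hZ.prodMk hY).aemeasurable
    hφ.aestronglyMeasurable,
    (indepFun_iff_map_prod_eq_prod_map_map hZ.aemeasurable hY.aemeasurable).1 hZY]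
  by_cases hi : Integrable φ ((μ.map Z).prod (μ.map Y))
  · simp only [integral_prod _ hi, h0, integral_zero]
  · exact integral_undef hi

theorem ae_of_indepFun (hZY : IndepFun Z Y μ) (hZ : Measurable Z) (hY : Measurable Y)
    (hP : μ.map Y = P) {q : X × Ξ → Prop} (hq : MeasurableSet {z | q z})
    (h0 : ∀ z, ∀ᵐ s ∂P, q (z, s)) : ∀ᵐ ω ∂μ, q (Z ω, Y ω) := by
  subst hP
  have hprod : ∀ᵐ z ∂((μ.map Z).prod (μ.map Y)), q z :=
    (Measure.ae_prod_mem_iff_ae_ae_mem hq).2 (Filter.Eventually.of_forall h0)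
  rw [← (indepFun_iff_map_prod_eq_prod_map_map hZ.aemeasurable hY.aemeasurable).1 hZY] at hprod
  exact (ae_map_iff (hZ.prodMk hY).aemeasurable hq).1 hprod

end ProductLaw

end Independence

/-! ### The law of the noise -/

section Noise

variable {d : ℕ} {Ξ : Type*} [MeasurableSpace Ξ] {U : Set (EuclideanSpace ℝ (Fin d))}
  {f : EuclideanSpace ℝ (Fin d) → ℝ} {F : EuclideanSpace ℝ (Fin d) → Ξ → ℝ} {P : Measure Ξ}
  {σ : ℝ}

theorem IsBoundedNoise.ae_norm_domNoise_le (hN : IsBoundedNoise U f F P σ) (hσ : 0 ≤ σ)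
    (x : EuclideanSpace ℝ (Fin d)) : ∀ᵐ s ∂P, ‖domNoise U f F x s‖ ≤ σ := by
  by_cases hx : x ∈ U
  · simpa only [domNoise_of_mem hx] using hN.bounded x hx
  · simp [domNoise_of_notMem hx, hσ]

theorem IsBoundedNoise.measurable_domNoise_apply (hN : IsBoundedNoise U f F P σ)
    (x : EuclideanSpace ℝ (Fin d)) : Measurable (domNoise U f F x) := by
  by_cases hx : x ∈ U
  · rw [funext (domNoise_of_mem hx)]
    exact (hN.measurable x hx).sub_const _
  · rw [domNoise_of_notMem hx]
    exact measurable_const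

variable [IsProbabilityMeasure P]

theorem IsBoundedNoise.integrable_domNoise (hN : IsBoundedNoise U f F P σ) (hσ : 0 ≤ σ)
    (x : EuclideanSpace ℝ (Fin d)) : Integrable (domNoise U f F x) P :=
  Integrable.of_bound (hN.measurable_domNoise_apply x).aestronglyMeasurable σ
    (hN.ae_norm_domNoise_le hσ x)

theorem IsBoundedNoise.integral_domNoise (hN : IsBoundedNoise U f F P σ) (hσ : 0 ≤ σ)
    (x : EuclideanSpace ℝ (Fin d)) : ∫ s, domNoise U f F x s ∂P = 0 := by
  by_cases hx : x ∈ U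
  · have hgrad : Integrable (stochGrad F x) P := by
      refine ((hN.integrable_domNoise hσ x).add (integrable_const (gradient f x))).congr ?_
      exact .of_forall fun s => by simp [domNoise_of_mem hx]
    simp only [domNoise_of_mem hx]
    rw [integral_sub hgrad (integrable_const _), hN.unbiased x hx]
    simp
  · simp [domNoise_of_notMem hx]

theorem IsBoundedNoise.integral_inner_eq_zero (hN : IsBoundedNoise U f F P σ) (hσ : 0 ≤ σ)
    (y x x' : EuclideanSpace ℝ (Fin d)) (b : ℝ) :
    ∫ s, (inner ℝ y (domNoise U f F x' s - b • domNoise U f F x s) : ℝ) ∂P = 0 := by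
  have hx := (hN.integrable_domNoise hσ x).smul b
  have hx' := hN.integrable_domNoise hσ x'
  have hinner := integral_inner (𝕜 := ℝ) (hx'.sub hx) y
  simp only [Pi.sub_apply, Pi.smul_apply] at hinner
  have hsub : ∫ s, (domNoise U f F x' s - b • domNoise U f F x s) ∂P = 0 := by
    have := integral_sub hx' hx
    simp only [Pi.smul_apply] at this
    rw [this, integral_smul, hN.integral_domNoise hσ, hN.integral_domNoise hσ, smul_zero, sub_zero]
  rw [hinner, hsub, inner_zero_right]

end Noise

/-! ### Summing up a drift inequality -/

/-- A potential `Φ` that, on a decreasing sequence of events `A`, drops by `q` in each of the first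
`n` steps, up to terms `M` of integral zero. The `k`-th step is taken on `A k`, and no information
on `Φ` remains after the event `A k` is left. -/
structure IsDrift {Ω : Type*} [MeasurableSpace Ω] (μ : Measure Ω) (A : ℕ → Set Ω)
    (Φ q M : ℕ → Ω → ℝ) (n : ℕ) : Prop where
  measurableSet : ∀ k ≤ n, MeasurableSet (A k)
  subset : ∀ k < n, A (k + 1) ⊆ A k
  aestronglyMeasurable : ∀ k ≤ n, AEStronglyMeasurable (Φ k) μ
  integrableOn_zero : IntegrableOn (Φ 0) (A 0) μ
  nonneg : ∀ k < n, ∀ᵐ ω ∂μ, ω ∈ A k → 0 ≤ Φ (k + 1) ω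
  integrableOn_decrease : ∀ k < n, IntegrableOn (q k) (A k) μ
  integrableOn_noise : ∀ k < n, IntegrableOn (M k) (A k) μ
  setIntegral_noise : ∀ k < n, ∫ ω in A k, M k ω ∂μ = 0
  step_le : ∀ k < n, ∀ᵐ ω ∂μ, ω ∈ A k → Φ (k + 1) ω ≤ Φ k ω - q k ω + M k ω

namespace IsDrift

variable {Ω : Type*} [MeasurableSpace Ω] {μ : Measure Ω} {A : ℕ → Set Ω} {Φ q M : ℕ → Ω → ℝ}
  {n k : ℕ}

theorem integrableOn_bound (h : IsDrift μ A Φ q M n) (hk : k < n)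
    (hΦ : IntegrableOn (Φ k) (A k) μ) : IntegrableOn (fun ω => Φ k ω - q k ω + M k ω) (A k) μ :=
  (hΦ.sub (h.integrableOn_decrease k hk)).add (h.integrableOn_noise k hk)

theorem integrableOn_succ_of_integrableOn (h : IsDrift μ A Φ q M n) (hk : k < n)
    (hΦ : IntegrableOn (Φ k) (A k) μ) : IntegrableOn (Φ (k + 1)) (A k) μ := by
  refine Integrable.mono' (h.integrableOn_bound hk hΦ) (h.aestronglyMeasurable (k + 1) hk).restrict
    ((ae_restrict_iff' (h.measurableSet k hk.le)).2 ?_)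
  filter_upwards [h.step_le k hk, h.nonneg k hk] with ω hstep hnonneg hω
  exact (Real.norm_of_nonneg (hnonneg hω)).trans_le (hstep hω)

theorem integrableOn (h : IsDrift μ A Φ q M n) (hk : k ≤ n) : IntegrableOn (Φ k) (A k) μ := by
  induction k with
  | zero => exact h.integrableOn_zero
  | succ k ih =>
    exact (h.integrableOn_succ_of_integrableOn hk (ih (Nat.le_of_succ_le hk))).mono_set
      (h.subset k hk)

theorem integrableOn_succ (h : IsDrift μ A Φ q M n) (hk : k < n) :
    IntegrableOn (Φ (k + 1)) (A k) μ :=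
  h.integrableOn_succ_of_integrableOn hk (h.integrableOn hk.le)

theorem setIntegral_succ_add_le (h : IsDrift μ A Φ q M n) (hk : k < n) :
    ∫ ω in A (k + 1), Φ (k + 1) ω ∂μ + ∫ ω in A k \ A (k + 1), Φ (k + 1) ω ∂μ
      + ∫ ω in A k, q k ω ∂μ ≤ ∫ ω in A k, Φ k ω ∂μ := by
  have hΦ := h.integrableOn hk.le
  have hΦ' := h.integrableOn_succ hk
  have hq := h.integrableOn_decrease k hk
  have hle : ∫ ω in A k, Φ (k + 1) ω ∂μ ≤ ∫ ω in A k, (Φ k ω - q k ω + M k ω) ∂μ :=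
    integral_mono_ae hΦ' (h.integrableOn_bound hk hΦ)
      ((ae_restrict_iff' (h.measurableSet k hk.le)).2 (h.step_le k hk))
  have hsum : ∫ ω in A k, (Φ k ω - q k ω + M k ω) ∂μ
      = ∫ ω in A k, Φ k ω ∂μ - ∫ ω in A k, q k ω ∂μ := by
    have hadd := integral_add (hΦ.sub hq) (h.integrableOn_noise k hk)
    simp only [Pi.sub_apply] at hadd
    rw [hadd, h.setIntegral_noise k hk, add_zero, integral_sub hΦ hq]
  have hsplit := setIntegral_sdiff (h.measurableSet (k + 1) hk) hΦ' (h.subset k hk)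
  linarith

theorem setIntegral_add_sum_le (h : IsDrift μ A Φ q M n) (hk : k ≤ n) :
    ∫ ω in A k, Φ k ω ∂μ + ∑ j ∈ Finset.range k, ∫ ω in A j \ A (j + 1), Φ (j + 1) ω ∂μ
      + ∑ j ∈ Finset.range k, ∫ ω in A j, q j ω ∂μ ≤ ∫ ω in A 0, Φ 0 ω ∂μ := by
  induction k with
  | zero => simp
  | succ k ih =>
    rw [Finset.sum_range_succ, Finset.sum_range_succ]
    linarith [ih (Nat.le_of_succ_le hk), h.setIntegral_succ_add_le hk]

end IsDrift

/-! ### Drift inequalities along a trajectory -/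

section Drift

variable {d : ℕ} {Ξ : Type*}

section Definitions

variable (U : Set (EuclideanSpace ℝ (Fin d))) (f : EuclideanSpace ℝ (Fin d) → ℝ)
  (F : EuclideanSpace ℝ (Fin d) → Ξ → ℝ) (x₁ : EuclideanSpace ℝ (Fin d)) (p : VRAdamInput)
  (ζ : Fin p.S₁ → Ξ) (ξ : ℕ → Ξ) (k : ℕ)

/-- The gradient `∇f(x)` of the objective at the iterate `x`, set to zero outside the domain. -/
noncomputable def iterGrad : EuclideanSpace ℝ (Fin d) :=
  U.indicator (gradient f) (domState U F x₁ p ζ ξ k).x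

/-- The error `m - ∇f(x)` of the gradient estimate `m`. -/
noncomputable def iterError : EuclideanSpace ℝ (Fin d) :=
  (domState U F x₁ p ζ ξ k).m - iterGrad U f F x₁ p ζ ξ k

/-- The displacement of the iterate. -/
noncomputable def iterStep : EuclideanSpace ℝ (Fin d) :=
  (domState U F x₁ p ζ ξ k).xNext - (domState U F x₁ p ζ ξ k).x

/-- The Lyapunov function of the analysis: the suboptimality gap, set to zero outside the domain,
plus `η / (λ β)` times the squared estimation error. -/
noncomputable def iterPotential : ℝ :=
  U.indicator (fun x => f x - sInf (f '' U)) (domState U F x₁ p ζ ξ k).x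
    + p.η / (p.lam * p.β) * ‖iterError U f F x₁ p ζ ξ k‖ ^ 2

/-- The noise of the new sample at the new iterate minus `b` times its noise at the old one. The
estimation error is driven by `b = 1 - β`, the correction by `b = 1`. -/
noncomputable def iterNoise (b : ℝ) : EuclideanSpace ℝ (Fin d) :=
  domNoise U f F (domState U F x₁ p ζ ξ k).xNext (ξ (k + 2))
    - b • domNoise U f F (domState U F x₁ p ζ ξ k).x (ξ (k + 2))

end Definitions

variable {U : Set (EuclideanSpace ℝ (Fin d))} {f : EuclideanSpace ℝ (Fin d) → ℝ}
  {F : EuclideanSpace ℝ (Fin d) → Ξ → ℝ} {x₁ : EuclideanSpace ℝ (Fin d)} {p : VRAdamInput}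
  {ζ : Fin p.S₁ → Ξ} {ξ : ℕ → Ξ} {L₀ Lρ ρ L σ G D : ℝ} {k : ℕ}

theorem iterGrad_of_mem (hx : (domState U F x₁ p ζ ξ k).x ∈ U) :
    iterGrad U f F x₁ p ζ ξ k = gradient f (domState U F x₁ p ζ ξ k).x :=
  Set.indicator_of_mem hx _

theorem iterPotential_of_mem (hx : (domState U F x₁ p ζ ξ k).x ∈ U) :
    iterPotential U f F x₁ p ζ ξ k
      = f (domState U F x₁ p ζ ξ k).x - sInf (f '' U) + p.η / (p.lam * p.β)
        * ‖(domState U F x₁ p ζ ξ k).m - gradient f (domState U F x₁ p ζ ξ k).x‖ ^ 2 := by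
  rw [iterPotential, iterError, iterGrad_of_mem hx, Set.indicator_of_mem hx]

theorem IsTuned.error_weight_nonneg (hp : IsTuned d L σ G D p) : 0 ≤ p.η / (p.lam * p.β) :=
  div_nonneg hp.η_pos.le (mul_nonneg hp.lam_pos.le hp.β_pos.le)

theorem iterPotential_nonneg (hP : IsTunedProblem U f F L₀ Lρ ρ L σ G D p) :
    0 ≤ iterPotential U f F x₁ p ζ ξ k :=
  add_nonneg (Set.indicator_nonneg (fun _ hx => hP.objective.gap_nonneg hx) _)
    (mul_nonneg hP.tuned.error_weight_nonneg (sq_nonneg _))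

theorem gap_le_iterPotential (hp : IsTuned d L σ G D p)
    (hx : (domState U F x₁ p ζ ξ k).x ∈ U) :
    f (domState U F x₁ p ζ ξ k).x - sInf (f '' U) ≤ iterPotential U f F x₁ p ζ ξ k := by
  rw [iterPotential_of_mem hx]
  exact le_add_of_nonneg_right (mul_nonneg hp.error_weight_nonneg (sq_nonneg _))

namespace IsRegularState

variable
  (hs : IsRegularState U f σ G D p k (domState U F x₁ p ζ ξ k) (domCorrection U f F x₁ p ζ ξ k))
include hs

theorem norm_iterGrad_le : ‖iterGrad U f F x₁ p ζ ξ k‖ ≤ G := by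
  rw [iterGrad_of_mem hs.mem]
  exact hs.gradient_le

theorem norm_iterError_le : ‖iterError U f F x₁ p ζ ξ k‖ ≤ p.lam * D := by
  rw [iterError, iterGrad_of_mem hs.mem]
  exact hs.error_le

theorem sq_norm_iterGrad_le (hP : IsTunedProblem U f F L₀ Lρ ρ L σ G D p) :
    p.η / (16 * G) * ‖iterGrad U f F x₁ p ζ ξ k‖ ^ 2 ≤ iterPotential U f F x₁ p ζ ξ k := by
  obtain ⟨h, hh⟩ := hs.exists_scaling
  rw [iterPotential_of_mem hs.mem, iterGrad_of_mem hs.mem]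
  exact hh.sq_norm_gradient_le_potential hP.tuned hP.objective hP.smooth hP.effSmooth hs.mem
    hs.gradient_le hs.error_le

theorem iterPotential_succ_le (hP : IsTunedProblem U f F L₀ Lρ ρ L σ G D p)
    (hn : IsNoiseBounded U f F x₁ σ p ζ ξ) (hk : k + 2 ≤ p.T) :
    iterPotential U f F x₁ p ζ ξ (k + 1) ≤ iterPotential U f F x₁ p ζ ξ k
      - (p.η / (16 * G) * ‖iterGrad U f F x₁ p ζ ξ k‖ ^ 2
        + p.lam / (16 * p.η) * ‖iterStep U F x₁ p ζ ξ k‖ ^ 2 - 2 * p.η * p.β * σ ^ 2 / p.lam)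
      + 2 * (p.η / (p.lam * p.β)) * (1 - p.β) * inner ℝ (iterError U f F x₁ p ζ ξ k)
          (iterNoise U f F x₁ p ζ ξ k (1 - p.β)) := by
  have hstep := hs.potential_step_le hP (hn.sample_prev k hk) (hn.sample k hk)
  have hnext : iterPotential U f F x₁ p ζ ξ (k + 1)
      = f (domState U F x₁ p ζ ξ k).xNext - sInf (f '' U) + p.η / (p.lam * p.β)
        * ‖(vrAdamStep p (domGrad U F) (k + 2) (domState U F x₁ p ζ ξ k) (ξ (k + 2))).m
          - gradient f (domState U F x₁ p ζ ξ k).xNext‖ ^ 2 :=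
    iterPotential_of_mem (k := k + 1) (hs.xNext_mem hP)
  rw [hnext, iterPotential_of_mem hs.mem, iterError, iterGrad_of_mem hs.mem, iterStep, iterNoise]
  linarith

theorem correction_succ_le (hP : IsTunedProblem U f F L₀ Lρ ρ L σ G D p)
    (hn : IsNoiseBounded U f F x₁ σ p ζ ξ) (hk : k + 2 ≤ p.T) :
    ‖domCorrection U f F x₁ p ζ ξ (k + 1)‖ ^ 6 ≤ ‖domCorrection U f F x₁ p ζ ξ k‖ ^ 6
      - (-(2 * 40 ^ 3 * (D ^ 2 * p.lam ^ 3 / (100 * G)) ^ 2 * (4 * L ^ 2)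
          * ‖iterStep U F x₁ p ζ ξ k‖ ^ 2))
      + 6 * (1 - p.β) ^ 6 * inner ℝ
        (‖domCorrection U f F x₁ p ζ ξ k‖ ^ 4 • domCorrection U f F x₁ p ζ ξ k)
        (iterNoise U f F x₁ p ζ ξ k 1) := by
  have hstep := hs.correction_step_le hP (hn.sample_prev k hk)
  have hnext : domCorrection U f F x₁ p ζ ξ (k + 1) = (1 - p.β) • (domCorrection U f F x₁ p ζ ξ k
      + (domNoise U f F (domState U F x₁ p ζ ξ k).xNext (ξ (k + 2))
        - domNoise U f F (domState U F x₁ p ζ ξ k).x (ξ (k + 2)))) := rfl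
  rw [hnext, iterNoise, one_smul, real_inner_smul_left, iterStep]
  linarith

theorem gap_or_correction_gt_of_not_isAlive (hP : IsTunedProblem U f F L₀ Lρ ρ L σ G D p)
    (ha : IsAlive U f F x₁ L G D p ζ ξ k) (hd : ¬ IsAlive U f F x₁ L G D p ζ ξ (k + 1)) :
    G ^ 2 / (6 * L) < f (domState U F x₁ p ζ ξ (k + 1)).x - sInf (f '' U) ∨
      p.lam * D / 2 < ‖domCorrection U f F x₁ p ζ ξ (k + 1)‖ := by
  by_contra! hle
  refine hd fun j hj => ?_
  rcases Nat.le_succ_iff.1 hj with hjk | rfl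
  · exact ha j hjk
  · exact ⟨hs.xNext_mem hP, hle⟩

theorem one_le_of_not_isAlive (hP : IsTunedProblem U f F L₀ Lρ ρ L σ G D p)
    (ha : IsAlive U f F x₁ L G D p ζ ξ k) (hd : ¬ IsAlive U f F x₁ L G D p ζ ξ (k + 1)) :
    1 ≤ 6 * L / G ^ 2 * iterPotential U f F x₁ p ζ ξ (k + 1)
      + (2 / (p.lam * D)) ^ 6 * ‖domCorrection U f F x₁ p ζ ξ (k + 1)‖ ^ 6 := by
  have hL := hP.tuned.L_pos
  have hG := hP.tuned.G_pos
  have hlam := hP.tuned.lam_pos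
  have hD : 0 < D := zero_lt_one.trans_le hP.tuned.one_le_D
  have hpotential := iterPotential_nonneg (x₁ := x₁) (ζ := ζ) (ξ := ξ) (k := k + 1) hP
  rcases hs.gap_or_correction_gt_of_not_isAlive hP ha hd with hgap | hcorrection
  · refine le_add_of_le_of_nonneg ?_ (by positivity)
    calc 1 = 6 * L / G ^ 2 * (G ^ 2 / (6 * L)) := by field_simp
      _ ≤ 6 * L / G ^ 2 * iterPotential U f F x₁ p ζ ξ (k + 1) := by
        gcongr
        exact hgap.le.trans (gap_le_iterPotential (k := k + 1) hP.tuned (hs.xNext_mem hP))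
  · refine le_add_of_nonneg_of_le (by positivity) ?_
    calc 1 = (2 / (p.lam * D)) ^ 6 * (p.lam * D / 2) ^ 6 := by field_simp
      _ ≤ (2 / (p.lam * D)) ^ 6 * ‖domCorrection U f F x₁ p ζ ξ (k + 1)‖ ^ 6 := by gcongr

end IsRegularState

end Drift

/-! ### The random trajectory -/

theorem integral_sq_norm_sum_le {Ω ι E : Type*} [MeasurableSpace Ω] {μ : Measure Ω}
    [IsProbabilityMeasure μ] [Fintype ι] [NormedAddCommGroup E] [InnerProductSpace ℝ E]
    {X : ι → Ω → E} {σ : ℝ} (hX : ∀ i, AEStronglyMeasurable (X i) μ)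
    (hσ : ∀ i, ∀ᵐ ω ∂μ, ‖X i ω‖ ≤ σ)
    (horth : Pairwise fun i j => ∫ ω, (inner ℝ (X i ω) (X j ω) : ℝ) ∂μ = 0) :
    ∫ ω, ‖∑ i, X i ω‖ ^ 2 ∂μ ≤ Fintype.card ι * σ ^ 2 := by
  have hint (i j : ι) : Integrable (fun ω => (inner ℝ (X i ω) (X j ω) : ℝ)) μ := by
    refine Integrable.of_bound ((hX i).inner (hX j)) (σ * σ) ?_
    filter_upwards [hσ i, hσ j] with ω hi hj
    exact (norm_inner_le_norm _ _).trans
      (mul_le_mul hi hj (norm_nonneg _) ((norm_nonneg _).trans hi))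
  have hdiag (i : ι) : ∫ ω, (inner ℝ (X i ω) (X i ω) : ℝ) ∂μ ≤ σ ^ 2 := by
    refine (integral_mono_ae (hint i i) (integrable_const (σ ^ 2)) ?_).trans_eq (by simp)
    filter_upwards [hσ i] with ω hi
    rw [real_inner_self_eq_norm_sq]
    gcongr
  calc ∫ ω, ‖∑ i, X i ω‖ ^ 2 ∂μ
      = ∑ i, ∑ j, ∫ ω, (inner ℝ (X i ω) (X j ω) : ℝ) ∂μ := by
        simp only [← real_inner_self_eq_norm_sq, sum_inner, inner_sum]
        rw [integral_finsetSum _ fun i _ => integrable_finsetSum _ fun j _ => hint j i,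
          Finset.sum_comm]
        simp only [integral_finsetSum _ fun j _ => hint j _]
    _ = ∑ i, ∫ ω, (inner ℝ (X i ω) (X i ω) : ℝ) ∂μ :=
        Finset.sum_congr rfl fun i _ =>
          Finset.sum_eq_single i (fun j _ hj => horth hj.symm) (by simp)
    _ ≤ ∑ _i : ι, σ ^ 2 := Finset.sum_le_sum fun i _ => hdiag i
    _ = Fintype.card ι * σ ^ 2 := by simp

section Random

variable {d : ℕ} {Ξ Ω : Type*} {U : Set (EuclideanSpace ℝ (Fin d))}
  {f : EuclideanSpace ℝ (Fin d) → ℝ} {F : EuclideanSpace ℝ (Fin d) → Ξ → ℝ}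
  {x₁ : EuclideanSpace ℝ (Fin d)} {p : VRAdamInput} {L₀ Lρ ρ L σ G D : ℝ}

theorem domState_zero_m_sub_gradient (hx₁ : x₁ ∈ U) (hS : 1 ≤ p.S₁) (ζ : Fin p.S₁ → Ξ)
    (ξ : ℕ → Ξ) :
    (domState U F x₁ p ζ ξ 0).m - gradient f x₁
      = (1 / (p.S₁ : ℝ)) • ∑ i, domNoise U f F x₁ (ζ i) := by
  have hS0 : (p.S₁ : ℝ) ≠ 0 := Nat.cast_ne_zero.2 (by omega)
  simp only [domState, vrAdamState, vrAdamInit, domGrad_eq (f := f) hx₁, Finset.sum_add_distrib,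
    Finset.sum_const, Finset.card_univ, Fintype.card_fin, smul_add]
  rw [← Nat.cast_smul_eq_nsmul ℝ, smul_smul, one_div_mul_cancel hS0, one_smul,
    add_sub_cancel_right]

variable [MeasurableSpace Ξ] [MeasurableSpace Ω]

/-- A run of VRAdam on random samples: the objective and the parameters satisfy the standing
assumptions, the samples are i.i.d. with bounded unbiased noise, and the run starts at a point `x₁`
of the domain at which the gradient is at most `G`. -/
structure IsTunedRun (μ : Measure Ω) (P : Measure Ξ) (U : Set (EuclideanSpace ℝ (Fin d)))
    (f : EuclideanSpace ℝ (Fin d) → ℝ) (F : EuclideanSpace ℝ (Fin d) → Ξ → ℝ)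
    (x₁ : EuclideanSpace ℝ (Fin d)) (L₀ Lρ ρ L σ G D : ℝ) (p : VRAdamInput)
    (ζ : Fin p.S₁ → Ω → Ξ) (ξ : ℕ → Ω → Ξ) : Prop where
  problem : IsTunedProblem U f F L₀ Lρ ρ L σ G D p
  noise : IsBoundedNoise U f F P σ
  sampling : IsIIDSampling μ P p.S₁ p.T ζ ξ
  mem : x₁ ∈ U
  gradient_le : ‖gradient f x₁‖ ≤ G
  batch_pos : 1 ≤ p.S₁

namespace IsTunedRun

variable {μ : Measure Ω} {P : Measure Ξ} {ζ : Fin p.S₁ → Ω → Ξ} {ξ : ℕ → Ω → Ξ} {k : ℕ}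
  (h : IsTunedRun μ P U f F x₁ L₀ Lρ ρ L σ G D p ζ ξ)
include h

theorem isMeasurableState (hk : k + 1 ≤ p.T) :
    IsMeasurableState (pastSigma p.T ζ ξ k)
      fun ω => domState U F x₁ p (fun i => ζ i ω) (fun j => ξ j ω) k :=
  isMeasurableState_vrAdamState
    (measurable_domGrad h.problem.objective.isOpen h.problem.smooth_component h.noise)
    (measurable_batch_pastSigma k) fun _ hj => measurable_sample_pastSigma hk hj

theorem measurable_iterGrad (hk : k + 1 ≤ p.T) : Measurable[pastSigma p.T ζ ξ k]
    fun ω => iterGrad U f F x₁ p (fun i => ζ i ω) (fun j => ξ j ω) k :=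
  (measurable_indicator_of_continuousOn h.problem.smooth.differentiableOn_gradient.continuousOn
    h.problem.objective.isOpen.measurableSet).comp (h.isMeasurableState hk).x

theorem measurable_iterError (hk : k + 1 ≤ p.T) : Measurable[pastSigma p.T ζ ξ k]
    fun ω => iterError U f F x₁ p (fun i => ζ i ω) (fun j => ξ j ω) k :=
  (h.isMeasurableState hk).m.sub (h.measurable_iterGrad hk)

theorem measurable_iterStep (hk : k + 1 ≤ p.T) : Measurable[pastSigma p.T ζ ξ k]
    fun ω => iterStep U F x₁ p (fun i => ζ i ω) (fun j => ξ j ω) k :=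
  (h.isMeasurableState hk).xNext.sub (h.isMeasurableState hk).x

theorem measurable_iterPotential (hk : k + 1 ≤ p.T) : Measurable[pastSigma p.T ζ ξ k]
    fun ω => iterPotential U f F x₁ p (fun i => ζ i ω) (fun j => ξ j ω) k :=
  have hO := h.problem.objective
  ((measurable_indicator_of_continuousOn
    (hO.differentiableOn.continuousOn.sub continuousOn_const) hO.isOpen.measurableSet).comp
      (h.isMeasurableState hk).x).add
        (((measurable_norm.comp (h.measurable_iterError hk)).pow_const 2).const_mul _)

theorem measurable_correction (hk : k + 1 ≤ p.T) : Measurable[pastSigma p.T ζ ξ k]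
    fun ω => domCorrection U f F x₁ p (fun i => ζ i ω) (fun j => ξ j ω) k :=
  measurable_domCorrection
    h.problem.objective.isOpen h.problem.smooth h.problem.smooth_component h.noise
    (measurable_batch_pastSigma k) fun _ hj => measurable_sample_pastSigma hk hj

theorem measurable_sample (hk : k + 2 ≤ p.T) : Measurable (ξ (k + 2)) :=
  h.sampling.measurable_sample (k + 2) (Finset.mem_Icc.2 ⟨by omega, hk⟩)

theorem law_sample (hk : k + 2 ≤ p.T) : μ.map (ξ (k + 2)) = P :=
  h.sampling.law_sample (k + 2) (Finset.mem_Icc.2 ⟨by omega, hk⟩)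

theorem measurable_noise :
    Measurable fun z : EuclideanSpace ℝ (Fin d) × Ξ => domNoise U f F z.1 z.2 :=
  measurable_domNoise h.problem.objective.isOpen h.problem.smooth h.problem.smooth_component
    h.noise

theorem measurable_iterNoise (hk : k + 2 ≤ p.T) (b : ℝ) :
    Measurable fun ω => iterNoise U f F x₁ p (fun i => ζ i ω) (fun j => ξ j ω) k b := by
  have hstate := h.isMeasurableState (k := k) (by omega)
  have hx := hstate.x.mono (h.sampling.pastSigma_le k) le_rfl
  have hxNext := hstate.xNext.mono (h.sampling.pastSigma_le k) le_rfl
  have hξ := h.measurable_sample hk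
  exact (h.measurable_noise.comp (hxNext.prodMk hξ)).sub
    ((h.measurable_noise.comp (hx.prodMk hξ)).const_smul b)

theorem ae_norm_batch_noise_le (i : Fin p.S₁) :
    ∀ᵐ ω ∂μ, ‖domNoise U f F x₁ (ζ i ω)‖ ≤ σ :=
  ae_of_ae_map (h.sampling.measurable_batch i).aemeasurable <|
    (h.sampling.law_batch i).symm ▸ h.noise.ae_norm_domNoise_le h.problem.tuned.σ_nonneg x₁

theorem norm_initial_error_le {ω : Ω} (hω : ∀ i, ‖domNoise U f F x₁ (ζ i ω)‖ ≤ σ) :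
    ‖(domState U F x₁ p (fun i => ζ i ω) (fun j => ξ j ω) 0).m - gradient f x₁‖ ≤ σ := by
  have hS : (0 : ℝ) < p.S₁ := by exact_mod_cast h.batch_pos
  rw [domState_zero_m_sub_gradient h.mem h.batch_pos, norm_smul,
    Real.norm_of_nonneg (by positivity), one_div, inv_mul_le_iff₀ hS]
  simpa using norm_sum_le_of_le Finset.univ fun i _ => hω i

variable [IsProbabilityMeasure μ]

theorem ae_norm_noise_le (hk : k + 2 ≤ p.T) {z : Ω → EuclideanSpace ℝ (Fin d)}
    (hz : Measurable[pastSigma p.T ζ ξ k] z) :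
    ∀ᵐ ω ∂μ, ‖domNoise U f F (z ω) (ξ (k + 2) ω)‖ ≤ σ := by
  have : IsProbabilityMeasure P := h.law_sample hk ▸
    Measure.isProbabilityMeasure_map (h.measurable_sample hk).aemeasurable
  exact ae_of_indepFun (q := fun z => ‖domNoise U f F z.1 z.2‖ ≤ σ)
    (h.sampling.indepFun_of_measurable_past hk hz)
    (hz.mono (h.sampling.pastSigma_le k) le_rfl) (h.measurable_sample hk) (h.law_sample hk)
    (measurableSet_le h.measurable_noise.norm measurable_const)
    (h.noise.ae_norm_domNoise_le h.problem.tuned.σ_nonneg)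

theorem ae_isNoiseBounded :
    ∀ᵐ ω ∂μ, IsNoiseBounded U f F x₁ σ p (fun i => ζ i ω) (fun j => ξ j ω) := by
  have hsample (k : ℕ) : ∀ᵐ ω ∂μ, k + 2 ≤ p.T →
      ‖domNoise U f F (domState U F x₁ p (fun i => ζ i ω) (fun j => ξ j ω) (k + 1)).x
        (ξ (k + 2) ω)‖ ≤ σ ∧
      ‖domNoise U f F (domState U F x₁ p (fun i => ζ i ω) (fun j => ξ j ω) k).x
        (ξ (k + 2) ω)‖ ≤ σ := by
    by_cases hk : k + 2 ≤ p.T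
    · have hstate := h.isMeasurableState (k := k) (by omega)
      filter_upwards [h.ae_norm_noise_le hk hstate.xNext, h.ae_norm_noise_le hk hstate.x]
        with ω hnext hprev _ using ⟨hnext, hprev⟩
    · exact .of_forall fun ω hk' => absurd hk' hk
  filter_upwards [ae_all_iff.2 h.ae_norm_batch_noise_le, ae_all_iff.2 hsample]
    with ω hbatch hsample
  exact ⟨h.norm_initial_error_le hbatch, fun k hk => (hsample k hk).1,
    fun k hk => (hsample k hk).2⟩

theorem integrableOn_inner_iterNoise (hk : k + 2 ≤ p.T) {A : Set Ω} (hA : MeasurableSet A)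
    {y : Ω → EuclideanSpace ℝ (Fin d)} (hy : Measurable y) {K : ℝ}
    (hyK : ∀ᵐ ω ∂μ, ω ∈ A → ‖y ω‖ ≤ K) (b : ℝ) :
    IntegrableOn (fun ω => (inner ℝ (y ω)
      (iterNoise U f F x₁ p (fun i => ζ i ω) (fun j => ξ j ω) k b) : ℝ)) A μ := by
  refine Integrable.of_bound (hy.inner (h.measurable_iterNoise hk b)).aestronglyMeasurable
    (K * (σ + |b| * σ)) ((ae_restrict_iff' hA).2 ?_)
  filter_upwards [hyK, h.ae_isNoiseBounded] with ω hyω hn hω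
  have hnoise : ‖iterNoise U f F x₁ p (fun i => ζ i ω) (fun j => ξ j ω) k b‖ ≤ σ + |b| * σ := by
    refine (norm_sub_le _ _).trans (add_le_add (hn.sample k hk) ?_)
    rw [norm_smul, Real.norm_eq_abs]
    gcongr
    exact hn.sample_prev k hk
  exact (norm_inner_le_norm _ _).trans
    (mul_le_mul (hyω hω) hnoise (norm_nonneg _) ((norm_nonneg _).trans (hyω hω)))

variable [IsProbabilityMeasure P]

theorem setIntegral_inner_iterNoise (hk : k + 2 ≤ p.T) {A : Set Ω}
    (hA : MeasurableSet[pastSigma p.T ζ ξ k] A) {y : Ω → EuclideanSpace ℝ (Fin d)}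
    (hy : Measurable[pastSigma p.T ζ ξ k] y) (b : ℝ) :
    ∫ ω in A, (inner ℝ (y ω)
      (iterNoise U f F x₁ p (fun i => ζ i ω) (fun j => ξ j ω) k b) : ℝ) ∂μ = 0 := by
  have hstate := h.isMeasurableState (k := k) (by omega)
  have hpast : Measurable[pastSigma p.T ζ ξ k] fun ω =>
      (A.indicator y ω, (domState U F x₁ p (fun i => ζ i ω) (fun j => ξ j ω) k).xNext,
        (domState U F x₁ p (fun i => ζ i ω) (fun j => ξ j ω) k).x) :=
    (Measurable.indicator (m := pastSigma p.T ζ ξ k) hy hA).prodMk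
      (hstate.xNext.prodMk hstate.x)
  let φ (z : (EuclideanSpace ℝ (Fin d) × EuclideanSpace ℝ (Fin d) × EuclideanSpace ℝ (Fin d))
      × Ξ) : ℝ := inner ℝ z.1.1 (domNoise U f F z.1.2.1 z.2 - b • domNoise U f F z.1.2.2 z.2)
  have hφ : Measurable φ :=
    (measurable_fst.comp measurable_fst).inner
      ((h.measurable_noise.comp
          ((measurable_fst.comp (measurable_snd.comp measurable_fst)).prodMk measurable_snd)).sub
        ((h.measurable_noise.comp
          ((measurable_snd.comp (measurable_snd.comp measurable_fst)).prodMk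
            measurable_snd)).const_smul b))
  have hmean := integral_eq_zero_of_indepFun (h.sampling.indepFun_of_measurable_past hk hpast)
    (hpast.mono (h.sampling.pastSigma_le k) le_rfl) (h.measurable_sample hk) (h.law_sample hk)
    hφ.stronglyMeasurable
    fun z => h.noise.integral_inner_eq_zero h.problem.tuned.σ_nonneg z.1 z.2.2 z.2.1 b
  rw [← integral_indicator (h.sampling.pastSigma_le k _ hA), ← hmean]
  refine integral_congr_ae (.of_forall fun ω => ?_)
  by_cases hω : ω ∈ A <;> simp [φ, hω, iterNoise]

theorem integral_inner_batch_noise {i j : Fin p.S₁} (hij : i ≠ j) :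
    ∫ ω, (inner ℝ (domNoise U f F x₁ (ζ i ω)) (domNoise U f F x₁ (ζ j ω)) : ℝ) ∂μ = 0 := by
  have hnoise := h.noise.measurable_domNoise_apply x₁
  have hindep : IndepFun (ζ i) (ζ j) μ :=
    h.sampling.indep.indepFun (i := Sum.inl i) (j := Sum.inl j) (by simpa using hij)
  refine integral_eq_zero_of_indepFun hindep (h.sampling.measurable_batch i)
    (h.sampling.measurable_batch j) (h.sampling.law_batch j)
    (φ := fun z => (inner ℝ (domNoise U f F x₁ z.1) (domNoise U f F x₁ z.2) : ℝ))
    ((hnoise.comp measurable_fst).inner (hnoise.comp measurable_snd)).stronglyMeasurable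
    fun z => ?_
  simpa using h.noise.integral_inner_eq_zero h.problem.tuned.σ_nonneg (domNoise U f F x₁ z) x₁ x₁ 0

theorem integral_sq_norm_iterError_zero_le :
    ∫ ω, ‖iterError U f F x₁ p (fun i => ζ i ω) (fun j => ξ j ω) 0‖ ^ 2 ∂μ ≤ σ ^ 2 / p.S₁ := by
  have hS : (0 : ℝ) < p.S₁ := by exact_mod_cast h.batch_pos
  have herror (ω : Ω) : iterError U f F x₁ p (fun i => ζ i ω) (fun j => ξ j ω) 0
      = (1 / (p.S₁ : ℝ)) • ∑ i, domNoise U f F x₁ (ζ i ω) := by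
    rw [iterError, iterGrad_of_mem (k := 0) h.mem]
    exact domState_zero_m_sub_gradient h.mem h.batch_pos _ _
  have hvariance := integral_sq_norm_sum_le (μ := μ) (X := fun i ω => domNoise U f F x₁ (ζ i ω))
    (fun i => ((h.noise.measurable_domNoise_apply x₁).comp
      (h.sampling.measurable_batch i)).aestronglyMeasurable)
    h.ae_norm_batch_noise_le fun i j hij => h.integral_inner_batch_noise hij
  calc ∫ ω, ‖iterError U f F x₁ p (fun i => ζ i ω) (fun j => ξ j ω) 0‖ ^ 2 ∂μ
      = (1 / (p.S₁ : ℝ)) ^ 2 * ∫ ω, ‖∑ i, domNoise U f F x₁ (ζ i ω)‖ ^ 2 ∂μ := by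
        simp only [herror, norm_smul, mul_pow, Real.norm_of_nonneg (one_div_nonneg.2 hS.le),
          integral_const_mul]
    _ ≤ (1 / (p.S₁ : ℝ)) ^ 2 * (p.S₁ * σ ^ 2) := by
        gcongr
        simpa using hvariance
    _ = σ ^ 2 / p.S₁ := by field_simp

end IsTunedRun

end Random

/-! ### The probability of leaving the good region -/

theorem measureReal_compl_eq_sum_sdiff {Ω : Type*} [MeasurableSpace Ω] {μ : Measure Ω}
    [IsProbabilityMeasure μ] {A : ℕ → Set Ω} {n : ℕ} (hA : ∀ k ≤ n, MeasurableSet (A k))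
    (hanti : ∀ k < n, A (k + 1) ⊆ A k) (hzero : A 0 = Set.univ) :
    μ.real (A n)ᶜ = ∑ k ∈ Finset.range n, μ.real (A k \ A (k + 1)) := by
  induction n with
  | zero => simp [hzero]
  | succ n ih =>
    rw [Finset.sum_range_succ, ← ih (fun k hk => hA k (by omega)) fun k hk => hanti k (by omega),
      probReal_compl_eq_one_sub (hA _ le_rfl), probReal_compl_eq_one_sub (hA n n.le_succ),
      measureReal_sdiff (hanti n n.lt_succ_self) (hA _ le_rfl)]
    ring

section Summation

variable {d : ℕ} {Ξ Ω : Type*}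

section Definitions

variable [MeasurableSpace Ω] (μ : Measure Ω) (U : Set (EuclideanSpace ℝ (Fin d)))
  (f : EuclideanSpace ℝ (Fin d) → ℝ) (F : EuclideanSpace ℝ (Fin d) → Ξ → ℝ)
  (x₁ : EuclideanSpace ℝ (Fin d)) (L G D : ℝ) (p : VRAdamInput) (ζ : Fin p.S₁ → Ω → Ξ)
  (ξ : ℕ → Ω → Ξ) (k : ℕ)

/-- The event that the trajectory is alive after `k` steps. -/
def aliveSet : Set Ω :=
  {ω | IsAlive U f F x₁ L G D p (fun i => ζ i ω) (fun j => ξ j ω) k}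

/-- The expected squared gradient at the `k`-th state, restricted to the trajectories still alive
there. -/
noncomputable def gradEnergy : ℝ :=
  ∫ ω in aliveSet U f F x₁ L G D p ζ ξ k,
    ‖iterGrad U f F x₁ p (fun i => ζ i ω) (fun j => ξ j ω) k‖ ^ 2 ∂μ

/-- The expected squared length of the `k`-th step, restricted to the trajectories still alive
there. -/
noncomputable def stepEnergy : ℝ :=
  ∫ ω in aliveSet U f F x₁ L G D p ζ ξ k,
    ‖iterStep U F x₁ p (fun i => ζ i ω) (fun j => ξ j ω) k‖ ^ 2 ∂μ

/-- The expected potential carried away by the trajectories that die in the `k`-th step. -/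
noncomputable def exitPotential : ℝ :=
  ∫ ω in aliveSet U f F x₁ L G D p ζ ξ k \ aliveSet U f F x₁ L G D p ζ ξ (k + 1),
    iterPotential U f F x₁ p (fun i => ζ i ω) (fun j => ξ j ω) (k + 1) ∂μ

/-- The expected sixth power of the correction of the trajectories that die in the `k`-th step. -/
noncomputable def exitCorrection : ℝ :=
  ∫ ω in aliveSet U f F x₁ L G D p ζ ξ k \ aliveSet U f F x₁ L G D p ζ ξ (k + 1),
    ‖domCorrection U f F x₁ p (fun i => ζ i ω) (fun j => ξ j ω) (k + 1)‖ ^ 6 ∂μ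

end Definitions

variable {U : Set (EuclideanSpace ℝ (Fin d))} {f : EuclideanSpace ℝ (Fin d) → ℝ}
  {F : EuclideanSpace ℝ (Fin d) → Ξ → ℝ} {x₁ : EuclideanSpace ℝ (Fin d)} {p : VRAdamInput}
  {L₀ Lρ ρ L σ G D : ℝ} {ζ : Fin p.S₁ → Ω → Ξ} {ξ : ℕ → Ω → Ξ} {k : ℕ}

theorem aliveSet_anti : Antitone (aliveSet U f F x₁ L G D p ζ ξ) :=
  fun _ _ hkl _ ha => ha.mono hkl

variable [MeasurableSpace Ξ] [MeasurableSpace Ω]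

namespace IsTunedRun

variable {μ : Measure Ω} {P : Measure Ξ} (h : IsTunedRun μ P U f F x₁ L₀ Lρ ρ L σ G D p ζ ξ)
include h

theorem aliveSet_zero (hgap : f x₁ - sInf (f '' U) ≤ G ^ 2 / (6 * L)) :
    aliveSet U f F x₁ L G D p ζ ξ 0 = Set.univ := by
  refine Set.eq_univ_of_forall fun ω j hj => ?_
  obtain rfl : j = 0 := by omega
  have hlam := h.problem.tuned.lam_pos
  have hD : 0 < D := zero_lt_one.trans_le h.problem.tuned.one_le_D
  refine ⟨h.mem, hgap, ?_⟩
  rw [domCorrection, norm_zero]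
  positivity

theorem measurableSet_aliveSet_pastSigma (hk : k + 1 ≤ p.T) :
    MeasurableSet[pastSigma p.T ζ ξ k] (aliveSet U f F x₁ L G D p ζ ξ k) :=
  measurableSet_isAlive h.problem.objective h.problem.smooth h.problem.smooth_component h.noise
    (measurable_batch_pastSigma k) fun _ hj => measurable_sample_pastSigma hk hj

theorem measurableSet_aliveSet (hk : k + 1 ≤ p.T) :
    MeasurableSet (aliveSet U f F x₁ L G D p ζ ξ k) :=
  h.sampling.pastSigma_le k _ (h.measurableSet_aliveSet_pastSigma hk)

theorem iterPotential_zero (ω : Ω) :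
    iterPotential U f F x₁ p (fun i => ζ i ω) (fun j => ξ j ω) 0
      = f x₁ - sInf (f '' U) + p.η / (p.lam * p.β)
        * ‖iterError U f F x₁ p (fun i => ζ i ω) (fun j => ξ j ω) 0‖ ^ 2 :=
  congrArg (· + _) (Set.indicator_of_mem h.mem _)

variable [IsProbabilityMeasure μ]

theorem ae_isRegularState (hk : k + 1 ≤ p.T) :
    ∀ᵐ ω ∂μ, ω ∈ aliveSet U f F x₁ L G D p ζ ξ k →
      IsRegularState U f σ G D p k (domState U F x₁ p (fun i => ζ i ω) (fun j => ξ j ω) k)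
        (domCorrection U f F x₁ p (fun i => ζ i ω) (fun j => ξ j ω) k) := by
  filter_upwards [h.ae_isNoiseBounded] with ω hω ha
  exact IsAlive.isRegularState h.problem h.gradient_le hω hk ha

theorem integrableOn_sq_norm_iterGrad (hk : k + 1 ≤ p.T) :
    IntegrableOn (fun ω => ‖iterGrad U f F x₁ p (fun i => ζ i ω) (fun j => ξ j ω) k‖ ^ 2)
      (aliveSet U f F x₁ L G D p ζ ξ k) μ := by
  have hmeas := (h.measurable_iterGrad hk).mono (h.sampling.pastSigma_le k) le_rfl
  refine Integrable.of_bound (hmeas.norm.pow_const 2).aestronglyMeasurable (G ^ 2)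
    ((ae_restrict_iff' (h.measurableSet_aliveSet hk)).2 ?_)
  filter_upwards [h.ae_isRegularState hk] with ω hreg hω
  rw [Real.norm_of_nonneg (by positivity)]
  exact pow_le_pow_left₀ (norm_nonneg _) (hreg hω).norm_iterGrad_le 2

theorem integrableOn_sq_norm_iterStep (hk : k + 1 ≤ p.T) :
    IntegrableOn (fun ω => ‖iterStep U F x₁ p (fun i => ζ i ω) (fun j => ξ j ω) k‖ ^ 2)
      (aliveSet U f F x₁ L G D p ζ ξ k) μ := by
  have hmeas := (h.measurable_iterStep hk).mono (h.sampling.pastSigma_le k) le_rfl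
  refine Integrable.of_bound (hmeas.norm.pow_const 2).aestronglyMeasurable ((2 * p.η * D) ^ 2)
    ((ae_restrict_iff' (h.measurableSet_aliveSet hk)).2 ?_)
  filter_upwards [h.ae_isRegularState hk] with ω hreg hω
  rw [Real.norm_of_nonneg (by positivity)]
  exact pow_le_pow_left₀ (norm_nonneg _) ((hreg hω).norm_step_le h.problem) 2

theorem ae_norm_iterError_zero_le :
    ∀ᵐ ω ∂μ, ‖iterError U f F x₁ p (fun i => ζ i ω) (fun j => ξ j ω) 0‖ ≤ σ := by
  filter_upwards [h.ae_isNoiseBounded] with ω hω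
  rw [iterError, iterGrad_of_mem (k := 0) h.mem]
  exact hω.batch

theorem integrable_sq_norm_iterError_zero (hT : 1 ≤ p.T) :
    Integrable (fun ω => ‖iterError U f F x₁ p (fun i => ζ i ω) (fun j => ξ j ω) 0‖ ^ 2) μ := by
  have hmeas := (h.measurable_iterError (k := 0) hT).mono (h.sampling.pastSigma_le 0) le_rfl
  refine Integrable.of_bound (hmeas.norm.pow_const 2).aestronglyMeasurable (σ ^ 2) ?_
  filter_upwards [h.ae_norm_iterError_zero_le] with ω hω
  rw [Real.norm_of_nonneg (by positivity)]
  exact pow_le_pow_left₀ (norm_nonneg _) hω 2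

theorem integrable_iterPotential_zero (hT : 1 ≤ p.T) :
    Integrable (fun ω => iterPotential U f F x₁ p (fun i => ζ i ω) (fun j => ξ j ω) 0) μ := by
  simp only [h.iterPotential_zero]
  exact (integrable_const _).add ((h.integrable_sq_norm_iterError_zero hT).const_mul _)

theorem integrableOn_decrease (hk : k + 1 ≤ p.T) (a b c : ℝ) : IntegrableOn (fun ω =>
      a * ‖iterGrad U f F x₁ p (fun i => ζ i ω) (fun j => ξ j ω) k‖ ^ 2
        + b * ‖iterStep U F x₁ p (fun i => ζ i ω) (fun j => ξ j ω) k‖ ^ 2 - c)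
    (aliveSet U f F x₁ L G D p ζ ξ k) μ :=
  (((h.integrableOn_sq_norm_iterGrad hk).const_mul a).fun_add
    ((h.integrableOn_sq_norm_iterStep hk).const_mul b)).sub (integrable_const c)

theorem le_setIntegral_decrease (hk : k + 1 ≤ p.T) (a b : ℝ) {c : ℝ} (hc : 0 ≤ c) :
    a * gradEnergy μ U f F x₁ L G D p ζ ξ k + b * stepEnergy μ U f F x₁ L G D p ζ ξ k - c
      ≤ ∫ ω in aliveSet U f F x₁ L G D p ζ ξ k,
        (a * ‖iterGrad U f F x₁ p (fun i => ζ i ω) (fun j => ξ j ω) k‖ ^ 2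
          + b * ‖iterStep U F x₁ p (fun i => ζ i ω) (fun j => ξ j ω) k‖ ^ 2 - c) ∂μ := by
  have hgrad := (h.integrableOn_sq_norm_iterGrad hk).const_mul a
  have hstep := (h.integrableOn_sq_norm_iterStep hk).const_mul b
  rw [integral_sub (hgrad.fun_add hstep) (integrable_const c), integral_add hgrad hstep,
    integral_const_mul, integral_const_mul, setIntegral_const, smul_eq_mul]
  exact sub_le_sub_left (mul_le_of_le_one_left hc measureReal_le_one) _

variable {n : ℕ}

theorem mul_measureReal_sum_ge_le_sum_gradEnergy (hn : n + 1 ≤ p.T) (M : ℝ) :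
    M * μ.real (aliveSet U f F x₁ L G D p ζ ξ n ∩ {ω | M ≤ ∑ k ∈ Finset.range (n + 1),
        ‖iterGrad U f F x₁ p (fun i => ζ i ω) (fun j => ξ j ω) k‖ ^ 2})
      ≤ ∑ k ∈ Finset.range (n + 1), gradEnergy μ U f F x₁ L G D p ζ ξ k := by
  have hsubset {k : ℕ} (hk : k ∈ Finset.range (n + 1)) :
      aliveSet U f F x₁ L G D p ζ ξ n ⊆ aliveSet U f F x₁ L G D p ζ ξ k :=
    aliveSet_anti (Nat.le_of_lt_succ (Finset.mem_range.1 hk))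
  have hint (k : ℕ) (hk : k ∈ Finset.range (n + 1)) :=
    h.integrableOn_sq_norm_iterGrad (k := k) (by have := Finset.mem_range.1 hk; omega)
  have hint' (k : ℕ) (hk : k ∈ Finset.range (n + 1)) := (hint k hk).mono_set (hsubset hk)
  have hmarkov := mul_meas_ge_le_integral_of_nonneg
    (.of_forall fun _ => Finset.sum_nonneg fun _ _ => by positivity)
    (integrable_finsetSum _ hint') M
  rw [measureReal_restrict_apply' (h.measurableSet_aliveSet hn), integral_finsetSum _ hint',
    Set.inter_comm] at hmarkov
  exact hmarkov.trans (Finset.sum_le_sum fun k hk => setIntegral_mono_set (hint k hk)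
    (.of_forall fun _ => by positivity) (hsubset hk).eventuallyLE)

variable [IsProbabilityMeasure P]

theorem isDrift_iterPotential (hn : n + 1 ≤ p.T) :
    IsDrift μ (aliveSet U f F x₁ L G D p ζ ξ)
      (fun k ω => iterPotential U f F x₁ p (fun i => ζ i ω) (fun j => ξ j ω) k)
      (fun k ω => p.η / (16 * G) * ‖iterGrad U f F x₁ p (fun i => ζ i ω) (fun j => ξ j ω) k‖ ^ 2
        + p.lam / (16 * p.η) * ‖iterStep U F x₁ p (fun i => ζ i ω) (fun j => ξ j ω) k‖ ^ 2
        - 2 * p.η * p.β * σ ^ 2 / p.lam)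
      (fun k ω => 2 * (p.η / (p.lam * p.β)) * (1 - p.β)
        * inner ℝ (iterError U f F x₁ p (fun i => ζ i ω) (fun j => ξ j ω) k)
          (iterNoise U f F x₁ p (fun i => ζ i ω) (fun j => ξ j ω) k (1 - p.β))) n where
  measurableSet k _ := h.measurableSet_aliveSet (by omega)
  subset k _ := aliveSet_anti k.le_succ
  aestronglyMeasurable k _ := ((h.measurable_iterPotential (by omega)).mono
    (h.sampling.pastSigma_le k) le_rfl).aestronglyMeasurable
  integrableOn_zero := (h.integrable_iterPotential_zero (by omega)).integrableOn
  nonneg k _ := .of_forall fun _ _ => iterPotential_nonneg h.problem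
  integrableOn_decrease k _ := h.integrableOn_decrease (by omega) _ _ _
  integrableOn_noise k _ := by
    have hmeas := (h.measurable_iterError (k := k) (by omega)).mono (h.sampling.pastSigma_le k)
      le_rfl
    refine Integrable.const_mul (h.integrableOn_inner_iterNoise (K := p.lam * D) (by omega)
      (h.measurableSet_aliveSet (by omega)) hmeas ?_ _) _
    filter_upwards [h.ae_isRegularState (k := k) (by omega)] with ω hreg hω
    exact (hreg hω).norm_iterError_le
  setIntegral_noise k _ := by
    rw [integral_const_mul, h.setIntegral_inner_iterNoise (by omega)
      (h.measurableSet_aliveSet_pastSigma (by omega)) (h.measurable_iterError (by omega)), mul_zero]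
  step_le k _ := by
    filter_upwards [h.ae_isNoiseBounded, h.ae_isRegularState (k := k) (by omega)]
      with ω hnoise hreg hω
    exact (hreg hω).iterPotential_succ_le h.problem hnoise (by omega)

theorem setIntegral_iterPotential_zero_le (hT : 1 ≤ p.T) :
    ∫ ω in aliveSet U f F x₁ L G D p ζ ξ 0,
        iterPotential U f F x₁ p (fun i => ζ i ω) (fun j => ξ j ω) 0 ∂μ
      ≤ f x₁ - sInf (f '' U) + p.η / (p.lam * p.β) * (σ ^ 2 / p.S₁) := by
  have herror := h.integrable_sq_norm_iterError_zero hT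
  have hmean : ∫ ω, iterPotential U f F x₁ p (fun i => ζ i ω) (fun j => ξ j ω) 0 ∂μ
      = f x₁ - sInf (f '' U) + p.η / (p.lam * p.β)
        * ∫ ω, ‖iterError U f F x₁ p (fun i => ζ i ω) (fun j => ξ j ω) 0‖ ^ 2 ∂μ := by
    simp only [h.iterPotential_zero]
    rw [integral_add (integrable_const _) (herror.const_mul _), integral_const_mul,
      integral_const, probReal_univ, one_smul]
  refine (setIntegral_le_integral (h.integrable_iterPotential_zero hT)
    (.of_forall fun _ => iterPotential_nonneg h.problem)).trans (hmean.trans_le ?_)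
  have := h.problem.tuned.error_weight_nonneg
  gcongr
  exact h.integral_sq_norm_iterError_zero_le

theorem gradEnergy_le_setIntegral_iterPotential (hn : n + 1 ≤ p.T) :
    p.η / (16 * G) * gradEnergy μ U f F x₁ L G D p ζ ξ n
      ≤ ∫ ω in aliveSet U f F x₁ L G D p ζ ξ n,
        iterPotential U f F x₁ p (fun i => ζ i ω) (fun j => ξ j ω) n ∂μ := by
  rw [gradEnergy, ← integral_const_mul]
  refine integral_mono_ae ((h.integrableOn_sq_norm_iterGrad hn).const_mul _)
    ((h.isDrift_iterPotential hn).integrableOn le_rfl)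
    ((ae_restrict_iff' (h.measurableSet_aliveSet hn)).2 ?_)
  filter_upwards [h.ae_isRegularState hn] with ω hreg hω
  exact (hreg hω).sq_norm_iterGrad_le h.problem

theorem sum_energy_add_exitPotential_le (hn : n + 1 ≤ p.T) :
    p.η / (16 * G) * ∑ k ∈ Finset.range (n + 1), gradEnergy μ U f F x₁ L G D p ζ ξ k
      + p.lam / (16 * p.η) * ∑ k ∈ Finset.range n, stepEnergy μ U f F x₁ L G D p ζ ξ k
      + ∑ k ∈ Finset.range n, exitPotential μ U f F x₁ L G D p ζ ξ k
      ≤ f x₁ - sInf (f '' U) + p.η / (p.lam * p.β) * (σ ^ 2 / p.S₁)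
        + n * (2 * p.η * p.β * σ ^ 2 / p.lam) := by
  have hη := h.problem.tuned.η_pos
  have hlam := h.problem.tuned.lam_pos
  have hβ := h.problem.tuned.β_pos
  have hdrift := (h.isDrift_iterPotential hn).setIntegral_add_sum_le le_rfl
  have hinit := h.setIntegral_iterPotential_zero_le (by omega)
  have hlast := h.gradEnergy_le_setIntegral_iterPotential hn
  have hdecrease := Finset.sum_le_sum fun k (hk : k ∈ Finset.range n) =>
    h.le_setIntegral_decrease (k := k) (by have := Finset.mem_range.1 hk; omega)
      (p.η / (16 * G)) (p.lam / (16 * p.η)) (c := 2 * p.η * p.β * σ ^ 2 / p.lam) (by positivity)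
  rw [Finset.sum_sub_distrib, Finset.sum_add_distrib, ← Finset.mul_sum, ← Finset.mul_sum,
    Finset.sum_const, Finset.card_range, nsmul_eq_mul] at hdecrease
  rw [Finset.sum_range_succ, mul_add]
  simp only [exitPotential]
  linarith

theorem isDrift_correction (hn : n + 1 ≤ p.T) :
    IsDrift μ (aliveSet U f F x₁ L G D p ζ ξ)
      (fun k ω => ‖domCorrection U f F x₁ p (fun i => ζ i ω) (fun j => ξ j ω) k‖ ^ 6)
      (fun k ω => -(2 * 40 ^ 3 * (D ^ 2 * p.lam ^ 3 / (100 * G)) ^ 2 * (4 * L ^ 2)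
        * ‖iterStep U F x₁ p (fun i => ζ i ω) (fun j => ξ j ω) k‖ ^ 2))
      (fun k ω => 6 * (1 - p.β) ^ 6
        * inner ℝ (‖domCorrection U f F x₁ p (fun i => ζ i ω) (fun j => ξ j ω) k‖ ^ 4
            • domCorrection U f F x₁ p (fun i => ζ i ω) (fun j => ξ j ω) k)
          (iterNoise U f F x₁ p (fun i => ζ i ω) (fun j => ξ j ω) k 1)) n := by
  have hpast (k : ℕ) (hk : k < n) : Measurable[pastSigma p.T ζ ξ k]
      fun ω => ‖domCorrection U f F x₁ p (fun i => ζ i ω) (fun j => ξ j ω) k‖ ^ 4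
        • domCorrection U f F x₁ p (fun i => ζ i ω) (fun j => ξ j ω) k :=
    (by fun_prop : Continuous fun v : EuclideanSpace ℝ (Fin d) => ‖v‖ ^ 4 • v).measurable.comp
      (h.measurable_correction (by omega))
  exact
  { measurableSet k _ := h.measurableSet_aliveSet (by omega)
    subset k _ := aliveSet_anti k.le_succ
    aestronglyMeasurable k _ := (((h.measurable_correction (by omega)).mono
      (h.sampling.pastSigma_le k) le_rfl).norm.pow_const 6).aestronglyMeasurable
    integrableOn_zero := by simp [domCorrection]
    nonneg k _ := .of_forall fun _ _ => by positivity
    integrableOn_decrease k _ :=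
      ((h.integrableOn_sq_norm_iterStep (by omega)).const_mul _).neg
    integrableOn_noise k hk := by
      refine Integrable.const_mul (h.integrableOn_inner_iterNoise
        (K := (p.lam * D / 2) ^ 4 * (p.lam * D / 2)) (by omega)
        (h.measurableSet_aliveSet (by omega))
        ((hpast k hk).mono (h.sampling.pastSigma_le k) le_rfl) (.of_forall fun ω hω => ?_) _) _
      have hle := (hω k le_rfl).2.2
      have := (norm_nonneg _).trans hle
      rw [norm_smul, norm_pow, norm_norm]
      gcongr
    setIntegral_noise k hk := by
      rw [integral_const_mul, h.setIntegral_inner_iterNoise (by omega)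
        (h.measurableSet_aliveSet_pastSigma (by omega)) (hpast k hk), mul_zero]
    step_le k _ := by
      filter_upwards [h.ae_isNoiseBounded, h.ae_isRegularState (k := k) (by omega)]
        with ω hnoise hreg hω
      exact (hreg hω).correction_succ_le h.problem hnoise (by omega) }

theorem sum_exitCorrection_le (hn : n + 1 ≤ p.T) :
    ∑ k ∈ Finset.range n, exitCorrection μ U f F x₁ L G D p ζ ξ k
      ≤ 2 * 40 ^ 3 * (D ^ 2 * p.lam ^ 3 / (100 * G)) ^ 2 * (4 * L ^ 2)
        * ∑ k ∈ Finset.range n, stepEnergy μ U f F x₁ L G D p ζ ξ k := by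
  have hdrift := (h.isDrift_correction hn).setIntegral_add_sum_le le_rfl
  have hinit : ∫ ω in aliveSet U f F x₁ L G D p ζ ξ 0,
      ‖domCorrection U f F x₁ p (fun i => ζ i ω) (fun j => ξ j ω) 0‖ ^ 6 ∂μ = 0 := by
    simp [domCorrection]
  have hlast : 0 ≤ ∫ ω in aliveSet U f F x₁ L G D p ζ ξ n,
      ‖domCorrection U f F x₁ p (fun i => ζ i ω) (fun j => ξ j ω) n‖ ^ 6 ∂μ :=
    integral_nonneg fun _ => by positivity
  simp only [integral_neg, integral_const_mul, Finset.sum_neg_distrib, ← Finset.mul_sum] at hdrift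
  simp only [exitCorrection, stepEnergy]
  linarith

theorem measureReal_exit_le (hk : k + 2 ≤ p.T) :
    μ.real (aliveSet U f F x₁ L G D p ζ ξ k \ aliveSet U f F x₁ L G D p ζ ξ (k + 1))
      ≤ 6 * L / G ^ 2 * exitPotential μ U f F x₁ L G D p ζ ξ k
        + (2 / (p.lam * D)) ^ 6 * exitCorrection μ U f F x₁ L G D p ζ ξ k := by
  have hmeas := (h.measurableSet_aliveSet (k := k) (by omega)).diff
    (h.measurableSet_aliveSet (k := k + 1) hk)
  have hpotential := (((h.isDrift_iterPotential hk).integrableOn_succ k.lt_succ_self).mono_set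
    (Set.sdiff_subset (t := aliveSet U f F x₁ L G D p ζ ξ (k + 1)))).const_mul (6 * L / G ^ 2)
  have hcorrection := (((h.isDrift_correction hk).integrableOn_succ k.lt_succ_self).mono_set
    (Set.sdiff_subset (t := aliveSet U f F x₁ L G D p ζ ξ (k + 1)))).const_mul
      ((2 / (p.lam * D)) ^ 6)
  rw [exitPotential, exitCorrection, ← integral_const_mul, ← integral_const_mul,
    ← integral_add hpotential hcorrection, ← mul_one (μ.real _), ← smul_eq_mul,
    ← setIntegral_const]
  refine integral_mono_ae (integrable_const _) (hpotential.add hcorrection)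
    ((ae_restrict_iff' hmeas).2 ?_)
  filter_upwards [h.ae_isRegularState (k := k) (by omega)] with ω hreg hω
  exact (hreg hω.1).one_le_of_not_isAlive h.problem hω.1 hω.2

theorem measureReal_compl_aliveSet_le (hgap : f x₁ - sInf (f '' U) ≤ G ^ 2 / (6 * L))
    (hn : n + 1 ≤ p.T) :
    μ.real (aliveSet U f F x₁ L G D p ζ ξ n)ᶜ
      ≤ 6 * L / G ^ 2 * ∑ k ∈ Finset.range n, exitPotential μ U f F x₁ L G D p ζ ξ k
        + (2 / (p.lam * D)) ^ 6
          * ∑ k ∈ Finset.range n, exitCorrection μ U f F x₁ L G D p ζ ξ k := by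
  rw [measureReal_compl_eq_sum_sdiff (fun k hk => h.measurableSet_aliveSet (by omega))
    (fun k _ => aliveSet_anti k.le_succ) (h.aliveSet_zero hgap), Finset.mul_sum, Finset.mul_sum,
    ← Finset.sum_add_distrib]
  exact Finset.sum_le_sum fun k hk =>
    h.measureReal_exit_le (by have := Finset.mem_range.1 hk; omega)

end IsTunedRun

end Summation

/-! ### The convergence guarantee -/

section Convergence

variable {d : ℕ} {Ξ Ω : Type*}

section Definitions

variable (U : Set (EuclideanSpace ℝ (Fin d))) (f : EuclideanSpace ℝ (Fin d) → ℝ)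
  (F : EuclideanSpace ℝ (Fin d) → Ξ → ℝ) (x₁ : EuclideanSpace ℝ (Fin d)) (G ε : ℝ)
  (p : VRAdamInput) (ζ : Fin p.S₁ → Ξ) (ξ : ℕ → Ξ)

/-- The run on the samples `ζ`, `ξ` achieves what the convergence guarantee promises: the iterates
stay in the domain, their gradients are at most `G`, and the mean squared gradient is at most
`ε ^ 2`. -/
def IsSuccess : Prop :=
  (∀ t ∈ Finset.Icc 1 p.T, vrAdamIterate p (stochGrad F) x₁ ζ ξ t ∈ U ∧
      ‖gradient f (vrAdamIterate p (stochGrad F) x₁ ζ ξ t)‖ ≤ G) ∧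
    1 / (p.T : ℝ) * ∑ t ∈ Finset.Icc 1 p.T,
      ‖gradient f (vrAdamIterate p (stochGrad F) x₁ ζ ξ t)‖ ^ 2 ≤ ε ^ 2

end Definitions

variable {U : Set (EuclideanSpace ℝ (Fin d))} {f : EuclideanSpace ℝ (Fin d) → ℝ}
  {F : EuclideanSpace ℝ (Fin d) → Ξ → ℝ} {x₁ : EuclideanSpace ℝ (Fin d)} {p : VRAdamInput}
  {L₀ Lρ ρ L σ G D δ ε : ℝ} {n : ℕ}

section Pathwise

variable {ζ : Fin p.S₁ → Ξ} {ξ : ℕ → Ξ}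

theorem isSuccess_of_T_eq_zero (hT : p.T = 0) : IsSuccess U f F x₁ G ε p ζ ξ := by
  refine ⟨fun t ht => ?_, ?_⟩
  · have := Finset.mem_Icc.1 ht
    omega
  · simpa [hT] using sq_nonneg ε

theorem isSuccess_of_T_eq_one (hT : p.T = 1) (hx₁ : x₁ ∈ U) (hG : ‖gradient f x₁‖ ≤ G)
    (hε : ‖gradient f x₁‖ ^ 2 ≤ ε ^ 2) : IsSuccess U f F x₁ G ε p ζ ξ := by
  have hiter : vrAdamIterate p (stochGrad F) x₁ ζ ξ 1 = x₁ := rfl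
  rw [IsSuccess, hT, Finset.Icc_self, Nat.cast_one, div_one, one_mul, Finset.sum_singleton, hiter]
  refine ⟨fun t ht => ?_, hε⟩
  obtain rfl := Finset.mem_singleton.1 ht
  exact ⟨hx₁, hG⟩

theorem isSuccess_of_isRegularState (hT : n + 1 = p.T)
    (hreg : ∀ k ≤ n, IsRegularState U f σ G D p k (domState U F x₁ p ζ ξ k)
      (domCorrection U f F x₁ p ζ ξ k))
    (hsum : ∑ k ∈ Finset.range (n + 1), ‖iterGrad U f F x₁ p ζ ξ k‖ ^ 2 ≤ p.T * ε ^ 2) :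
    IsSuccess U f F x₁ G ε p ζ ξ := by
  have hiter (k : ℕ) (hk : k ≤ n) :
      vrAdamIterate p (stochGrad F) x₁ ζ ξ (k + 1) = (domState U F x₁ p ζ ξ k).x := by
    rw [vrAdamIterate, Nat.add_sub_cancel,
      vrAdamState_eq_domState (fun j hj => (hreg j hj).mem) k hk]
  have hsum_eq : ∑ t ∈ Finset.Icc 1 p.T, ‖gradient f (vrAdamIterate p (stochGrad F) x₁ ζ ξ t)‖ ^ 2
      = ∑ k ∈ Finset.range (n + 1), ‖iterGrad U f F x₁ p ζ ξ k‖ ^ 2 := by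
    rw [← hT, Finset.range_eq_Ico, ← Finset.Ico_add_one_right_eq_Icc,
      ← Finset.sum_Ico_add' _ 0 (n + 1) 1]
    refine Finset.sum_congr rfl fun k hk => ?_
    have hkn : k ≤ n := Nat.le_of_lt_succ (Finset.mem_Ico.1 hk).2
    rw [hiter k hkn, iterGrad_of_mem (hreg k hkn).mem]
  refine ⟨fun t ht => ?_, ?_⟩
  · obtain ⟨k, rfl⟩ := Nat.exists_eq_add_of_le' (Finset.mem_Icc.1 ht).1
    have hkn : k ≤ n := by have := (Finset.mem_Icc.1 ht).2; omega
    rw [hiter k hkn]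
    exact ⟨(hreg k hkn).mem, (hreg k hkn).gradient_le⟩
  · have hTpos : (0 : ℝ) < p.T := by exact_mod_cast (by omega : 0 < p.T)
    rwa [hsum_eq, one_div, inv_mul_le_iff₀ hTpos]

end Pathwise

variable [MeasurableSpace Ξ] [MeasurableSpace Ω]

namespace IsTunedRun

variable {μ : Measure Ω} {P : Measure Ξ} [IsProbabilityMeasure μ] [IsProbabilityMeasure P]
  {ζ : Fin p.S₁ → Ω → Ξ} {ξ : ℕ → Ω → Ξ}
  (h : IsTunedRun μ P U f F x₁ L₀ Lρ ρ L σ G D p ζ ξ) (hn : n + 1 ≤ p.T)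
  (hnoise : p.η / (p.lam * p.β) * (σ ^ 2 / p.S₁) + n * (2 * p.η * p.β * σ ^ 2 / p.lam)
    ≤ f x₁ - sInf (f '' U))
include h hn hnoise

theorem energies_le :
    p.η / (16 * G) * ∑ k ∈ Finset.range (n + 1), gradEnergy μ U f F x₁ L G D p ζ ξ k
        ≤ 2 * (f x₁ - sInf (f '' U)) ∧
      p.lam / (16 * p.η) * ∑ k ∈ Finset.range n, stepEnergy μ U f F x₁ L G D p ζ ξ k
        ≤ 2 * (f x₁ - sInf (f '' U)) ∧
      ∑ k ∈ Finset.range n, exitPotential μ U f F x₁ L G D p ζ ξ k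
        ≤ 2 * (f x₁ - sInf (f '' U)) := by
  have hη := h.problem.tuned.η_pos
  have hlam := h.problem.tuned.lam_pos
  have hG := h.problem.tuned.G_pos
  have htotal := h.sum_energy_add_exitPotential_le hn
  have hgrad : 0 ≤ p.η / (16 * G)
      * ∑ k ∈ Finset.range (n + 1), gradEnergy μ U f F x₁ L G D p ζ ξ k :=
    mul_nonneg (by positivity)
      (Finset.sum_nonneg fun _ _ => integral_nonneg fun _ => by positivity)
  have hstep : 0 ≤ p.lam / (16 * p.η)
      * ∑ k ∈ Finset.range n, stepEnergy μ U f F x₁ L G D p ζ ξ k :=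
    mul_nonneg (by positivity)
      (Finset.sum_nonneg fun _ _ => integral_nonneg fun _ => by positivity)
  have hexit : 0 ≤ ∑ k ∈ Finset.range n, exitPotential μ U f F x₁ L G D p ζ ξ k :=
    Finset.sum_nonneg fun _ _ => integral_nonneg fun _ => iterPotential_nonneg h.problem
  refine ⟨?_, ?_, ?_⟩ <;> linarith

theorem sum_gradEnergy_le : ∑ k ∈ Finset.range (n + 1), gradEnergy μ U f F x₁ L G D p ζ ξ k
    ≤ 32 * G * (f x₁ - sInf (f '' U)) / p.η := by
  have hG := h.problem.tuned.G_pos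
  have hle := (h.energies_le hn hnoise).1
  rw [div_mul_eq_mul_div, div_le_iff₀ (by positivity)] at hle
  rw [le_div_iff₀ h.problem.tuned.η_pos]
  linarith

theorem sum_stepEnergy_le : ∑ k ∈ Finset.range n, stepEnergy μ U f F x₁ L G D p ζ ξ k
    ≤ 32 * p.η * (f x₁ - sInf (f '' U)) / p.lam := by
  have hη := h.problem.tuned.η_pos
  have hle := (h.energies_le hn hnoise).2.1
  rw [div_mul_eq_mul_div, div_le_iff₀ (by positivity)] at hle
  rw [le_div_iff₀ h.problem.tuned.lam_pos]
  linarith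

section Gap

variable (hgap : 1000 * (L * (f x₁ - sInf (f '' U))) ≤ 7 * G ^ 2 * δ)
include hgap

theorem mul_sum_exitPotential_le :
    6 * L / G ^ 2 * ∑ k ∈ Finset.range n, exitPotential μ U f F x₁ L G D p ζ ξ k
      ≤ 84 / 1000 * δ := by
  have hL := h.problem.tuned.L_pos
  have hG := h.problem.tuned.G_pos
  have hexit := mul_le_mul_of_nonneg_left (h.energies_le hn hnoise).2.2 (by positivity : 0 ≤ 6 * L)
  rw [div_mul_eq_mul_div, div_le_iff₀ (by positivity)]
  linarith

theorem mul_sum_exitCorrection_le (hδ : 0 ≤ δ) :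
    (2 / (p.lam * D)) ^ 6 * ∑ k ∈ Finset.range n, exitCorrection μ U f F x₁ L G D p ζ ξ k
      ≤ 74 / 1000 * δ := by
  have hL := h.problem.tuned.L_pos
  have hG := h.problem.tuned.G_pos
  have hη := h.problem.tuned.η_pos
  have hlam := h.problem.tuned.lam_pos
  have hD := h.problem.tuned.one_le_D
  have : 0 < D := by linarith
  have hΔ := h.problem.objective.gap_nonneg h.mem
  have hstep := h.sum_stepEnergy_le hn hnoise
  set Δ := f x₁ - sInf (f '' U)
  calc (2 / (p.lam * D)) ^ 6 * ∑ k ∈ Finset.range n, exitCorrection μ U f F x₁ L G D p ζ ξ k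
      ≤ (2 / (p.lam * D)) ^ 6 * (2 * 40 ^ 3 * (D ^ 2 * p.lam ^ 3 / (100 * G)) ^ 2 * (4 * L ^ 2)
          * (32 * p.η * Δ / p.lam)) := by
        gcongr
        exact (h.sum_exitCorrection_le hn).trans (by gcongr)
    _ = 104857.6 * (p.η * L) * (L * Δ) / (p.lam * G ^ 2 * D ^ 2) := by field_simp; ring
    _ ≤ 104857.6 * (p.lam / 10000) * (7 * G ^ 2 * δ / 1000) / (p.lam * G ^ 2 * D ^ 2) := by
        gcongr
        · linarith [h.problem.tuned.η_le_lam]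
        · linarith
    _ = 104857.6 / 10000 * 7 / 1000 * δ / D ^ 2 := by field_simp
    _ ≤ 104857.6 / 10000 * 7 / 1000 * δ := div_le_self (by positivity) (one_le_pow₀ hD)
    _ ≤ 74 / 1000 * δ := by linarith

theorem measureReal_compl_aliveSet_le_mul (hδ : 0 ≤ δ) (hδ1 : δ ≤ 1) :
    μ.real (aliveSet U f F x₁ L G D p ζ ξ n)ᶜ ≤ 158 / 1000 * δ := by
  have hL := h.problem.tuned.L_pos
  have hG : 0 < G ^ 2 := pow_pos h.problem.tuned.G_pos 2
  have hgap' : f x₁ - sInf (f '' U) ≤ G ^ 2 / (6 * L) := by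
    rw [le_div_iff₀ (by positivity)]
    linarith [mul_le_of_le_one_right hG.le hδ1]
  linarith [h.measureReal_compl_aliveSet_le hgap' hn, h.mul_sum_exitPotential_le hn hnoise hgap,
    h.mul_sum_exitCorrection_le hn hnoise hgap hδ]

end Gap

theorem measureReal_sum_ge_le (hδ : 0 < δ) (hΔ : 0 < f x₁ - sInf (f '' U)) {M : ℝ}
    (hM : 1000 * G * (f x₁ - sInf (f '' U)) ≤ M * (p.η * δ)) :
    μ.real (aliveSet U f F x₁ L G D p ζ ξ n ∩ {ω | M ≤ ∑ k ∈ Finset.range (n + 1),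
        ‖iterGrad U f F x₁ p (fun i => ζ i ω) (fun j => ξ j ω) k‖ ^ 2}) ≤ 32 / 1000 * δ := by
  have hG := h.problem.tuned.G_pos
  have hη := h.problem.tuned.η_pos
  have hMpos : 0 < M := pos_of_mul_pos_left (hM.trans_lt' (by positivity)) (by positivity)
  have hmarkov := (h.mul_measureReal_sum_ge_le_sum_gradEnergy hn M).trans
    (h.sum_gradEnergy_le hn hnoise)
  refine le_of_mul_le_mul_left (hmarkov.trans ?_) hMpos
  rw [div_le_iff₀ hη]
  linarith

omit hn in
theorem ofReal_le_measure_isSuccess (hT : n + 1 = p.T) (hδ : 0 < δ) (hδ1 : δ < 1)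
    (hΔ : 0 < f x₁ - sInf (f '' U))
    (hgap : 1000 * (L * (f x₁ - sInf (f '' U))) ≤ 7 * G ^ 2 * δ)
    (hTε : 1000 * G * (f x₁ - sInf (f '' U)) ≤ p.T * ε ^ 2 * (p.η * δ)) :
    ENNReal.ofReal (1 - δ)
      ≤ μ {ω | IsSuccess U f F x₁ G ε p (fun i => ζ i ω) (fun s => ξ s ω)} := by
  have hn := hT.le
  have hdead := h.measureReal_compl_aliveSet_le_mul hn hnoise hgap hδ.le hδ1.le
  have hlarge := h.measureReal_sum_ge_le hn hnoise hδ hΔ hTε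
  set A := aliveSet U f F x₁ L G D p ζ ξ n
  set B := A ∩ {ω | p.T * ε ^ 2 ≤ ∑ k ∈ Finset.range (n + 1),
    ‖iterGrad U f F x₁ p (fun i => ζ i ω) (fun j => ξ j ω) k‖ ^ 2}
  have hgood : 1 - δ ≤ μ.real (A \ B) := by
    have hA : μ.real Aᶜ = 1 - μ.real A := probReal_compl_eq_one_sub (h.measurableSet_aliveSet hn)
    linarith [le_measureReal_sdiff (μ := μ) (s₁ := A) (s₂ := B)]
  calc ENNReal.ofReal (1 - δ) ≤ ENNReal.ofReal (μ.real (A \ B)) := ENNReal.ofReal_le_ofReal hgood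
    _ = μ (A \ B) := ofReal_measureReal
    _ ≤ _ := measure_mono_ae ?_
  have hreg : ∀ᵐ ω ∂μ, ∀ k ≤ n, ω ∈ aliveSet U f F x₁ L G D p ζ ξ k →
      IsRegularState U f σ G D p k (domState U F x₁ p (fun i => ζ i ω) (fun j => ξ j ω) k)
        (domCorrection U f F x₁ p (fun i => ζ i ω) (fun j => ξ j ω) k) :=
    ae_all_iff.2 fun k => Filter.eventually_imp_distrib_left.2 fun hk =>
      h.ae_isRegularState (by omega)
  filter_upwards [hreg] with ω hω hmem
  obtain ⟨halive, hnotB⟩ := hmem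
  exact isSuccess_of_isRegularState hT (fun k hk => hω k hk (aliveSet_anti hk halive))
    (le_of_not_ge fun hge => hnotB ⟨halive, hge⟩)

end IsTunedRun

end Convergence

/-! ### Consequences of admissibility -/

section Admissible

theorem mul_le_of_le_mul_extDiv {η c a b : ℝ} (hc : 0 ≤ c) (ha : 0 ≤ a) (hb : 0 ≤ b)
    (h : ENNReal.ofReal η ≤ ENNReal.ofReal c * extDiv a b) : η * b ≤ c * a := by
  rcases hb.eq_or_lt with rfl | hb
  · rw [mul_zero]
    positivity
  · rwa [extDiv, ← ENNReal.ofReal_div_of_pos hb, ← ENNReal.ofReal_mul hc,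
      ENNReal.ofReal_le_ofReal_iff (by positivity), mul_div_assoc', le_div_iff₀ hb] at h

theorem isEffSmooth_effSmooth {L₀ Lρ ρ G : ℝ} (hLρ : 0 ≤ Lρ) (hρ : 0 ≤ ρ) (hρ2 : ρ < 2) (hG : 0 < G)
    (hL₀ : 0 ≤ L₀) (hL : 0 < effSmooth L₀ Lρ ρ G) :
    IsEffSmooth L₀ Lρ ρ G (effSmooth L₀ Lρ ρ G) := by
  refine ⟨hLρ, hρ, hG, hL, ?_⟩
  have htwo : (2 : ℝ) ^ ρ < 4 :=
    (Real.rpow_lt_rpow_of_exponent_lt one_lt_two hρ2).trans_eq (by norm_num)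
  have hGρ : 0 < G ^ ρ := Real.rpow_pos_of_pos hG ρ
  rw [effSmooth] at hL ⊢
  rw [Real.mul_rpow zero_le_two hG.le]
  rcases hLρ.eq_or_lt with rfl | hLρ
  · linarith
  · linarith [mul_lt_mul_of_pos_left htwo (mul_pos hLρ hGρ)]

theorem IsObjective.effSmooth_pos {d : ℕ} {U : Set (EuclideanSpace ℝ (Fin d))}
    {f : EuclideanSpace ℝ (Fin d) → ℝ} {x : EuclideanSpace ℝ (Fin d)} {L₀ Lρ ρ G : ℝ}
    (hf : IsObjective U f) (hfs : IsGenSmoothOn U f L₀ Lρ ρ) (hL₀ : 0 ≤ L₀) (hLρ : 0 ≤ Lρ)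
    (hρ : 0 ≤ ρ) (hG : 0 < G) (hx : x ∈ U) (hgap : 0 < f x - sInf (f '' U)) :
    0 < effSmooth L₀ Lρ ρ G := by
  have : 0 < G ^ ρ := Real.rpow_pos_of_pos hG ρ
  rcases hL₀.eq_or_lt with rfl | hL₀
  · rcases hLρ.eq_or_lt with rfl | hLρ
    · exact absurd (hf.gap_eq_zero hfs hρ hx) hgap.ne'
    · rw [effSmooth]
      positivity
  · rw [effSmooth]
    positivity

namespace IsAdmissible

variable {c C : ℝ} {d : ℕ} {L₀ Lρ ρ σ Δ g δ ε G : ℝ} {p : VRAdamInput}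
  (h : IsAdmissible c C d L₀ Lρ ρ σ Δ g δ ε G p)
include h

theorem η_mul_le_G (hc : 0 ≤ c) (hL : 0 ≤ effSmooth L₀ Lρ ρ G) :
    p.η * effSmooth L₀ Lρ ρ G ≤ c * (G * √(p.β₂ / d)) := by
  have hG := h.G_pos
  refine mul_le_of_le_mul_extDiv hc (by positivity) hL (h.η_le.trans ?_)
  gcongr
  exact (min_le_right _ _).trans (min_le_left _ _)

theorem η_mul_le_lam (hc : 0 ≤ c) (hL : 0 ≤ effSmooth L₀ Lρ ρ G) :
    p.η * effSmooth L₀ Lρ ρ G ≤ c * p.lam := by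
  refine mul_le_of_le_mul_extDiv hc h.lam_pos.le hL (h.η_le.trans ?_)
  gcongr
  exact (min_le_right _ _).trans ((min_le_right _ _).trans (min_le_left _ _))

theorem η_mul_le_ε (hc : 0 ≤ c) (hL : 0 ≤ effSmooth L₀ Lρ ρ G) (hσ : 0 ≤ σ) (hε : 0 ≤ ε) :
    p.η * (σ * G * effSmooth L₀ Lρ ρ G) ≤ c * (p.lam ^ 2 * √δ * ε) := by
  have hG := h.G_pos
  refine mul_le_of_le_mul_extDiv hc (by positivity) (by positivity) (h.η_le.trans ?_)
  gcongr
  exact (min_le_right _ _).trans ((min_le_right _ _).trans ((min_le_right _ _).trans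
    (min_le_right _ _)))

theorem one_le_d (hc : 0 ≤ c) (hL : 0 < effSmooth L₀ Lρ ρ G) : 1 ≤ d := by
  refine Nat.one_le_iff_ne_zero.2 fun hd => ?_
  have hle := h.η_mul_le_G hc hL.le
  simp only [hd, Nat.cast_zero, div_zero, Real.sqrt_zero, mul_zero] at hle
  exact hle.not_gt (mul_pos h.η_pos hL)

theorem one_le_sqrt_div (hd : 1 ≤ d) : 1 ≤ √d / √p.β₂ := by
  rw [one_le_div (Real.sqrt_pos.2 h.β₂_pos)]
  exact Real.sqrt_le_sqrt (h.β₂_le_one.trans (by exact_mod_cast hd))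

theorem β_mul_pow_eq :
    p.β * p.lam ^ 3 = 1600 * effSmooth L₀ Lρ ρ G ^ 2 * G * p.η ^ 2 := by
  have hlam : (p.lam ^ (-(3 / 2) : ℝ)) ^ 2 * p.lam ^ 3 = 1 := by
    rw [← Real.rpow_natCast, ← Real.rpow_mul h.lam_pos.le, ← Real.rpow_natCast p.lam 3,
      ← Real.rpow_add h.lam_pos]
    norm_num
  have hG : √G ^ 2 = G := Real.sq_sqrt h.G_pos.le
  calc p.β * p.lam ^ 3
      = 1600 * effSmooth L₀ Lρ ρ G ^ 2 * √G ^ 2 * p.η ^ 2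
          * ((p.lam ^ (-(3 / 2) : ℝ)) ^ 2 * p.lam ^ 3) := by rw [h.β_eq]; ring
    _ = _ := by rw [hlam, hG, mul_one]

theorem mul_sqrt_div_le_G (hc : 0 ≤ c) (hc' : 10000 * c ≤ 1) (hL : 0 < effSmooth L₀ Lρ ρ G) :
    10000 * p.η * effSmooth L₀ Lρ ρ G * √(d / p.β₂) ≤ G := by
  have hβ₂ := h.β₂_pos
  have hdpos : (0 : ℝ) < d := by exact_mod_cast h.one_le_d hc hL
  have hinv : √(p.β₂ / d) * √(d / p.β₂) = 1 := by
    rw [← Real.sqrt_mul (by positivity), div_mul_div_cancel₀ hdpos.ne', div_self hβ₂.ne',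
      Real.sqrt_one]
  calc 10000 * p.η * effSmooth L₀ Lρ ρ G * √(d / p.β₂)
      = 10000 * (p.η * effSmooth L₀ Lρ ρ G) * √(d / p.β₂) := by ring
    _ ≤ 10000 * (c * (G * √(p.β₂ / d))) * √(d / p.β₂) := by
        gcongr 10000 * ?_ * _
        exact h.η_mul_le_G hc hL.le
    _ = 10000 * c * G * (√(p.β₂ / d) * √(d / p.β₂)) := by ring
    _ ≤ G := by
        rw [hinv, mul_one]
        exact mul_le_of_le_one_left h.G_pos.le hc'

theorem isTuned (hc : 0 ≤ c) (hc' : 10000 * c ≤ 1) (hL : 0 < effSmooth L₀ Lρ ρ G) (hσ : 0 ≤ σ) :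
    IsTuned d (effSmooth L₀ Lρ ρ G) σ G √(d / p.β₂) p := by
  have hG := h.G_pos
  have hlam := h.lam_pos
  have hβ₂ := h.β₂_pos
  have hd := h.one_le_d hc hL
  have hone : 1 ≤ √(d / p.β₂) :=
    (h.one_le_sqrt_div hd).trans_eq (Real.sqrt_div (Nat.cast_nonneg d) _).symm
  exact
  { L_pos := hL
    G_pos := hG
    lam_pos := hlam
    η_pos := h.η_pos
    σ_nonneg := hσ
    β₂_pos := hβ₂
    β₂_le_one := h.β₂_le_one
    one_le_D := hone
    sq_D := Real.sq_sqrt (by positivity)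
    lam_le := h.lam_le
    σ_le_G := h.sigma_le
    σ_le_D := by
      rw [Real.sqrt_div (Nat.cast_nonneg d), mul_div_assoc', le_div_iff₀ (Real.sqrt_pos.2 hβ₂)]
      exact h.sqrt_β₂_le.trans (le_mul_of_one_le_right hlam.le
        (Real.one_le_sqrt.2 (by exact_mod_cast hd)))
    sqrt_le := h.sqrt_β₂_le
    β_eq := h.β_mul_pow_eq
    β_le_one := h.β_le_one
    η_le_G := h.mul_sqrt_div_le_G hc hc' hL
    η_le_lam := by
      linarith [h.η_mul_le_lam hc hL.le, mul_le_of_le_one_left hlam.le hc'] }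

section Gap

variable (hC : 0 ≤ C) (hd : 1 ≤ d) (hΔ : 0 ≤ Δ) (hδ : 0 < δ)
include hC hd hΔ hδ

theorem mul_L₀_le (hL₀ : 0 ≤ L₀) : C * Δ * L₀ ≤ G ^ 2 * δ := by
  have hG := (Real.sqrt_le_left h.G_pos.le).1 h.L₀_le
  rw [← div_div, mul_div_assoc (_ * _) √_ √_, div_le_iff₀ hδ] at hG
  exact (le_mul_of_one_le_right (by positivity) (h.one_le_sqrt_div hd)).trans hG

theorem mul_Lρ_le (hLρ : 0 ≤ Lρ) (hρ2 : ρ < 2) : C * Δ * (Lρ * G ^ ρ) ≤ G ^ 2 * δ := by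
  have hGρ : 0 < G ^ ρ := Real.rpow_pos_of_pos h.G_pos ρ
  have hG : C * Δ * Lρ * √d / (√p.β₂ * δ) ≤ G ^ (2 - ρ) :=
    (Real.rpow_inv_le_iff_of_pos (by positivity) h.G_pos.le (by linarith)).1
      (by simpa only [one_div] using h.Lρ_le)
  rw [← div_div, mul_div_assoc (_ * _) √_ √_, div_le_iff₀ hδ] at hG
  calc C * Δ * (Lρ * G ^ ρ) = C * Δ * Lρ * G ^ ρ := by ring
    _ ≤ C * Δ * Lρ * (√d / √p.β₂) * G ^ ρ := by
        gcongr ?_ * _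
        exact le_mul_of_one_le_right (by positivity) (h.one_le_sqrt_div hd)
    _ ≤ G ^ (2 - ρ) * δ * G ^ ρ := by gcongr
    _ = G ^ (2 - ρ) * G ^ ρ * δ := by ring
    _ = G ^ 2 * δ := by rw [← Real.rpow_add h.G_pos, sub_add_cancel, Real.rpow_two]

theorem mul_effSmooth_mul_le (hL₀ : 0 ≤ L₀) (hLρ : 0 ≤ Lρ) (hρ2 : ρ < 2) :
    C * (effSmooth L₀ Lρ ρ G * Δ) ≤ 7 * G ^ 2 * δ := by
  rw [effSmooth]
  linarith [h.mul_L₀_le hC hd hΔ hδ hL₀, h.mul_Lρ_le hC hd hΔ hδ hLρ hρ2]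

end Gap

section IterationCount

variable (hδ : 0 < δ) (hε : 0 < ε)
include hδ hε

theorem mul_gap_le : C * G * Δ ≤ p.T * ε ^ 2 * (p.η * δ) := by
  have hη := h.η_pos
  have hceil : C * G * Δ / (p.η * δ * ε ^ 2) ≤ p.T := h.T_eq ▸ Nat.le_ceil _
  rw [div_le_iff₀ (by positivity)] at hceil
  linarith

theorem T_pos (hC : 0 < C) (hΔ : 0 < Δ) : 0 < p.T := by
  have hη := h.η_pos
  have hG := h.G_pos
  rw [h.T_eq, Nat.ceil_pos]
  positivity

theorem T_mul_le (hC : 0 ≤ C) (hΔ : 0 ≤ Δ) (hT : 2 ≤ p.T) :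
    p.T * (p.η * δ * ε ^ 2) ≤ 2 * (C * G * Δ) := by
  have hη := h.η_pos
  have hG := h.G_pos
  have hceil : (p.T : ℝ) < C * G * Δ / (p.η * δ * ε ^ 2) + 1 := by
    rw [h.T_eq]
    exact Nat.ceil_lt_add_one (by positivity)
  have hT' : (2 : ℝ) ≤ p.T := by exact_mod_cast hT
  rw [← le_div_iff₀ (by positivity), mul_div_assoc]
  linarith

end IterationCount

theorem batch_noise_le (hβ : 0 < p.β) (hT : 0 < p.T) :
    p.η / (p.lam * p.β) * (σ ^ 2 / p.S₁) ≤ p.T * (2 * p.η * p.β * σ ^ 2 / p.lam) := by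
  have hη := h.η_pos
  have hlam := h.lam_pos
  have : (0 : ℝ) < p.T := by exact_mod_cast hT
  have hS : (0 : ℝ) < p.S₁ := by exact_mod_cast h.S₁_pos
  have hle : 1 / (p.S₁ : ℝ) ≤ 2 * p.β ^ 2 * p.T := (one_div_le (by positivity) hS).1 h.S₁_ge
  calc p.η / (p.lam * p.β) * (σ ^ 2 / p.S₁)
      = p.η / (p.lam * p.β) * (σ ^ 2 * (1 / p.S₁)) := by ring
    _ ≤ p.η / (p.lam * p.β) * (σ ^ 2 * (2 * p.β ^ 2 * p.T)) := by gcongr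
    _ = _ := by field_simp

theorem total_noise_le (hc : 0 ≤ c) (hC : 0 ≤ C) (hσ : 0 ≤ σ) (hΔ : 0 ≤ Δ) (hδ : 0 < δ) (hε : 0 < ε)
    (hL : 0 ≤ effSmooth L₀ Lρ ρ G) (hT : 2 ≤ p.T) :
    p.T * (2 * p.η * p.β * σ ^ 2 / p.lam) ≤ 6400 * C * c ^ 2 * Δ := by
  have hη := h.η_pos
  have hG := h.G_pos
  have hlam := h.lam_pos
  set L := effSmooth L₀ Lρ ρ G
  have hβ : p.β = 1600 * L ^ 2 * G * p.η ^ 2 / p.lam ^ 3 := by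
    rw [eq_div_iff (by positivity)]
    exact h.β_mul_pow_eq
  have hTle : (p.T : ℝ) ≤ 2 * (C * G * Δ) / (p.η * δ * ε ^ 2) := by
    rw [le_div_iff₀ (by positivity)]
    exact h.T_mul_le hδ hε hC hΔ hT
  have hβ0 : 0 ≤ p.β := by rw [hβ]; positivity
  have hsq : (p.η * (σ * G * L)) ^ 2 ≤ c ^ 2 * (p.lam ^ 4 * δ * ε ^ 2) :=
    (pow_le_pow_left₀ (by positivity) (h.η_mul_le_ε hc hL hσ hε.le) 2).trans_eq
      (by rw [mul_pow, mul_pow, mul_pow, Real.sq_sqrt hδ.le]; ring)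
  calc p.T * (2 * p.η * p.β * σ ^ 2 / p.lam)
      ≤ 2 * (C * G * Δ) / (p.η * δ * ε ^ 2) * (2 * p.η * p.β * σ ^ 2 / p.lam) := by gcongr
    _ = 6400 * C * Δ / (p.lam ^ 4 * δ * ε ^ 2) * (p.η * (σ * G * L)) ^ 2 := by
        rw [hβ]; field_simp; ring
    _ ≤ 6400 * C * Δ / (p.lam ^ 4 * δ * ε ^ 2) * (c ^ 2 * (p.lam ^ 4 * δ * ε ^ 2)) := by gcongr
    _ = 6400 * C * c ^ 2 * Δ := by field_simp

end IsAdmissible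

section Success

variable {d : ℕ} {Ξ Ω : Type*} {U : Set (EuclideanSpace ℝ (Fin d))}
  {f : EuclideanSpace ℝ (Fin d) → ℝ} {F : EuclideanSpace ℝ (Fin d) → Ξ → ℝ}
  {x₁ : EuclideanSpace ℝ (Fin d)} {p : VRAdamInput} {L₀ Lρ ρ L σ G D δ ε : ℝ}

theorem IsTunedProblem.sq_norm_gradient_le_of_T_eq_one
    (hP : IsTunedProblem U f F L₀ Lρ ρ L σ G D p) (hx₁ : x₁ ∈ U) (hg₁ : ‖gradient f x₁‖ ≤ G)
    (hT : p.T = 1) (hδ1 : δ ≤ 1)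
    (hTε : 1000 * G * (f x₁ - sInf (f '' U)) ≤ p.T * ε ^ 2 * (p.η * δ)) :
    ‖gradient f x₁‖ ^ 2 ≤ ε ^ 2 := by
  have hη := hP.tuned.η_pos
  have hL := hP.tuned.L_pos
  have hG := hP.tuned.G_pos
  have hΔ := hP.objective.gap_nonneg hx₁
  have hgrad := hP.objective.sq_norm_gradient_le hP.smooth hP.effSmooth hx₁ (by linarith)
  set Δ := f x₁ - sInf (f '' U)
  rw [hT, Nat.cast_one, one_mul] at hTε
  have hηL : 10000 * p.η * L ≤ G :=
    (le_mul_of_one_le_right (by positivity) hP.tuned.one_le_D).trans hP.tuned.η_le_G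
  have hscaled : p.η * (10000000 * (L * Δ)) ≤ p.η * ε ^ 2 := by
    calc p.η * (10000000 * (L * Δ)) = 1000 * (10000 * p.η * L) * Δ := by ring
      _ ≤ 1000 * G * Δ := by gcongr
      _ ≤ ε ^ 2 * (p.η * δ) := hTε
      _ ≤ ε ^ 2 * (p.η * 1) := by gcongr
      _ = p.η * ε ^ 2 := by ring
  have : 0 ≤ L * Δ := by positivity
  linarith [le_of_mul_le_mul_left hscaled hη]

variable [MeasurableSpace Ξ] [MeasurableSpace Ω] {P : Measure Ξ} {μ : Measure Ω}
  [IsProbabilityMeasure μ] {ζ : Fin p.S₁ → Ω → Ξ} {ξ : ℕ → Ω → Ξ}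

theorem ofReal_le_measure_of_forall {A : Set Ω} (hδ : 0 ≤ δ) (hA : ∀ ω, ω ∈ A) :
    ENNReal.ofReal (1 - δ) ≤ μ A := by
  rw [Set.eq_univ_of_forall hA, measure_univ]
  exact ENNReal.ofReal_le_one.2 (by linarith)

theorem ofReal_le_measure_isSuccess_of_isAdmissible [IsProbabilityMeasure P] (hL₀ : 0 ≤ L₀)
    (hLρ : 0 ≤ Lρ) (hρ : 0 ≤ ρ) (hρ2 : ρ < 2) (hσ : 0 ≤ σ) (hδ : 0 < δ) (hδ1 : δ < 1) (hε : 0 < ε)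
    (hf : IsObjective U f) (hx₁ : x₁ ∈ U) (hfs : IsGenSmoothOn U f L₀ Lρ ρ)
    (hFs : ∀ s, IsGenSmoothOn U (fun x => F x s) L₀ Lρ ρ) (hN : IsBoundedNoise U f F P σ)
    (hI : IsIIDSampling μ P p.S₁ p.T ζ ξ)
    (h : IsAdmissible (1 / 10000) 1000 d L₀ Lρ ρ σ (f x₁ - sInf (f '' U)) ‖gradient f x₁‖ δ ε G p) :
    ENNReal.ofReal (1 - δ)
      ≤ μ {ω | IsSuccess U f F x₁ G ε p (fun i => ζ i ω) (fun s => ξ s ω)} := by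
  rcases (hf.gap_nonneg hx₁).eq_or_lt with hΔ | hΔ
  · exact ofReal_le_measure_of_forall hδ.le fun ω =>
      isSuccess_of_T_eq_zero (by rw [h.T_eq, ← hΔ]; simp)
  have hL := hf.effSmooth_pos hfs hL₀ hLρ hρ h.G_pos hx₁ hΔ
  have htuned := h.isTuned (by norm_num) (by norm_num) hL hσ
  have hP : IsTunedProblem U f F L₀ Lρ ρ (effSmooth L₀ Lρ ρ G) σ G √(d / p.β₂) p :=
    ⟨hf, hfs, hFs, isEffSmooth_effSmooth hLρ hρ hρ2 h.G_pos hL₀ hL, htuned⟩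
  have hg₁ : ‖gradient f x₁‖ ≤ G := by linarith [h.grad_le, norm_nonneg (gradient f x₁)]
  have hTpos := h.T_pos hδ hε (by norm_num) hΔ
  have hTε := h.mul_gap_le hδ hε
  obtain ⟨n, hn⟩ : ∃ n, n + 1 = p.T := ⟨p.T - 1, by omega⟩
  rcases (Nat.one_le_iff_ne_zero.2 hTpos.ne').eq_or_lt with hT | hT
  · exact ofReal_le_measure_of_forall hδ.le fun ω => isSuccess_of_T_eq_one hT.symm hx₁ hg₁
      (hP.sq_norm_gradient_le_of_T_eq_one hx₁ hg₁ hT.symm hδ1.le hTε)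
  · have hrun : IsTunedRun μ P U f F x₁ L₀ Lρ ρ (effSmooth L₀ Lρ ρ G) σ G √(d / p.β₂) p ζ ξ :=
      ⟨hP, hN, hI, hx₁, hg₁, h.S₁_pos⟩
    have hbatch := h.batch_noise_le htuned.β_pos hTpos
    have htotal := h.total_noise_le (by norm_num) (by norm_num) hσ hΔ.le hδ hε hL.le hT
    refine hrun.ofReal_le_measure_isSuccess (n := n) ?_ hn hδ hδ1 hΔ
      (h.mul_effSmooth_mul_le (by norm_num) (h.one_le_d (by norm_num) hL) hΔ.le hδ hL₀ hLρ hρ2) hTε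
    have hnT : (n : ℝ) * (2 * p.η * p.β * σ ^ 2 / p.lam)
        ≤ p.T * (2 * p.η * p.β * σ ^ 2 / p.lam) := by
      have hη := htuned.η_pos
      have hβ := htuned.β_pos
      have hlam := htuned.lam_pos
      gcongr
      omega
    linarith

end Success

end Admissible

/-! ### The gradient complexity -/

section Complexity

open Filter Topology

section StepSize

theorem eventually_mul_le_one (a : ℝ) : ∀ᶠ ε in 𝓝[>] (0 : ℝ), a * ε ≤ 1 := by
  have hlim : Tendsto (fun ε => a * ε) (𝓝[>] 0) (𝓝 (a * 0)) :=
    (continuous_const.mul continuous_id).continuousWithinAt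
  exact hlim.eventually_le_const (by rw [mul_zero]; exact one_pos)

theorem eventually_ofReal_mul_le (e : ℝ) {b : ℝ≥0∞} (hb : b ≠ 0) :
    ∀ᶠ ε in 𝓝[>] (0 : ℝ), ENNReal.ofReal (e * ε) ≤ b := by
  have hlim : Tendsto (fun ε => ENNReal.ofReal (e * ε)) (𝓝[>] 0) (𝓝 (ENNReal.ofReal (e * 0))) :=
    (ENNReal.continuous_ofReal.comp (continuous_const.mul continuous_id)).continuousWithinAt
  exact hlim.eventually_le_const <| by
    simpa only [mul_zero, ENNReal.ofReal_zero] using pos_iff_ne_zero.2 hb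

theorem ofReal_le_mul_extDiv {η c a b : ℝ} (hc : 0 < c) (ha : 0 < a) (hb : 0 ≤ b)
    (h : η * b ≤ c * a) : ENNReal.ofReal η ≤ ENNReal.ofReal c * extDiv a b := by
  rcases hb.eq_or_lt with rfl | hb
  · rw [extDiv, ENNReal.ofReal_zero, ENNReal.div_zero (ENNReal.ofReal_pos.2 ha).ne',
      ENNReal.mul_top (ENNReal.ofReal_pos.2 hc).ne']
    exact le_top
  · rw [extDiv, ← ENNReal.ofReal_div_of_pos hb, ← ENNReal.ofReal_mul hc.le]
    exact ENNReal.ofReal_le_ofReal (by rwa [mul_div_assoc', le_div_iff₀ hb])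

theorem extDiv_ne_zero {a : ℝ} (b : ℝ) (ha : 0 < a) : extDiv a b ≠ 0 :=
  (ENNReal.div_pos (ENNReal.ofReal_pos.2 ha).ne' ENNReal.ofReal_ne_top).ne'

theorem localRadius_ne_zero (L₀ Lρ ρ G : ℝ) : localRadius L₀ Lρ ρ G ≠ 0 := by
  rw [localRadius, ← pos_iff_ne_zero, lt_min_iff]
  refine ⟨(extDiv_ne_zero _ one_pos).bot_lt, ?_⟩
  split_ifs
  · exact ENNReal.zero_lt_top
  · exact (extDiv_ne_zero _ one_pos).bot_lt

theorem eventually_ofReal_mul_le_stepBound {c e L₀ Lρ ρ σ Δ δ G lam β₂ : ℝ} {d : ℕ} (hc : 0 < c)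
    (hd : 1 ≤ d) (hσ : 0 ≤ σ) (hδ : 0 < δ) (hG : 0 < G) (hlam : 0 < lam) (hβ₂ : 0 < β₂)
    (hL : 0 ≤ effSmooth L₀ Lρ ρ G)
    (he : e * (σ * G * effSmooth L₀ Lρ ρ G) ≤ c * (lam ^ 2 * √δ)) :
    ∀ᶠ ε in 𝓝[>] (0 : ℝ),
      ENNReal.ofReal (e * ε) ≤ ENNReal.ofReal c * stepBound d L₀ Lρ ρ σ Δ δ ε G lam β₂ := by
  have : (0 : ℝ) < d := by exact_mod_cast hd
  have hsqrt : 0 < √(β₂ / d) := Real.sqrt_pos.2 (by positivity)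
  have hc' : ENNReal.ofReal c ≠ 0 := (ENNReal.ofReal_pos.2 hc).ne'
  filter_upwards [
    eventually_ofReal_mul_le e (mul_ne_zero hc' (mul_ne_zero (localRadius_ne_zero L₀ Lρ ρ G)
      (ENNReal.ofReal_pos.2 hsqrt).ne')),
    eventually_ofReal_mul_le e (mul_ne_zero hc'
      (extDiv_ne_zero (effSmooth L₀ Lρ ρ G) (mul_pos hG hsqrt))),
    eventually_ofReal_mul_le e (mul_ne_zero hc' (extDiv_ne_zero (effSmooth L₀ Lρ ρ G) hlam)),
    eventually_ofReal_mul_le e (mul_ne_zero hc' (extDiv_ne_zero (β₂ * Δ * effSmooth L₀ Lρ ρ G ^ 2)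
      (by positivity : 0 < lam ^ 4 * d * δ))),
    self_mem_nhdsWithin] with ε hradius hG_le hlam_le hgap_le hε
  have hε : 0 < ε := hε
  have hε_le : e * ε * (σ * G * effSmooth L₀ Lρ ρ G) ≤ c * (lam ^ 2 * √δ * ε) := by
    linarith [mul_le_mul_of_nonneg_right he hε.le]
  simp only [stepBound, mul_min, le_min_iff]
  exact ⟨hradius, hG_le, hlam_le, hgap_le,
    ofReal_le_mul_extDiv hc (by positivity) (by positivity) hε_le⟩

end StepSize

section LinearStep

/-- The inputs of VRAdam with step size `e ε`, with `T` and `S₁` as small as is admissible (up to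
rounding). Here `a` stands for `C G Δ₁ / δ`. -/
noncomputable def linearStepInput (θ a e lam β₂ ε : ℝ) : VRAdamInput where
  β := θ ^ 2 * (e * ε) ^ 2
  β₂ := β₂
  η := e * ε
  lam := lam
  T := ⌈a / (e * ε ^ 3)⌉₊
  S₁ := ⌈1 / (2 * (θ ^ 2 * (e * ε) ^ 2) ^ 2 * ⌈a / (e * ε ^ 3)⌉₊)⌉₊ + 1

theorem inv_natCeil_le_inv {x : ℝ} (hx : 0 ≤ x) : (⌈x⌉₊ : ℝ)⁻¹ ≤ x⁻¹ := by
  rcases hx.eq_or_lt with rfl | hx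
  · simp
  · exact inv_anti₀ hx (Nat.le_ceil x)

theorem natCeil_sub_one_le {x : ℝ} (hx : 0 ≤ x) : ((⌈x⌉₊ - 1 : ℕ) : ℝ) ≤ x := by
  rcases Nat.eq_zero_or_pos ⌈x⌉₊ with hceil | hceil
  · simpa [hceil] using hx
  · rw [Nat.cast_sub hceil, Nat.cast_one]
    linarith [Nat.ceil_lt_add_one hx]

variable {θ a e lam β₂ : ℝ} (ha : 0 ≤ a) (he : 0 < e)
include ha he

theorem eventually_linearStepInput_S₁_le :
    ∀ᶠ ε in 𝓝[>] (0 : ℝ), ((linearStepInput θ a e lam β₂ ε).S₁ : ℝ) ≤ 3 * (1 / ε ^ 3) := by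
  filter_upwards [eventually_mul_le_one 1, eventually_mul_le_one (2 * θ ^ 4 * e ^ 3 * a)⁻¹,
    self_mem_nhdsWithin] with ε hε1 hM hε
  have hε : 0 < ε := hε
  rw [one_mul] at hε1
  have hbatch : 1 / (2 * (θ ^ 2 * (e * ε) ^ 2) ^ 2 * ⌈a / (e * ε ^ 3)⌉₊) ≤ 1 / ε ^ 3 := by
    calc 1 / (2 * (θ ^ 2 * (e * ε) ^ 2) ^ 2 * ⌈a / (e * ε ^ 3)⌉₊)
        = (2 * (θ ^ 2 * (e * ε) ^ 2) ^ 2)⁻¹ * (⌈a / (e * ε ^ 3)⌉₊ : ℝ)⁻¹ := by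
          rw [one_div, mul_inv]
      _ ≤ (2 * (θ ^ 2 * (e * ε) ^ 2) ^ 2)⁻¹ * (a / (e * ε ^ 3))⁻¹ := by
          gcongr _ * ?_
          exact inv_natCeil_le_inv (by positivity)
      _ = (2 * θ ^ 4 * e ^ 3 * a * ε)⁻¹ := by
          rw [← mul_inv]
          congr 1
          field_simp
      _ = (2 * θ ^ 4 * e ^ 3 * a)⁻¹ * ε * (1 / ε ^ 2) := by
          rw [mul_inv]
          field_simp
      _ ≤ 1 * (1 / ε ^ 2) := by gcongr
      _ ≤ 1 / ε ^ 3 := by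
          rw [one_mul]
          exact one_div_le_one_div_of_le (by positivity)
            (pow_le_pow_of_le_one hε.le hε1 (by norm_num))
  have hone : 1 ≤ 1 / ε ^ 3 := one_le_one_div (by positivity) (pow_le_one₀ hε.le hε1)
  have hceil := Nat.ceil_lt_add_one
    (by positivity : 0 ≤ 1 / (2 * (θ ^ 2 * (e * ε) ^ 2) ^ 2 * ⌈a / (e * ε ^ 3)⌉₊))
  simp only [linearStepInput, Nat.cast_add, Nat.cast_one]
  linarith

theorem eventually_gradientEvals_linearStepInput_le :
    ∀ᶠ ε in 𝓝[>] (0 : ℝ), ((linearStepInput θ a e lam β₂ ε).gradientEvals : ℝ)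
      ≤ (3 + 2 * (a / e)) * ε ^ (-3 : ℤ) := by
  filter_upwards [eventually_linearStepInput_S₁_le (θ := θ) (lam := lam) (β₂ := β₂) ha he,
    self_mem_nhdsWithin] with ε hS hε
  have hε : 0 < ε := hε
  have hT : (((linearStepInput θ a e lam β₂ ε).T - 1 : ℕ) : ℝ) ≤ a / (e * ε ^ 3) :=
    natCeil_sub_one_le (by positivity)
  calc ((linearStepInput θ a e lam β₂ ε).gradientEvals : ℝ)
      = (linearStepInput θ a e lam β₂ ε).S₁
          + 2 * ((linearStepInput θ a e lam β₂ ε).T - 1 : ℕ) := by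
        simp only [VRAdamInput.gradientEvals, Nat.cast_add, Nat.cast_mul, Nat.cast_ofNat]
    _ ≤ 3 * (1 / ε ^ 3) + 2 * (a / (e * ε ^ 3)) := by gcongr
    _ = (3 + 2 * (a / e)) * (1 / ε ^ 3) := by field_simp
    _ = _ := by rw [zpow_neg, one_div]; norm_cast

end LinearStep

section Threshold

/-- The lower bounds on `G` required by admissibility, with `s` in the place of `√d`. -/
structure IsGradThreshold (C s L₀ Lρ ρ σ Δ g δ lam β₂ G : ℝ) : Prop where
  lam_le : 2 * lam ≤ G
  sigma_le : 2 * σ ≤ G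
  grad_le : 2 * g ≤ G
  L₀_le : √(C * Δ * L₀ * s / (√β₂ * δ)) ≤ G
  Lρ_le : (C * Δ * Lρ * s / (√β₂ * δ)) ^ (1 / (2 - ρ)) ≤ G

theorem exists_isGradThreshold (C s L₀ Lρ ρ σ Δ g δ lam β₂ : ℝ) :
    ∃ G, IsGradThreshold C s L₀ Lρ ρ σ Δ g δ lam β₂ G :=
  ⟨2 * lam ⊔ (2 * σ ⊔ (2 * g ⊔ (√(C * Δ * L₀ * s / (√β₂ * δ))
    ⊔ (C * Δ * Lρ * s / (√β₂ * δ)) ^ (1 / (2 - ρ))))),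
    by constructor <;> simp only [le_sup_iff, le_refl, true_or, or_true]⟩

variable {c C x L₀ Lρ ρ σ Δ g δ lam β₂ G : ℝ}

theorem IsGradThreshold.mul (h : IsGradThreshold C 1 L₀ Lρ ρ σ Δ g δ lam β₂ G) (hC : 0 ≤ C)
    (hL₀ : 0 ≤ L₀) (hLρ : 0 ≤ Lρ) (hρ : 0 ≤ ρ) (hρ2 : ρ < 2) (hΔ : 0 ≤ Δ) (hδ : 0 ≤ δ)
    (hG : 0 ≤ G) (hx : 1 ≤ x) :
    IsGradThreshold C (x ^ (2 - ρ)) L₀ Lρ ρ σ Δ g δ lam β₂ (G * x) := by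
  have hle : G ≤ G * x := le_mul_of_one_le_right hG hx
  have hx0 : 0 ≤ x := by linarith
  refine ⟨h.lam_le.trans hle, h.sigma_le.trans hle, h.grad_le.trans hle, ?_, ?_⟩
  · have hsqrt : √(x ^ (2 - ρ)) ≤ x := by
      rw [Real.sqrt_le_left hx0, ← Real.rpow_two]
      exact Real.rpow_le_rpow_of_exponent_le hx (by linarith)
    have hbase := h.L₀_le
    rw [mul_one] at hbase
    rw [mul_div_right_comm, Real.sqrt_mul (by positivity)]
    gcongr
  · have hbase := h.Lρ_le
    rw [mul_one] at hbase
    rw [mul_div_right_comm, Real.mul_rpow (by positivity) (by positivity), ← Real.rpow_mul hx0,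
      mul_one_div_cancel (by linarith), Real.rpow_one]
    gcongr

theorem effSmooth_nonneg (hL₀ : 0 ≤ L₀) (hLρ : 0 ≤ Lρ) (hG : 0 ≤ G) :
    0 ≤ effSmooth L₀ Lρ ρ G := by
  rw [effSmooth]
  positivity

theorem effSmooth_mul_add_one_le (hL₀ : 0 ≤ L₀) (hρ : 0 ≤ ρ) (hG : 0 ≤ G) (hx : 1 ≤ x) :
    effSmooth L₀ Lρ ρ (G * x) + 1 ≤ (effSmooth L₀ Lρ ρ G + 1) * x ^ ρ := by
  have hone : 1 ≤ x ^ ρ := Real.one_le_rpow hx hρ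
  have hconst : 3 * L₀ + 1 ≤ (3 * L₀ + 1) * x ^ ρ := le_mul_of_one_le_right (by positivity) hone
  rw [effSmooth, effSmooth, Real.mul_rpow hG (by linarith)]
  linarith

/-- The factor of `ε⁻³` in the gradient complexity when the gradients are bounded by `G`. -/
noncomputable def complexityFactor (c C L₀ Lρ ρ σ Δ δ lam G : ℝ) : ℝ :=
  3 + 2 * (C * Δ * (σ + 1) / (δ * (c * lam ^ 2 * √δ)) * (G ^ 2 * (effSmooth L₀ Lρ ρ G + 1)))

theorem complexityFactor_mul_le (hc : 0 ≤ c) (hC : 0 ≤ C) (hL₀ : 0 ≤ L₀) (hρ : 0 ≤ ρ)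
    (hσ : 0 ≤ σ) (hΔ : 0 ≤ Δ) (hδ : 0 ≤ δ) (hG : 0 ≤ G) (hx : 1 ≤ x) :
    complexityFactor c C L₀ Lρ ρ σ Δ δ lam (G * x)
      ≤ complexityFactor c C L₀ Lρ ρ σ Δ δ lam G * x ^ (2 + ρ) := by
  simp only [complexityFactor]
  set B := C * Δ * (σ + 1) / (δ * (c * lam ^ 2 * √δ))
  have : 0 ≤ B := by positivity
  have hsq : x ^ 2 * x ^ ρ = x ^ (2 + ρ) := by
    rw [Real.rpow_add (by linarith), Real.rpow_two]
  calc 3 + 2 * (B * ((G * x) ^ 2 * (effSmooth L₀ Lρ ρ (G * x) + 1)))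
      ≤ 3 * x ^ (2 + ρ)
          + 2 * (B * ((G * x) ^ 2 * ((effSmooth L₀ Lρ ρ G + 1) * x ^ ρ))) := by
        gcongr
        · exact le_mul_of_one_le_right (by norm_num) (Real.one_le_rpow hx (by linarith))
        · exact effSmooth_mul_add_one_le hL₀ hρ hG hx
    _ = (3 + 2 * (B * (G ^ 2 * (effSmooth L₀ Lρ ρ G + 1)))) * x ^ (2 + ρ) := by
        rw [← hsq]
        ring

theorem exists_one_le_rpow_two_sub_eq_sqrt (hρ2 : ρ < 2) {d : ℕ} (hd : 1 ≤ d) :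
    ∃ x : ℝ, 1 ≤ x ∧ x ^ (2 - ρ) = √d ∧
      x ^ (2 + ρ) = (d : ℝ) ^ ((2 + ρ) / (2 * (2 - ρ))) := by
  have hd1 : (1 : ℝ) ≤ d := by exact_mod_cast hd
  have hd0 : (0 : ℝ) ≤ d := by linarith
  have h2ρ : 0 < 2 - ρ := by linarith
  refine ⟨(d : ℝ) ^ (1 / (2 * (2 - ρ))), Real.one_le_rpow hd1 (by positivity), ?_, ?_⟩
  · rw [Real.sqrt_eq_rpow, ← Real.rpow_mul hd0]
    congr 1
    field_simp
  · rw [← Real.rpow_mul hd0, one_div_mul_eq_div]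

theorem stepSlope_mul_le (hc : 0 ≤ c) (hσ : 0 ≤ σ) (hL : 0 ≤ effSmooth L₀ Lρ ρ G) (hG : 0 < G) :
    c * lam ^ 2 * √δ / ((σ + 1) * G * (effSmooth L₀ Lρ ρ G + 1)) * (σ * G * effSmooth L₀ Lρ ρ G)
      ≤ c * (lam ^ 2 * √δ) := by
  rw [div_mul_eq_mul_div, div_le_iff₀ (by positivity), mul_assoc c]
  gcongr <;> linarith

theorem IsGradThreshold.eventually_exists_isAdmissible {d : ℕ}
    (h : IsGradThreshold C √d L₀ Lρ ρ σ Δ g δ lam β₂ G) (hc : 0 < c) (hC : 0 ≤ C) (hd : 1 ≤ d)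
    (hL₀ : 0 ≤ L₀) (hLρ : 0 ≤ Lρ) (hσ : 0 ≤ σ) (hΔ : 0 ≤ Δ) (hδ : 0 < δ) (hlam : 0 < lam)
    (hβ₂ : 0 < β₂) (hβ₂1 : β₂ ≤ 1) (hσβ : 2 * σ * √β₂ ≤ lam) :
    ∀ᶠ ε in 𝓝[>] (0 : ℝ), ∃ p : VRAdamInput, p.lam = lam ∧ p.β₂ = β₂ ∧
      IsAdmissible c C d L₀ Lρ ρ σ Δ g δ ε G p ∧
      (p.gradientEvals : ℝ) ≤ complexityFactor c C L₀ Lρ ρ σ Δ δ lam G * ε ^ (-3 : ℤ) := by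
  have hG : 0 < G := by linarith [h.lam_le]
  have hL := effSmooth_nonneg (ρ := ρ) hL₀ hLρ hG.le
  set θ := 40 * effSmooth L₀ Lρ ρ G * √G * lam ^ (-(3 / 2) : ℝ)
  set e := c * lam ^ 2 * √δ / ((σ + 1) * G * (effSmooth L₀ Lρ ρ G + 1)) with he_def
  have he : 0 < e := by positivity
  filter_upwards [
    eventually_gradientEvals_linearStepInput_le (θ := θ) (a := C * G * Δ / δ) (lam := lam)
      (β₂ := β₂) (by positivity) he,
    eventually_ofReal_mul_le_stepBound (Δ := Δ) hc hd hσ hδ hG hlam hβ₂ hL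
      (stepSlope_mul_le hc.le hσ hL hG),
    eventually_mul_le_one (θ * e), self_mem_nhdsWithin] with ε hevals hstep hθ hε
  have hε : 0 < ε := hε
  refine ⟨linearStepInput θ (C * G * Δ / δ) e lam β₂ ε, rfl, rfl,
    { h with
      lam_pos := hlam
      G_pos := hG
      β₂_pos := hβ₂
      β₂_le_one := hβ₂1
      sqrt_β₂_le := hσβ
      β_eq := rfl
      β_le_one := by
        rw [linearStepInput, ← mul_pow, ← mul_assoc]
        exact pow_le_one₀ (by positivity) hθ
      η_pos := mul_pos he hε
      η_le := hstep
      T_eq := congrArg Nat.ceil (by simp only [linearStepInput]; field_simp)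
      S₁_pos := Nat.le_add_left 1 _
      S₁_ge := (Nat.le_ceil _).trans (Nat.cast_le.2 (Nat.le_succ _)) },
    hevals.trans_eq ?_⟩
  rw [complexityFactor, he_def]
  field_simp

theorem exists_isAdmissible_gradientEvals_le (hc : 0 < c) (hC : 0 ≤ C) (hL₀ : 0 ≤ L₀)
    (hLρ : 0 ≤ Lρ) (hρ : 0 ≤ ρ) (hρ2 : ρ < 2) (hσ : 0 ≤ σ) (hΔ : 0 ≤ Δ) (hδ : 0 < δ)
    (hlam : 0 < lam) (hβ₂ : 0 < β₂) (hβ₂1 : β₂ ≤ 1) (hσβ : 2 * σ * √β₂ ≤ lam) :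
    ∃ K : ℝ, ∀ d : ℕ, 1 ≤ d → ∃ ε₀ : ℝ, 0 < ε₀ ∧ ∀ ε : ℝ, 0 < ε → ε ≤ ε₀ →
      ∃ (G : ℝ) (p : VRAdamInput), p.lam = lam ∧ p.β₂ = β₂ ∧
        IsAdmissible c C d L₀ Lρ ρ σ Δ g δ ε G p ∧
        (p.gradientEvals : ℝ) ≤ K * (d : ℝ) ^ ((2 + ρ) / (2 * (2 - ρ))) * ε ^ (-3 : ℤ) := by
  obtain ⟨G, hthr⟩ := exists_isGradThreshold C 1 L₀ Lρ ρ σ Δ g δ lam β₂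
  have hG : 0 < G := by linarith [hthr.lam_le]
  refine ⟨complexityFactor c C L₀ Lρ ρ σ Δ δ lam G, fun d hd => ?_⟩
  obtain ⟨x, hx, hsqrt, hpow⟩ := exists_one_le_rpow_two_sub_eq_sqrt hρ2 hd
  have hmul := hthr.mul hC hL₀ hLρ hρ hρ2 hΔ hδ.le hG.le hx
  rw [hsqrt] at hmul
  obtain ⟨ε₀, hε₀, hadm⟩ := mem_nhdsGT_iff_exists_Ioc_subset.1
    (hmul.eventually_exists_isAdmissible hc hC hd hL₀ hLρ hσ hΔ hδ hlam hβ₂ hβ₂1 hσβ)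
  refine ⟨ε₀, hε₀, fun ε hε hεle => ?_⟩
  obtain ⟨p, hplam, hpβ₂, hp, hevals⟩ := hadm ⟨hε, hεle⟩
  refine ⟨G * x, p, hplam, hpβ₂, hp, hevals.trans ?_⟩
  rw [← hpow]
  gcongr
  exact complexityFactor_mul_le hc.le hC hL₀ hρ hσ hΔ hδ.le hG.le hx

end Threshold

end Complexity

theorem mainTheorem3 :
    ∃ c C : ℝ, 0 < c ∧ 0 < C ∧
      -- the convergence guarantee
      (∀ (d : ℕ) (L₀ Lρ ρ σ δ ε G : ℝ) (p : VRAdamInput)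
        (U : Set (EuclideanSpace ℝ (Fin d))) (f : EuclideanSpace ℝ (Fin d) → ℝ)
        (x₁ : EuclideanSpace ℝ (Fin d))
        (Ξ : Type*) [MeasurableSpace Ξ] (P : Measure Ξ) [IsProbabilityMeasure P]
        (F : EuclideanSpace ℝ (Fin d) → Ξ → ℝ)
        (Ω : Type*) [MeasurableSpace Ω] (μ : Measure Ω) [IsProbabilityMeasure μ]
        (ζ : Fin p.S₁ → Ω → Ξ) (ξ : ℕ → Ω → Ξ),
        0 ≤ L₀ → 0 ≤ Lρ → 0 ≤ ρ → ρ < 2 → 0 ≤ σ → 0 < δ → δ < 1 → 0 < ε →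
        IsObjective U f → x₁ ∈ U →
        IsGenSmoothOn U f L₀ Lρ ρ →
        (∀ s : Ξ, IsGenSmoothOn U (fun x => F x s) L₀ Lρ ρ) →
        IsBoundedNoise U f F P σ →
        IsIIDSampling μ P p.S₁ p.T ζ ξ →
        IsAdmissible c C d L₀ Lρ ρ σ (f x₁ - sInf (f '' U)) ‖gradient f x₁‖ δ ε G p →
        let x : ℕ → Ω → EuclideanSpace ℝ (Fin d) := fun t ω =>
          vrAdamIterate p (stochGrad F) x₁ (fun i => ζ i ω) (fun s => ξ s ω) t
        ENNReal.ofReal (1 - δ) ≤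
          μ {ω | (∀ t ∈ Finset.Icc 1 p.T, x t ω ∈ U ∧ ‖gradient f (x t ω)‖ ≤ G) ∧
            1 / (p.T : ℝ) * ∑ t ∈ Finset.Icc 1 p.T, ‖gradient f (x t ω)‖ ^ 2 ≤ ε ^ 2}) ∧
      -- the gradient complexity
      (∀ L₀ Lρ ρ σ Δ₁ g₁ δ lam β₂ : ℝ,
        0 ≤ L₀ → 0 ≤ Lρ → 0 ≤ ρ → ρ < 2 → 0 ≤ σ → 0 ≤ Δ₁ → 0 ≤ g₁ → 0 < δ → δ < 1 →
        0 < lam → 0 < β₂ → β₂ ≤ 1 → 2 * σ * √β₂ ≤ lam →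
        ∃ K : ℝ, ∀ d : ℕ, 1 ≤ d → ∃ ε₀ : ℝ, 0 < ε₀ ∧ ∀ ε : ℝ, 0 < ε → ε ≤ ε₀ →
          ∃ (G : ℝ) (p : VRAdamInput), p.lam = lam ∧ p.β₂ = β₂ ∧
            IsAdmissible c C d L₀ Lρ ρ σ Δ₁ g₁ δ ε G p ∧
            (p.gradientEvals : ℝ) ≤
              K * (d : ℝ) ^ ((2 + ρ) / (2 * (2 - ρ))) * ε ^ (-3 : ℤ)) := by
  refine ⟨1 / 10000, 1000, by norm_num, by norm_num, ?_, ?_⟩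
  · intro d L₀ Lρ ρ σ δ ε G p U f x₁ Ξ _ P _ F Ω _ μ _ ζ ξ hL₀ hLρ hρ hρ2 hσ hδ hδ1 hε hf hx₁ hfs
      hFs hN hI hadm
    exact ofReal_le_measure_isSuccess_of_isAdmissible hL₀ hLρ hρ hρ2 hσ hδ hδ1 hε hf hx₁ hfs hFs
      hN hI hadm
  · intro L₀ Lρ ρ σ Δ₁ g₁ δ lam β₂ hL₀ hLρ hρ hρ2 hσ hΔ _ hδ _ hlam hβ₂ hβ₂1 hσβ
    exact exists_isAdmissible_gradientEvals_le (by norm_num) (by norm_num) hL₀ hLρ hρ hρ2 hσ hΔ hδ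
      hlam hβ₂ hβ₂1 hσβ
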